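/- Let $R$ be a nonzero finite dimensional unital associative algebra over $\mathbb C$ and let $e_1,\dots,e_m$ be a complete set of primitive orthogonal idempotents of $R$ (so $1=e_1+\cdots+e_m$). Let $\mathcal D(R)$ be the algebra of $R$-valued differential operators on $\mathbb C$ with rational coefficients. The decorated adelic Grassmannian $\widetilde{\mathrm{Gr}}^{\mathrm{ad}}(R)$ is the set of functions $\Phi(x,z)=P(x,\partial_x)\exp(xz)$, where $P\in\mathcal D(R)$ is monic and right-divides in $\mathcal D(R)$ a monic $R$-valued differential operator with constant coefficients. We say that $\Phi$ corresponds to the right $R$-submodule $V$ if $V=\ker P$, the kernel in the $R$-valued meromorphic functions on $\mathbb C$. Order: for $\Phi=P\exp(xz)$ and $\Psi=S\exp(xz)$ in $\widetilde{\mathrm{Gr}}^{\mathrm{ad}}(R)$ put $\Phi\prec\Psi$ if $S=P\prod_{j=1}^{l}\big(\partial_x-\sum_k\gamma_{kj}e_k\big)$ for some $l\ge 1$ and $\gamma_{kj}\in\mathbb C$; if this holds with $l=1$, $\Psi$ is an immediate successor of $\Phi$. Normalization: if $\ker P$ has a right $R$-basis $F_j=\sum_k p_{kj}(x)\exp(\alpha_{kj}x)e_k$,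 $1\le j\le l$, with $p_{kj}\in R[x]$ and $\alpha_{kj}\in\mathbb C$, then $\Phi(x,z)\cdot\big[\sum_k\prod_j(z-\alpha_{kj})\,e_k\big]^{-1}$ is called a normalization of $\Phi$. The adelic Grassmannian $\mathrm{Gr}^{\mathrm{ad}}(R)$ is the set of normalizations of points of $\widetilde{\mathrm{Gr}}^{\mathrm{ad}}(R)$ in which all normalizations of one and the same $\Phi$ are identified, that is, the quotient of $\widetilde{\mathrm{Gr}}^{\mathrm{ad}}(R)$ by the equivalence relation generated by "having a normalization in common"; $\pi:\widetilde{\mathrm{Gr}}^{\mathrm{ad}}(R)\to\mathrm{Gr}^{\mathrm{ad}}(R)$ is the canonical map. The operators $F_A$: for a $\mathbb C$-linear operator $A$ on $R$ let $R=U_0\oplus U_1$ be the $A$-invariant decomposition with $A|_{U_0}$ nilpotent and $A|_{U_1}$ invertible, and let $F_A:R[x]\to R[x]$ be the linear operator with $F_A(u)=\exp(-Ax)\int_0^x\exp(At)u(t)\,dt$ for $u\in U_0[x]$ and $F_A(u)=\sum_{k\ge0}(-1)^kA^{-k-1}u^{(k)}(x)$ for $u\in U_1[x]$. Theorem. The relation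 $\prec$ is a strict partial order on $\widetilde{\mathrm{Gr}}^{\mathrm{ad}}(R)$, every $\Phi\in\widetilde{\mathrm{Gr}}^{\mathrm{ad}}(R)$ has a normalization, and the following hold. (1) For $\Phi,\Psi\in\widetilde{\mathrm{Gr}}^{\mathrm{ad}}(R)$ one has $\pi(\Phi)=\pi(\Psi)$ if and only if $\Phi$ and $\Psi$ have a normalization in common. The fiber of $\pi$ containing $\Phi$ consists of all $\Psi\in\widetilde{\mathrm{Gr}}^{\mathrm{ad}}(R)$ such that $\Phi$ and $\Psi$ have a common successor, i.e. $\Phi\prec\Theta$ and $\Psi\prec\Theta$ for some $\Theta\in\widetilde{\mathrm{Gr}}^{\mathrm{ad}}(R)$. (2) The immediate successors of $\Phi=P\exp(xz)$ are parametrized bijectively by $\gamma=(\gamma_1,\dots,\gamma_m)\in\mathbb C^m$, the one for $\gamma$ being $P\,(\partial_x-\gamma_1e_1-\cdots-\gamma_me_m)\exp(xz)$. If $\Phi$ corresponds to $$V=\bigoplus_{k=1}^n p_k(x)\exp(\alpha_kx)\,e_{i_k}R,\qquad p_k\in R[x],\ \alpha_k\in\mathbb C,$$ then the immediate successor for $\gamma$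 corresponds to $$V_\gamma=\Big(\bigoplus_{i=1}^m\exp(\gamma_ix)\,e_iR\Big)\oplus\Big(\bigoplus_{k=1}^nF_{A_{\alpha_k}}\big(p_k(x)e_{i_k}\big)\exp(\alpha_kx)R\Big),$$ where $A_\alpha$ is the operator on $R$ of left multiplication by $(\alpha-\gamma_1)e_1+\cdots+(\alpha-\gamma_m)e_m$, and the sum is direct. -/

import Mathlib

open Polynomial TensorProduct Filter

noncomputable section

/-! ## Scalar meromorphic functions on the complex plane -/

/-- The algebra of functions `ℂ → ℂ` that are meromorphic at every point
(with arbitrary values at the poles). -/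
def MerFun : Subalgebra ℂ (ℂ → ℂ) where
  carrier := {f | Meromorphic f}
  mul_mem' := fun hf hg => Meromorphic.mul hf hg
  add_mem' := fun hf hg => Meromorphic.add hf hg
  algebraMap_mem' := fun c => Meromorphic.const c

/-- Functions that vanish off a closed discrete set. -/
def nullIdeal : Ideal MerFun where
  carrier := {f | (f : ℂ → ℂ) =ᶠ[codiscrete ℂ] 0}
  add_mem' := by
    intro f g hf hg
    show ((f + g : MerFun) : ℂ → ℂ) =ᶠ[codiscrete ℂ] 0
    filter_upwards [show (f : ℂ → ℂ) =ᶠ[codiscrete ℂ] 0 from hf,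
      show (g : ℂ → ℂ) =ᶠ[codiscrete ℂ] 0 from hg] with x h1 h2
    simp [h1, h2]
  zero_mem' := by
    show ((0 : MerFun) : ℂ → ℂ) =ᶠ[codiscrete ℂ] 0
    rfl
  smul_mem' := by
    intro c f hf
    show ((c * f : MerFun) : ℂ → ℂ) =ᶠ[codiscrete ℂ] 0
    filter_upwards [show (f : ℂ → ℂ) =ᶠ[codiscrete ℂ] 0 from hf] with x h1
    simp [h1]

/-- The algebra of meromorphic functions on `ℂ`: two functions are identified when they
agree off a closed discrete set. -/
def Mer : Type := MerFun ⧸ nullIdeal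

namespace Mer

instance : CommRing Mer := inferInstanceAs (CommRing (MerFun ⧸ nullIdeal))

instance : Algebra ℂ Mer := inferInstanceAs (Algebra ℂ (MerFun ⧸ nullIdeal))

/-- The class of a meromorphic function. -/
def mk (f : ℂ → ℂ) (hf : Meromorphic f) : Mer :=
  Ideal.Quotient.mk nullIdeal ⟨f, hf⟩

theorem mk_eq_mk_iff {f g : ℂ → ℂ} (hf : Meromorphic f) (hg : Meromorphic g) :
    mk f hf = mk g hg ↔ f =ᶠ[codiscrete ℂ] g := by
  unfold mk
  refine (Ideal.Quotient.mk_eq_mk_iff_sub_mem _ _).trans ?_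
  show (f - g) =ᶠ[codiscrete ℂ] 0 ↔ _
  constructor
  · intro h
    filter_upwards [h] with x hx
    simpa [sub_eq_zero] using hx
  · intro h
    filter_upwards [h] with x hx
    simp [hx]

theorem exists_mk (φ : Mer) : ∃ (f : ℂ → ℂ) (hf : Meromorphic f), φ = mk f hf := by
  obtain ⟨⟨f, hf⟩, rfl⟩ := Ideal.Quotient.mk_surjective φ
  exact ⟨f, hf, rfl⟩

theorem mk_add_mk {f g : ℂ → ℂ} (hf : Meromorphic f) (hg : Meromorphic g) :
    mk f hf + mk g hg = mk (f + g) (hf.add hg) := rfl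

theorem smul_mk (c : ℂ) {f : ℂ → ℂ} (hf : Meromorphic f) :
    c • mk f hf = mk (c • f) (hf.const_smul c) := rfl

theorem eventuallyEq_deriv {f g : ℂ → ℂ} (h : f =ᶠ[codiscrete ℂ] g) :
    deriv f =ᶠ[codiscrete ℂ] deriv g := by
  have key : ∀ {u v : ℂ → ℂ}, u =ᶠ[codiscrete ℂ] v ↔ ∀ x : ℂ, u =ᶠ[nhdsWithin x {x}ᶜ] v := by
    intro u v
    show {x | u x = v x} ∈ codiscreteWithin Set.univ ↔ _
    rw [mem_codiscreteWithin_iff_forall_mem_nhdsNE]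
    simp [Filter.EventuallyEq, Filter.Eventually]
  exact key.2 fun x => (key.1 h x).nhdsNE_deriv

/-- Differentiation of meromorphic functions. -/
def D : Mer →ₗ[ℂ] Mer where
  toFun := fun φ => mk (deriv φ.exists_mk.choose) φ.exists_mk.choose_spec.choose.deriv
  map_add' := by
    intro φ ψ
    have h1 := φ.exists_mk.choose_spec.choose
    have h2 := ψ.exists_mk.choose_spec.choose
    have h3 := (φ + ψ).exists_mk.choose_spec.choose
    have e1 := φ.exists_mk.choose_spec.choose_spec
    have e2 := ψ.exists_mk.choose_spec.choose_spec
    have e3 := (φ + ψ).exists_mk.choose_spec.choose_spec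
    set f := φ.exists_mk.choose
    set g := ψ.exists_mk.choose
    set k := (φ + ψ).exists_mk.choose
    refine Eq.trans ?_ (mk_add_mk h1.deriv h2.deriv).symm
    rw [mk_eq_mk_iff]
    have h4 : k =ᶠ[codiscrete ℂ] f + g := by
      rw [← mk_eq_mk_iff h3 (h1.add h2), ← e3, ← mk_add_mk h1 h2, ← e1, ← e2]
    refine (eventuallyEq_deriv h4).trans ?_
    filter_upwards [h1.meromorphicOn (s := Set.univ) |>.eventually_codiscreteWithin_analyticAt,
      h2.meromorphicOn (s := Set.univ) |>.eventually_codiscreteWithin_analyticAt] with x hx hy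
    exact deriv_add hx.differentiableAt hy.differentiableAt
  map_smul' := by
    intro c φ
    have h1 := φ.exists_mk.choose_spec.choose
    have h3 := (c • φ).exists_mk.choose_spec.choose
    have e1 := φ.exists_mk.choose_spec.choose_spec
    have e3 := (c • φ).exists_mk.choose_spec.choose_spec
    set f := φ.exists_mk.choose
    set k := (c • φ).exists_mk.choose
    refine Eq.trans ?_ (smul_mk c h1.deriv).symm
    rw [mk_eq_mk_iff]
    have h4 : k =ᶠ[codiscrete ℂ] c • f := by
      rw [← mk_eq_mk_iff h3 (h1.const_smul c), ← e3, ← smul_mk c h1, ← e1]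
    refine (eventuallyEq_deriv h4).trans (Eventually.of_forall fun x => ?_)
    exact deriv_const_smul_field c f

theorem D_mk {f : ℂ → ℂ} (hf : Meromorphic f) : D (mk f hf) = mk (deriv f) hf.deriv := by
  have h3 := (mk f hf).exists_mk.choose_spec.choose
  have e3 := (mk f hf).exists_mk.choose_spec.choose_spec
  show mk (deriv (mk f hf).exists_mk.choose) _ = _
  rw [mk_eq_mk_iff]
  exact eventuallyEq_deriv ((mk_eq_mk_iff h3 hf).1 e3.symm)

theorem meromorphic_id : Meromorphic fun t : ℂ => t := fun t => MeromorphicAt.id t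

theorem meromorphic_exp (α : ℂ) : Meromorphic fun t : ℂ => Complex.exp (α * t) :=
  fun _ => AnalyticAt.meromorphicAt (by fun_prop)

/-- The coordinate function `x`. -/
def x : Mer := mk (fun t => t) meromorphic_id

/-- The function `exp(αx)`. -/
def exp (α : ℂ) : Mer := mk (fun t => Complex.exp (α * t)) (meromorphic_exp α)

end Mer

/-! ## `R`-valued meromorphic functions and differential operators -/

section

variable (R : Type*) [Ring R] [Algebra ℂ R]

/-- The algebra `M(R)` of meromorphic functions on `ℂ` with values in a finite dimensional
algebra `R`, that is, `R ⊗ M(ℂ)`. It is a ring, and a right `R`-module through the first factor. -/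
abbrev MerR : Type _ := R ⊗[ℂ] Mer

/-- The derivative `∂ₓ` of `R`-valued meromorphic functions. -/
def dX : Module.End ℂ (MerR R) := LinearMap.lTensor R Mer.D

end

section

variable {R : Type*} [Ring R] [Algebra ℂ R]

/-- Constant functions. -/
def constR (r : R) : MerR R := r ⊗ₜ[ℂ] (1 : Mer)

/-- Scalar valued functions. -/
def scalarR (f : Mer) : MerR R := (1 : R) ⊗ₜ[ℂ] f

/-- The `R`-valued polynomial function `x ↦ p(x)`. -/
def polyR (p : R[X]) : MerR R := p.sum fun n r => r ⊗ₜ[ℂ] (Mer.x ^ n)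

/-- The `R`-valued quasipolynomial `p(x) exp(αx)`. -/
def quasi (p : R[X]) (α : ℂ) : MerR R := polyR p * scalarR (Mer.exp α)

/-- `a` is an `R`-valued rational function: `q(x) a(x) = p(x)` for some `p ∈ R[x]` and some
nonzero `q ∈ ℂ[x]`. -/
def IsRational (a : MerR R) : Prop :=
  ∃ q : ℂ[X], q ≠ 0 ∧ ∃ p : R[X], scalarR (Polynomial.aeval Mer.x q) * a = polyR p

/-- The differential operator `∑ₖ aₖ(x) ∂ₓᵏ` with coefficients `aₖ = p.coeff k`. -/
def diffOp (p : (MerR R)[X]) : Module.End ℂ (MerR R) :=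
  p.sum fun k a => LinearMap.mulLeft ℂ a * dX R ^ k

/-- Membership in the algebra `𝒟(R)` of `R`-valued differential operators on `ℂ` with rational
coefficients. -/
def IsRatDiffOp (P : Module.End ℂ (MerR R)) : Prop :=
  ∃ p : (MerR R)[X], (∀ k, IsRational (p.coeff k)) ∧ P = diffOp p

/-- `P ∈ 𝒟(R)` is monic. -/
def IsMonicRatDiffOp (P : Module.End ℂ (MerR R)) : Prop :=
  ∃ p : (MerR R)[X], p.Monic ∧ (∀ k, IsRational (p.coeff k)) ∧ P = diffOp p

/-- The differential operator `L(∂ₓ)` with constant coefficients. -/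
def constOp (L : R[X]) : Module.End ℂ (MerR R) :=
  diffOp (L.map (Algebra.TensorProduct.includeLeftRingHom : R →+* MerR R))

/-- `P` is a monic operator with rational coefficients which right-divides, in `𝒟(R)`,
a monic operator with constant coefficients. -/
def IsDarboux (P : Module.End ℂ (MerR R)) : Prop :=
  IsMonicRatDiffOp P ∧
    ∃ Q : Module.End ℂ (MerR R), IsRatDiffOp Q ∧ ∃ L : R[X], L.Monic ∧ Q * P = constOp L

/-- The function `P(x, ∂ₓ) exp(xz)`; its value at `z` is a meromorphic function of `x`. -/
def wave (P : Module.End ℂ (MerR R)) : ℂ → MerR R := fun z => P (scalarR (Mer.exp z))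

variable (R) in
/-- The decorated adelic Grassmannian: the functions `P(x, ∂ₓ) exp(xz)`. -/
def DecGr : Type _ := {Φ : ℂ → MerR R // ∃ P, IsDarboux P ∧ Φ = wave P}

/-- `Φ(x,z) = P(x, ∂ₓ) exp(xz)` with `P` an admissible operator. -/
def DecGr.IsOp (Φ : DecGr R) (P : Module.End ℂ (MerR R)) : Prop :=
  IsDarboux P ∧ Φ.1 = wave P

/-- The right `R`-submodule `V` is the one that corresponds to `Φ = P exp(xz)`: it is the
kernel of `P` in the `R`-valued meromorphic functions on `ℂ`. -/
def DecGr.CorrespondsTo (Φ : DecGr R) (V : Submodule Rᵐᵒᵖ (MerR R)) : Prop :=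
  ∃ P, Φ.IsOp P ∧ ∀ f, f ∈ V ↔ P f = 0

/-! ## Idempotents, the partial order, the normalization -/

/-- Primitive idempotents: nonzero, and not a sum of two nonzero orthogonal idempotents. -/
def IsPrimitiveIdem (e : R) : Prop :=
  IsIdempotentElem e ∧ e ≠ 0 ∧
    ∀ a b : R, IsIdempotentElem a → IsIdempotentElem b → a * b = 0 → b * a = 0 →
      e = a + b → a = 0 ∨ b = 0

variable {m : ℕ} (e : Fin m → R)

/-- The element `γ₁e₁ + ⋯ + γₘeₘ` of `R`. -/
def diagElt (γ : Fin m → ℂ) : R := ∑ k, γ k • e k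

/-- The first order operator `∂ₓ - γ₁e₁ - ⋯ - γₘeₘ`. -/
def linOp (γ : Fin m → ℂ) : Module.End ℂ (MerR R) :=
  dX R - LinearMap.mulLeft ℂ (constR (diagElt e γ))

/-- `Ψ = S exp(xz)` and `Φ = P exp(xz)` with `S = P ∏ⱼ (∂ₓ - γ₁ⱼe₁ - ⋯ - γₘⱼeₘ)`, the product
over the members `(γ₁ⱼ, …, γₘⱼ)` of the list `γs`. -/
def SuccVia (γs : List (Fin m → ℂ)) (Φ Ψ : DecGr R) : Prop :=
  ∃ P S, Φ.IsOp P ∧ Ψ.IsOp S ∧ S = P * (γs.map (linOp e)).prod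

/-- The order `Φ ≺ Ψ` on the decorated adelic Grassmannian (at least one factor). -/
def Prec (Φ Ψ : DecGr R) : Prop := ∃ γs : List (Fin m → ℂ), γs ≠ [] ∧ SuccVia e γs Φ Ψ

/-- `Ψ` is an immediate successor of `Φ` (exactly one factor). -/
def ImmSucc (Φ Ψ : DecGr R) : Prop := ∃ γ : Fin m → ℂ, SuccVia e [γ] Φ Ψ

/-- `g(z) = ∏ⱼ(z - α₁ⱼ) e₁ + ⋯ + ∏ⱼ(z - αₘⱼ) eₘ`. -/
def normFactor {l : ℕ} (α : Fin m → Fin l → ℂ) (z : ℂ) : R := ∑ k, (∏ j, (z - α k j)) • e k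

/-- `N` is a normalization of `Φ = P exp(xz)`: for some right `R`-basis of the kernel of `P` of
the form `Fⱼ = ∑ₖ pₖⱼ(x) exp(αₖⱼ x) eₖ`, `1 ≤ j ≤ l`, one has
`N(x,z) = Φ(x,z) · (∏ⱼ(z - α₁ⱼ) e₁ + ⋯ + ∏ⱼ(z - αₘⱼ) eₘ)⁻¹`
as meromorphic functions. As a function of `z`, `N` is a germ along the filter of
complements of closed discrete subsets of `ℂ`; the inverse exists for all but finitely many `z`. -/
def IsNormalization (Φ : DecGr R) (N : Germ (codiscrete ℂ) (MerR R)) : Prop :=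
  ∃ P, Φ.IsOp P ∧ ∃ (l : ℕ) (p : Fin m → Fin l → R[X]) (α : Fin m → Fin l → ℂ)
    (F : Fin l → MerR R),
    (∀ j, F j = ∑ k, quasi (p k j * C (e k)) (α k j)) ∧
    LinearIndependent Rᵐᵒᵖ F ∧
    (∀ f, f ∈ Submodule.span Rᵐᵒᵖ (Set.range F) ↔ P f = 0) ∧
    N = ((fun z => Φ.1 z * constR (Ring.inverse (normFactor e α z)) : ℂ → MerR R) :
      Germ (codiscrete ℂ) (MerR R))

/-- `Φ` and `Ψ` have a normalization in common. -/
def SameNorm (Φ Ψ : DecGr R) : Prop := ∃ N, IsNormalization e Φ N ∧ IsNormalization e Ψ N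

/-- The adelic Grassmannian: the set of normalized functions, as the quotient of the decorated
adelic Grassmannian under the equivalence relation generated by having a normalization in
common (so that a point of the decorated Grassmannian has a single image even when
different bases of its kernel lead to different normalizations). -/
def AdGr : Type _ := Quot (SameNorm e)

/-- The normalization map `π`. -/
def piNorm : DecGr R → AdGr e := Quot.mk (SameNorm e)

end

/-! ## The operators `F_A` -/

section

variable {R : Type*} [Ring R] [Algebra ℂ R]

/-- Coefficientwise action of a linear operator on `R[x]`. -/
def coeffMap (A : Module.End ℂ R) (u : R[X]) : R[X] := u.sum fun n r => monomial n (A r)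

/-- The integral `∫₀ˣ u(t) dt` of a polynomial. -/
def primitive (u : R[X]) : R[X] := u.sum fun n r => monomial (n + 1) (((n : ℂ) + 1)⁻¹ • r)

/-- `exp(xA) u(x)`, the exponential series being cut at the power `dim R` of `A`; this is the
exponential itself on polynomials with coefficients in the nilpotent part of `A`. -/
def expAct (A : Module.End ℂ R) (u : R[X]) : R[X] :=
  ∑ k ∈ Finset.range (Module.finrank ℂ R), X ^ k * coeffMap ((k.factorial : ℂ)⁻¹ • A ^ k) u

/-- The summand `U₀` of `U = R` on which `A` is nilpotent. -/
def nilSpace (A : Module.End ℂ R) : Submodule ℂ R := ⨆ n, LinearMap.ker (A ^ n)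

/-- The summand `U₁` of `U = R` on which `A` is invertible. -/
def invSpace (A : Module.End ℂ R) : Submodule ℂ R := ⨅ n, LinearMap.range (A ^ n)

theorem mapsTo_invSpace (A : Module.End ℂ R) : ∀ r ∈ invSpace A, A r ∈ invSpace A := by
  intro r hr
  simp only [invSpace, Submodule.mem_iInf] at hr ⊢
  intro n
  obtain ⟨s, rfl⟩ := hr n
  refine ⟨A s, ?_⟩
  rw [← Module.End.mul_apply, ← Module.End.mul_apply, ← pow_succ, ← pow_succ']

variable [FiniteDimensional ℂ R]

theorem isCompl_nilSpace_invSpace (A : Module.End ℂ R) : IsCompl (nilSpace A) (invSpace A) :=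
  A.isCompl_iSup_ker_pow_iInf_range_pow

/-- `A` restricted to `U₁`, as an invertible operator. -/
def invEquiv (A : Module.End ℂ R) : invSpace A ≃ₗ[ℂ] invSpace A :=
  LinearEquiv.ofInjectiveEndo (A.restrict (mapsTo_invSpace A)) (by
    rw [← LinearMap.ker_eq_bot, LinearMap.ker_eq_bot']
    rintro ⟨r, hr⟩ h
    have h0 : A r = 0 := by simpa using congrArg Subtype.val h
    have h1 : r ∈ nilSpace A :=
      Submodule.mem_iSup_of_mem 1 (by simpa using h0)
    have h2 : r = 0 := by
      have := (isCompl_nilSpace_invSpace A).disjoint.le_bot ⟨h1, hr⟩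
      simpa using this
    simpa using h2)

/-- Projection onto `U₀` along `U₁`. -/
def nilProj (A : Module.End ℂ R) : Module.End ℂ R :=
  (nilSpace A).subtype ∘ₗ (nilSpace A).projectionOnto (invSpace A) (isCompl_nilSpace_invSpace A)

/-- Projection onto `U₁` along `U₀`. -/
def invProj (A : Module.End ℂ R) : Module.End ℂ R :=
  (invSpace A).subtype ∘ₗ
    (invSpace A).projectionOnto (nilSpace A) (isCompl_nilSpace_invSpace A).symm

/-- The inverse of `A` on `U₁`, extended by `0` on `U₀`. -/
def partialInv (A : Module.End ℂ R) : Module.End ℂ R :=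
  (invSpace A).subtype ∘ₗ (invEquiv A).symm.toLinearMap ∘ₗ
    (invSpace A).projectionOnto (nilSpace A) (isCompl_nilSpace_invSpace A).symm

/-- The operator `F_A` on `R[x]`: it is `exp(-Ax) ∫₀ˣ exp(At) u(t) dt` for `u ∈ U₀[x]` and
`∑ₖ (-1)ᵏ A⁻ᵏ⁻¹ u⁽ᵏ⁾(x)` for `u ∈ U₁[x]`. -/
def opF (A : Module.End ℂ R) (u : R[X]) : R[X] :=
  expAct (-A) (primitive (expAct A (coeffMap (nilProj A) u))) +
    ∑ k ∈ Finset.range (u.natDegree + 1),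
      coeffMap ((-1 : ℂ) ^ k • partialInv A ^ (k + 1)) (derivative^[k] (coeffMap (invProj A) u))

variable {m : ℕ} (e : Fin m → R)

/-- The operator `A_α` of left multiplication by `(α - γ₁) e₁ + ⋯ + (α - γₘ) eₘ`. -/
def opA (γ : Fin m → ℂ) (α : ℂ) : Module.End ℂ R :=
  LinearMap.mulLeft ℂ (diagElt e fun k => α - γ k)

/-- The summands `pₖ(x) exp(αₖ x) e_{iₖ} R`. -/
def summand {n : ℕ} (p : Fin n → R[X]) (α : Fin n → ℂ) (i : Fin n → Fin m) (k : Fin n) :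
    Submodule Rᵐᵒᵖ (MerR R) :=
  Submodule.span Rᵐᵒᵖ {quasi (p k * C (e (i k))) (α k)}

/-- The summands `exp(γᵢ x) eᵢ R` and `F_{A_{αₖ}}(pₖ(x) e_{iₖ}) exp(αₖ x) R` of `V_γ`. -/
def succSummand {n : ℕ} (p : Fin n → R[X]) (α : Fin n → ℂ) (i : Fin n → Fin m)
    (γ : Fin m → ℂ) : Fin m ⊕ Fin n → Submodule Rᵐᵒᵖ (MerR R) :=
  Sum.elim (fun j => Submodule.span Rᵐᵒᵖ {quasi (C (e j)) (γ j)})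
    fun k => Submodule.span Rᵐᵒᵖ {quasi (opF (opA e γ (α k)) (p k * C (e (i k)))) (α k)}

end

end

/-!
# Successors and fibres of the adelic Grassmannian of a finite dimensional algebra

A Darboux operator `P` right-divides, over the rational functions, an operator with constant
coefficients, hence (`exists_mul_eq_map_algebraMap`) even a *scalar* operator
`∏ (∂ₓ - b)`, whose solutions are the quasipolynomials `∑ p(x) exp(bx)`. So `ker P` consists of
quasipolynomials. Rational functions and exponentials are independent, so that the components of a
solution for the different exponents are again solutions (`IsDarboux.exists_decomposition`).
Counting dimensions, at a point where `P` and its cofactor are regular the jets of order `deg P`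
identify `ker P` with the free module `R ^ deg P` (`IsDarboux.exists_jet`).

*Order.* `P` is determined by the values of `P exp(xz)` for infinitely many `z`, since these are
values of its symbol at `z`; the order of `P` grows under multiplication by `∂ₓ - γ₁e₁ - ⋯ - γₘeₘ`,
which gives irreflexivity.

*Immediate successors.* The kernel of `P (∂ₓ - ∑ γₖeₖ)` is the preimage of `ker P` under the
surjection `∂ₓ - ∑ γₖeₖ` of quasipolynomials. The kernel of this surjection is
`⨁ exp(γᵢx) eᵢR`, and `F_A` gives a right `R`-linear section (`linOp_quasi_opF`).

*Fibres.* Let `g(z) = ∑ₖ ∏ⱼ (z - γₖⱼ) eₖ` and `B = ∏ⱼ (∂ₓ - ∑ₖ γₖⱼeₖ)`, so that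
`P B exp(xz) = P exp(xz) g(z)` (`wave_mul_prod_linOp`). If `P exp(xz)` and `S exp(xz)` have a
normalization in common, clearing the denominators gives `P B = S B'` for two such products, that
is, a common successor. Conversely let `T = P B = S B'`. The solutions `xⁱ exp(αx) eₖ` of `B` and of
`B'` all lie in `ker T`, and they can be completed to a decomposition
`ker T = ⨁ fₜ R` with `fₜ R ≅ e_{k(t)} R`, each `eₖ` occurring `deg T` times
(`IsDarboux.exists_frame`). The corners `eₖ R eₖ` are local, so a Steinitz exchange replaces the
remaining members by quasipolynomials with a single exponent (`IsFrame.exists_homogeneous`). The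
operator `B` kills the members that solve `B` and maps the others to a decomposition of `ker P`, and
sums over `k` form a basis of `ker P` of the shape that defines normalizations. The resulting
normalization is `T exp(xz) (∑ₖ ∏ₜ (z - αₜ) eₖ)⁻¹`, which depends on the decomposition of `ker T`
only, hence is also one of `S exp(xz)` (`isNormalization_of_isFrame`). Since products of first order
factors commute, having a common successor is transitive; so having a normalization in common is
already an equivalence relation.
-/

/-! ### Meromorphic functions on the plane -/

namespace Mer

open scoped Topology

theorem mk_mul_mk {f g : ℂ → ℂ} (hf : Meromorphic f) (hg : Meromorphic g) :
    mk f hf * mk g hg = mk (f * g) (hf.mul hg) := rfl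

theorem mk_one : mk (fun _ => 1) (Meromorphic.const 1) = 1 := rfl

theorem algebraMap_eq_mk (c : ℂ) : algebraMap ℂ Mer c = mk (fun _ => c) (Meromorphic.const c) := rfl

theorem mk_zero : mk (fun _ => 0) (Meromorphic.const 0) = 0 := rfl

theorem eventuallyEq_codiscrete_iff {u v : ℂ → ℂ} :
    u =ᶠ[codiscrete ℂ] v ↔ ∀ a : ℂ, u =ᶠ[𝓝[≠] a] v := by
  change {a | u a = v a} ∈ codiscreteWithin Set.univ ↔ _
  rw [mem_codiscreteWithin_iff_forall_mem_nhdsNE]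
  simp [Filter.EventuallyEq, Filter.Eventually]

theorem mk_congr {f g : ℂ → ℂ} (h : f = g) (hf : Meromorphic f) (hg : Meromorphic g) :
    mk f hf = mk g hg := by
  subst h; rfl

theorem D_mul (φ ψ : Mer) : D (φ * ψ) = D φ * ψ + φ * D ψ := by
  obtain ⟨f, hf, rfl⟩ := exists_mk φ
  obtain ⟨g, hg, rfl⟩ := exists_mk ψ
  rw [mk_mul_mk, D_mk, D_mk, D_mk, mk_mul_mk, mk_mul_mk, mk_add_mk, mk_eq_mk_iff]
  filter_upwards [hf.meromorphicOn (s := Set.univ) |>.eventually_codiscreteWithin_analyticAt,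
      hg.meromorphicOn (s := Set.univ) |>.eventually_codiscreteWithin_analyticAt] with a ha hb
  exact deriv_mul ha.differentiableAt hb.differentiableAt

theorem D_one : D (1 : Mer) = 0 := by
  simpa using D_mul 1 1

theorem D_x : D x = 1 := by
  rw [x, D_mk, ← mk_one]
  exact mk_congr (by ext; simp) _ _

theorem D_exp (α : ℂ) : D (exp α) = α • exp α := by
  rw [exp, D_mk, smul_mk]
  refine mk_congr ?_ _ _
  ext t
  have : HasDerivAt (fun t : ℂ => Complex.exp (α * t)) (Complex.exp (α * t) * (α * 1)) t :=
    ((hasDerivAt_id t).const_mul α).cexp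
  simp [this.deriv, mul_comm]

theorem exp_mul_exp (α β : ℂ) : exp α * exp β = exp (α + β) := by
  rw [exp, exp, exp, mk_mul_mk]
  refine mk_congr ?_ _ _
  ext t
  simp [← Complex.exp_add, add_mul]

theorem exp_zero : exp 0 = 1 := by
  rw [exp, ← mk_one]
  exact mk_congr (by ext; simp) _ _

instance : Nontrivial Mer := ⟨0, 1, fun h => by
  rw [← mk_zero, ← mk_one, mk_eq_mk_iff, eventuallyEq_codiscrete_iff] at h
  obtain ⟨a, ha⟩ := (h 0).exists
  exact zero_ne_one ha⟩

/-- The identity theorem: a meromorphic function that vanishes near one point vanishes. -/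
theorem mk_eq_zero_of_eventually {f : ℂ → ℂ} (hf : Meromorphic f) {a : ℂ}
    (h : f =ᶠ[𝓝[≠] a] 0) : mk f hf = 0 := by
  rw [← mk_zero, mk_eq_mk_iff, eventuallyEq_codiscrete_iff]
  have htop : meromorphicOrderAt f a = ⊤ := meromorphicOrderAt_eq_top_iff.2 h
  have hall : ∀ b, meromorphicOrderAt f b = ⊤ := by
    by_contra! hb
    obtain ⟨b, hb⟩ := hb
    exact hf.exists_meromorphicOrderAt_ne_top_iff_forall.1 ⟨b, hb⟩ a htop
  exact fun b => meromorphicOrderAt_eq_top_iff.1 (hall b)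

/-! ### Functions regular at a point -/

/-- The algebra of (classes of) meromorphic functions that are analytic at `a`. -/
def reg (a : ℂ) : Subalgebra ℂ Mer where
  carrier := {φ | ∃ (f : ℂ → ℂ) (hf : Meromorphic f), AnalyticAt ℂ f a ∧ φ = mk f hf}
  mul_mem' := by
    rintro _ _ ⟨f, hf, hfa, rfl⟩ ⟨g, hg, hga, rfl⟩
    exact ⟨f * g, hf.mul hg, hfa.mul hga, rfl⟩
  add_mem' := by
    rintro _ _ ⟨f, hf, hfa, rfl⟩ ⟨g, hg, hga, rfl⟩
    exact ⟨f + g, hf.add hg, hfa.add hga, rfl⟩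
  algebraMap_mem' := fun c => ⟨fun _ => c, Meromorphic.const c, analyticAt_const, rfl⟩

theorem D_mem_reg {a : ℂ} {φ : Mer} (h : φ ∈ reg a) : D φ ∈ reg a := by
  obtain ⟨f, hf, hfa, rfl⟩ := h
  exact ⟨deriv f, hf.deriv, hfa.deriv, D_mk hf⟩

theorem x_mem_reg (a : ℂ) : x ∈ reg a := ⟨_, meromorphic_id, analyticAt_id, rfl⟩

theorem exp_mem_reg (α a : ℂ) : exp α ∈ reg a := ⟨_, meromorphic_exp α, by fun_prop, rfl⟩

theorem exists_mem_reg (φ : Mer) : ∃ a, φ ∈ reg a := by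
  obtain ⟨f, hf, rfl⟩ := exists_mk φ
  obtain ⟨a, ha⟩ := (hf 0).eventually_analyticAt.exists
  exact ⟨a, f, hf, ha, rfl⟩

theorem eq_of_mk_eq_mk {f g : ℂ → ℂ} {a : ℂ} {hf : Meromorphic f} {hg : Meromorphic g}
    (hfa : AnalyticAt ℂ f a) (hga : AnalyticAt ℂ g a) (h : mk f hf = mk g hg) : f a = g a := by
  rw [mk_eq_mk_iff, eventuallyEq_codiscrete_iff] at h
  exact tendsto_nhds_unique_of_eventuallyEq
    (hfa.continuousAt.tendsto.mono_left nhdsWithin_le_nhds)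
    (hga.continuousAt.tendsto.mono_left nhdsWithin_le_nhds) (h a)

/-- Evaluation at `a`, as a linear functional on all meromorphic functions: it is extended from
the functions regular at `a` in an arbitrary way. -/
theorem exists_eval (a : ℂ) : ∃ ε : Mer →ₗ[ℂ] ℂ, ∀ (f : ℂ → ℂ) (hf : Meromorphic f),
    AnalyticAt ℂ f a → ε (mk f hf) = f a := by
  have hex : ∀ φ : reg a, ∃ (f : ℂ → ℂ) (hf : Meromorphic f), AnalyticAt ℂ f a ∧ φ.1 = mk f hf :=
    fun φ => φ.2
  choose F hF hFa hFe using hex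
  -- the value at `a` does not depend on the representative that is analytic there
  have key : ∀ (φ : reg a) (f : ℂ → ℂ) (hf : Meromorphic f), AnalyticAt ℂ f a → φ.1 = mk f hf →
      F φ a = f a := fun φ f hf hfa h => eq_of_mk_eq_mk (hFa φ) hfa ((hFe φ).symm.trans h)
  let ε₀ : Subalgebra.toSubmodule (reg a) →ₗ[ℂ] ℂ :=
    { toFun := fun φ => F φ a
      map_add' := fun φ ψ => key (φ + ψ) (F φ + F ψ) ((hF φ).add (hF ψ)) ((hFa φ).add (hFa ψ)) (by
        rw [← mk_add_mk (hF φ) (hF ψ), ← hFe, ← hFe]; rfl)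
      map_smul' := fun c φ => key (c • φ) (c • F φ) ((hF φ).const_smul c)
        (analyticAt_const.smul (hFa φ)) (by
        rw [← smul_mk c (hF φ), ← hFe]; rfl) }
  obtain ⟨ε, hε⟩ := LinearMap.exists_extend ε₀
  refine ⟨ε, fun f hf hfa => ?_⟩
  have h : ε ((⟨mk f hf, f, hf, hfa, rfl⟩ : Subalgebra.toSubmodule (reg a)) : Mer) = _ :=
    LinearMap.congr_fun hε ⟨mk f hf, f, hf, hfa, rfl⟩
  exact h.trans (key ⟨mk f hf, f, hf, hfa, rfl⟩ f hf hfa rfl)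

/-- A linear functional on all meromorphic functions that extends the evaluation at `a`; its value
on a function with a pole at `a` is arbitrary. -/
noncomputable def evalAt (a : ℂ) : Mer →ₗ[ℂ] ℂ := (exists_eval a).choose

theorem evalAt_mk {a : ℂ} {f : ℂ → ℂ} (hf : Meromorphic f) (hfa : AnalyticAt ℂ f a) :
    evalAt a (mk f hf) = f a := (exists_eval a).choose_spec f hf hfa

theorem evalAt_mul {a : ℂ} {φ ψ : Mer} (hφ : φ ∈ reg a) (hψ : ψ ∈ reg a) :
    evalAt a (φ * ψ) = evalAt a φ * evalAt a ψ := by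
  obtain ⟨f, hf, hfa, rfl⟩ := hφ
  obtain ⟨g, hg, hga, rfl⟩ := hψ
  rw [mk_mul_mk, evalAt_mk _ (hfa.mul hga), evalAt_mk _ hfa, evalAt_mk _ hga, Pi.mul_apply]

theorem evalAt_one (a : ℂ) : evalAt a 1 = 1 := by
  rw [← mk_one, evalAt_mk _ analyticAt_const]

theorem D_pow_mk {f : ℂ → ℂ} (hf : Meromorphic f) (k : ℕ) :
    (D ^ k) (mk f hf) = mk (deriv^[k] f) hf.iterated_deriv := by
  induction k with
  | zero => rfl
  | succ k ih =>
    rw [pow_succ', Module.End.mul_apply, ih, D_mk]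
    exact mk_congr (Function.iterate_succ_apply' deriv k f).symm _ _

/-- A function regular at `a` all of whose derivatives vanish at `a` is zero. -/
theorem eq_zero_of_evalAt {a : ℂ} {φ : Mer} (hφ : φ ∈ reg a)
    (h : ∀ k, evalAt a ((D ^ k) φ) = 0) : φ = 0 := by
  obtain ⟨f, hf, hfa, rfl⟩ := hφ
  have hd : ∀ k, AnalyticAt ℂ (deriv^[k] f) a := fun k => by
    induction k with
    | zero => exact hfa
    | succ k ih => rw [Function.iterate_succ_apply']; exact ih.deriv
  have hk : ∀ k, iteratedDeriv k f a = 0 := fun k => by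
    have := h k
    rwa [D_pow_mk, evalAt_mk _ (hd k), ← iteratedDeriv_eq_iterate] at this
  refine mk_eq_zero_of_eventually hf (a := a) ?_
  have htop : analyticOrderAt f a = ⊤ := by
    rw [ENat.eq_top_iff_forall_ge]
    intro n
    exact (natCast_le_analyticOrderAt_iff_iteratedDeriv_eq_zero hfa).2 fun i _ => hk i
  exact (analyticOrderAt_eq_top.1 htop).filter_mono nhdsWithin_le_nhds

/-- The constants are the only meromorphic functions with zero derivative. -/
theorem eq_algebraMap_of_D_eq_zero {φ : Mer} (h : D φ = 0) : ∃ c : ℂ, φ = algebraMap ℂ Mer c := by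
  obtain ⟨a, ha⟩ := exists_mem_reg φ
  refine ⟨evalAt a φ, sub_eq_zero.1 (eq_zero_of_evalAt (a := a)
    (sub_mem ha (Subalgebra.algebraMap_mem _ _)) fun k => ?_)⟩
  cases k with
  | zero =>
    rw [pow_zero, Module.End.one_apply, map_sub, Algebra.algebraMap_eq_smul_one, map_smul,
      evalAt_one]
    simp
  | succ k =>
    rw [pow_succ, Module.End.mul_apply, map_sub, h, Algebra.algebraMap_eq_smul_one, map_smul,
      D_one]
    simp

/-! ### Polynomials as meromorphic functions -/

theorem meromorphic_eval (q : ℂ[X]) : Meromorphic fun t => q.eval t := fun _ =>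
  AnalyticAt.meromorphicAt (AnalyticAt.aeval_polynomial analyticAt_id q)

theorem aeval_x (q : ℂ[X]) : aeval x q = mk (fun t => q.eval t) (meromorphic_eval q) := by
  induction q using Polynomial.induction_on' with
  | add p q hp hq =>
    rw [map_add, hp, hq, mk_add_mk]
    exact mk_congr (by ext; simp) _ _
  | monomial n c =>
    have h : ∀ n : ℕ, ∃ h : Meromorphic fun t : ℂ => t ^ n, x ^ n = mk (fun t => t ^ n) h := by
      intro n
      induction n with
      | zero =>
        refine ⟨fun _ => AnalyticAt.meromorphicAt (by fun_prop), ?_⟩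
        rw [pow_zero, ← mk_one]
        exact mk_congr (by ext; simp) _ _
      | succ n ih =>
        obtain ⟨h, ih⟩ := ih
        refine ⟨fun _ => AnalyticAt.meromorphicAt (by fun_prop), ?_⟩
        rw [pow_succ, ih, x, mk_mul_mk]
        exact mk_congr (by ext; simp [pow_succ]) _ _
    obtain ⟨h, hn⟩ := h n
    rw [aeval_monomial, algebraMap_eq_mk, hn, mk_mul_mk]
    exact mk_congr (by ext; simp) _ _

/-- A nonzero polynomial is invertible in the meromorphic functions, and its inverse is regular
off the zeros of the polynomial. -/
theorem exists_inv_aeval_x {q : ℂ[X]} (hq : q ≠ 0) :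
    ∃ ψ : Mer, ψ * aeval x q = 1 ∧ ∀ a, q.eval a ≠ 0 → ψ ∈ reg a := by
  refine ⟨mk _ (meromorphic_eval q).inv, ?_, fun a ha => ⟨_, _, ?_, rfl⟩⟩
  · rw [aeval_x, mk_mul_mk, ← mk_one, mk_eq_mk_iff]
    have h : ({t | q.IsRoot t} : Set ℂ)ᶜ ∈ codiscrete ℂ :=
      (q.finite_setOfPred_isRoot hq).compl_mem_codiscrete
    filter_upwards [h] with t ht
    exact inv_mul_cancel₀ ht
  · exact (AnalyticAt.aeval_polynomial analyticAt_id q).inv ha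

end Mer

/-! ### The differential ring of `R`-valued meromorphic functions -/

section MerR

variable {R : Type*} [Ring R] [Algebra ℂ R]

theorem constR_eq (r : R) :
    constR r = (Algebra.TensorProduct.includeLeft : R →ₐ[ℂ] MerR R) r := rfl

theorem scalarR_eq (f : Mer) :
    scalarR f = (Algebra.TensorProduct.includeRight : Mer →ₐ[ℂ] MerR R) f := rfl

theorem constR_mul (r s : R) : constR (r * s) = constR r * constR s := by simp [constR_eq]

theorem constR_one : constR (1 : R) = 1 := rfl

theorem constR_zero : constR (0 : R) = 0 := by simp [constR_eq]

theorem constR_add (r s : R) : constR (r + s) = constR r + constR s := by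
  simp only [constR_eq, map_add]

theorem constR_sub (r s : R) : constR (r - s) = constR r - constR s := by
  simp only [constR_eq, map_sub]

theorem constR_smul (c : ℂ) (r : R) : constR (c • r) = c • constR r := by
  simp only [constR_eq, map_smul]

theorem constR_sum {ι : Type*} (s : Finset ι) (f : ι → R) :
    constR (∑ i ∈ s, f i) = ∑ i ∈ s, constR (f i) := by simp only [constR_eq, map_sum]

theorem scalarR_mul (f g : Mer) : (scalarR (f * g) : MerR R) = scalarR f * scalarR g := by
  simp [scalarR_eq]

theorem scalarR_one : (scalarR 1 : MerR R) = 1 := rfl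

theorem scalarR_smul (c : ℂ) (f : Mer) : (scalarR (c • f) : MerR R) = c • scalarR f := by
  simp only [scalarR_eq, map_smul]

theorem scalarR_mul_comm (f : Mer) (v : MerR R) : scalarR f * v = v * scalarR f := by
  induction v using TensorProduct.induction_on with
  | zero => simp
  | tmul r g => simp [scalarR, mul_comm]
  | add v w hv hw => rw [mul_add, add_mul, hv, hw]

theorem op_smul_eq (r : R) (v : MerR R) : MulOpposite.op r • v = v * constR r := by
  induction v using TensorProduct.induction_on with
  | zero => simp
  | tmul s g => simp [constR, TensorProduct.smul_tmul']
  | add v w hv hw => rw [smul_add, add_mul, hv, hw]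

theorem dX_tmul (r : R) (f : Mer) : dX R (r ⊗ₜ f) = r ⊗ₜ Mer.D f := rfl

theorem dX_mul (v w : MerR R) : dX R (v * w) = dX R v * w + v * dX R w := by
  induction v using TensorProduct.induction_on with
  | zero => simp
  | add v v' hv hv' => simp only [add_mul, map_add, hv, hv']; abel
  | tmul r f =>
    induction w using TensorProduct.induction_on with
    | zero => simp
    | add w w' hw hw' => simp only [mul_add, map_add, hw, hw']; abel
    | tmul s g => simp [dX_tmul, Mer.D_mul, TensorProduct.tmul_add]

theorem dX_constR (r : R) : dX R (constR r) = 0 := by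
  rw [constR, dX_tmul, Mer.D_one, TensorProduct.tmul_zero]

theorem dX_scalarR (f : Mer) : dX R (scalarR f) = scalarR (Mer.D f) := rfl

theorem dX_mul_constR (v : MerR R) (r : R) : dX R (v * constR r) = dX R v * constR r := by
  rw [dX_mul, dX_constR, mul_zero, add_zero]

theorem dX_constR_mul (v : MerR R) (r : R) : dX R (constR r * v) = constR r * dX R v := by
  rw [dX_mul, dX_constR, zero_mul, zero_add]

theorem dX_pow_mul_constR (k : ℕ) (v : MerR R) (r : R) :
    (dX R ^ k) (v * constR r) = (dX R ^ k) v * constR r := by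
  induction k with
  | zero => rfl
  | succ k ih => rw [pow_succ', Module.End.mul_apply, ih, dX_mul_constR, Module.End.mul_apply]

theorem scalarR_exp_mul (α β : ℂ) :
    (scalarR (Mer.exp α) : MerR R) * scalarR (Mer.exp β) = scalarR (Mer.exp (α + β)) := by
  rw [← scalarR_mul, Mer.exp_mul_exp]

theorem scalarR_exp_mul_neg (α : ℂ) :
    (scalarR (Mer.exp α) : MerR R) * scalarR (Mer.exp (-α)) = 1 := by
  rw [scalarR_exp_mul, add_neg_cancel, Mer.exp_zero, scalarR_one]

theorem dX_scalarR_exp (α : ℂ) :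
    dX R (scalarR (Mer.exp α)) = α • scalarR (Mer.exp α) := by
  rw [dX_scalarR, Mer.D_exp, scalarR_smul]

theorem mul_scalarR_exp_eq_zero {v : MerR R} {α : ℂ} (h : v * scalarR (Mer.exp α) = 0) :
    v = 0 := by
  have := congrArg (· * scalarR (Mer.exp (-α))) h
  simpa [mul_assoc, scalarR_exp_mul_neg] using this

/-! ### Coordinates -/

/-- The scalar valued function obtained by applying a linear functional to the values. -/
noncomputable def coordMap (φ : Module.Dual ℂ R) : MerR R →ₗ[ℂ] Mer :=
  (TensorProduct.lid ℂ Mer).toLinearMap ∘ₗ LinearMap.rTensor Mer φ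

theorem coordMap_tmul (φ : Module.Dual ℂ R) (r : R) (f : Mer) :
    coordMap φ (r ⊗ₜ f) = φ r • f := by simp [coordMap]

theorem coordMap_dX (φ : Module.Dual ℂ R) (v : MerR R) :
    coordMap φ (dX R v) = Mer.D (coordMap φ v) := by
  induction v using TensorProduct.induction_on with
  | zero => simp
  | tmul s g => simp [dX_tmul, coordMap_tmul]
  | add v w hv hw => simp [hv, hw]

theorem coordMap_dX_pow (φ : Module.Dual ℂ R) (k : ℕ) (v : MerR R) :
    coordMap φ ((dX R ^ k) v) = (Mer.D ^ k) (coordMap φ v) := by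
  induction k with
  | zero => rfl
  | succ k ih =>
    rw [pow_succ', Module.End.mul_apply, coordMap_dX, ih, pow_succ', Module.End.mul_apply]

theorem sum_basis_coordMap {ι : Type*} [Fintype ι] (b : Module.Basis ι ℂ R) (v : MerR R) :
    v = ∑ i, b i ⊗ₜ[ℂ] coordMap (b.coord i) v := by
  induction v using TensorProduct.induction_on with
  | zero => simp
  | tmul s g =>
    simp only [coordMap_tmul, ← TensorProduct.smul_tmul, ← TensorProduct.sum_tmul]
    rw [show ∑ i, b.coord i s • b i = s from b.sum_repr s]
  | add v w hv hw => simp only [map_add, TensorProduct.tmul_add, Finset.sum_add_distrib, ← hv, ← hw]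

theorem eq_zero_of_coordMap [FiniteDimensional ℂ R] {v : MerR R}
    (h : ∀ φ, coordMap (R := R) φ v = 0) : v = 0 := by
  rw [sum_basis_coordMap (Module.finBasis ℂ R) v]
  simp [h]

theorem constR_injective [FiniteDimensional ℂ R] {r : R} (h : constR r = 0) : r = 0 := by
  rw [← Module.forall_dual_apply_eq_zero_iff ℂ]
  intro φ
  have := congrArg (coordMap φ) h
  simpa [constR, coordMap_tmul] using this

theorem nontrivial_merR [Nontrivial R] [FiniteDimensional ℂ R] : Nontrivial (MerR R) :=
  ⟨0, constR 1, fun h => zero_ne_one' R (constR_injective h.symm).symm⟩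

theorem exists_constR_of_dX_eq_zero [FiniteDimensional ℂ R] {v : MerR R} (h : dX R v = 0) :
    ∃ r, v = constR r := by
  have hc : ∀ φ, ∃ c : ℂ, coordMap (R := R) φ v = algebraMap ℂ Mer c := fun φ =>
    Mer.eq_algebraMap_of_D_eq_zero (by rw [← coordMap_dX, h, map_zero])
  choose c hc using hc
  let b := Module.finBasis ℂ R
  refine ⟨∑ i, c (b.coord i) • b i, ?_⟩
  conv_lhs => rw [sum_basis_coordMap b v]
  simp only [hc, constR, TensorProduct.sum_tmul, Algebra.algebraMap_eq_smul_one,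
    TensorProduct.smul_tmul]

/-! ### Quasipolynomials -/

theorem commute_constR_scalarR (r : R) (f : Mer) : Commute (constR r) (scalarR f) :=
  (scalarR_mul_comm f (constR r)).symm

/-- The homomorphism `R[X] → M(R)`, `p ↦ p(x)`. -/
noncomputable def polyHom : R[X] →+* MerR R :=
  eval₂RingHom' (Algebra.TensorProduct.includeLeftRingHom : R →+* MerR R) (scalarR Mer.x)
    fun r => commute_constR_scalarR r _

theorem polyR_eq (p : R[X]) : polyR p = polyHom p := by
  change _ = eval₂ _ _ p
  rw [eval₂_eq_sum, polyR]
  refine Finset.sum_congr rfl fun n _ => ?_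
  simp [scalarR]

theorem polyR_C (r : R) : polyR (C r) = constR r := by
  rw [polyR_eq]; exact eval₂_C _ _

theorem polyR_X : polyR (X : R[X]) = scalarR Mer.x := by
  rw [polyR_eq]; exact eval₂_X _ _

theorem polyR_mul (p q : R[X]) : polyR (p * q) = polyR p * polyR q := by simp [polyR_eq]

theorem polyR_add (p q : R[X]) : polyR (p + q) = polyR p + polyR q := by simp [polyR_eq]

theorem polyR_zero : polyR (0 : R[X]) = 0 := by simp [polyR_eq]

theorem polyR_smul (c : ℂ) (p : R[X]) : polyR (c • p) = c • polyR p := by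
  have h : c • p = C (c • 1) * p := by rw [← smul_eq_C_mul, smul_assoc, one_smul]
  rw [h, polyR_mul, polyR_C, constR_smul, constR_one, smul_one_mul]

theorem polyR_map_algebraMap (q : ℂ[X]) :
    polyR (q.map (algebraMap ℂ R)) = scalarR (aeval Mer.x q) := by
  rw [polyR_eq, scalarR_eq, ← aeval_algHom_apply, aeval_def]
  change eval₂ _ _ _ = _
  rw [eval₂_map]
  congr 1

theorem dX_polyR (p : R[X]) : dX R (polyR p) = polyR (derivative p) := by
  induction p using Polynomial.induction_on with
  | C a => simp [polyR_C, dX_constR, polyR_zero]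
  | add p q hp hq => simp only [polyR_add, map_add, hp, hq]
  | monomial n a ih =>
    rw [pow_succ, ← mul_assoc, derivative_mul, derivative_X, mul_one, polyR_mul, dX_mul, ih,
      polyR_add, polyR_mul (derivative _), polyR_X, dX_scalarR, Mer.D_x, scalarR_one, mul_one]

theorem polyR_injective [FiniteDimensional ℂ R] {p : R[X]} (h : polyR p = 0) : p = 0 := by
  have : IsAddTorsionFree R := IsAddTorsionFree.of_isTorsionFree ℂ R
  induction hn : p.natDegree using Nat.strong_induction_on generalizing p with
  | _ n ih =>
    have hd : derivative p = 0 := by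
      by_cases h0 : p.natDegree = 0
      · exact derivative_eq_zero.2 h0
      · exact ih _ (hn ▸ natDegree_derivative_lt h0) (by rw [← dX_polyR, h, map_zero]) rfl
    obtain ⟨r, rfl⟩ := natDegree_eq_zero.1 (derivative_eq_zero.1 hd)
    rw [polyR_C] at h
    rw [constR_injective h, C_0]

theorem quasi_add (p q : R[X]) (α : ℂ) : quasi (p + q) α = quasi p α + quasi q α := by
  rw [quasi, polyR_add, add_mul]; rfl

theorem quasi_zero (α : ℂ) : quasi (0 : R[X]) α = 0 := by rw [quasi, polyR_zero, zero_mul]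

theorem quasi_smul (c : ℂ) (p : R[X]) (α : ℂ) : quasi (c • p) α = c • quasi p α := by
  rw [quasi, polyR_smul, smul_mul_assoc]; rfl

/-- `p ↦ p(x) exp(αx)` as a linear map. -/
noncomputable def quasiHom (α : ℂ) : R[X] →ₗ[ℂ] MerR R where
  toFun p := quasi p α
  map_add' p q := quasi_add p q α
  map_smul' c p := quasi_smul c p α

theorem quasi_sum {ι : Type*} (s : Finset ι) (p : ι → R[X]) (α : ℂ) :
    quasi (∑ i ∈ s, p i) α = ∑ i ∈ s, quasi (p i) α := map_sum (quasiHom α) _ _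

theorem quasi_sub (p q : R[X]) (α : ℂ) : quasi (p - q) α = quasi p α - quasi q α :=
  map_sub (quasiHom α) _ _

theorem quasi_mul_C (p : R[X]) (r : R) (α : ℂ) : quasi (p * C r) α = quasi p α * constR r := by
  rw [quasi, quasi, polyR_mul, polyR_C, mul_assoc, mul_assoc, scalarR_mul_comm]

theorem quasi_C_mul (p : R[X]) (r : R) (α : ℂ) : quasi (C r * p) α = constR r * quasi p α := by
  rw [quasi, quasi, polyR_mul, polyR_C, mul_assoc]

theorem quasi_injective [FiniteDimensional ℂ R] {p : R[X]} {α : ℂ} (h : quasi p α = 0) : p = 0 :=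
  polyR_injective (mul_scalarR_exp_eq_zero h)

theorem dX_quasi (p : R[X]) (α : ℂ) : dX R (quasi p α) = quasi (derivative p + α • p) α := by
  rw [quasi, dX_mul, dX_polyR, dX_scalarR_exp, quasi, polyR_add, polyR_smul, add_mul,
    mul_smul_comm, smul_mul_assoc]

theorem dX_sub_quasi (p : R[X]) (α β : ℂ) :
    (dX R - algebraMap ℂ _ β) (quasi p α) = quasi (derivative p + (α - β) • p) α := by
  rw [LinearMap.sub_apply, dX_quasi, Module.algebraMap_end_apply, ← quasi_smul, ← quasi_sub,
    sub_smul, add_sub_assoc]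

theorem dX_sub_pow_quasi (p : R[X]) (α : ℂ) (n : ℕ) :
    ((dX R - algebraMap ℂ _ α) ^ n) (quasi p α) = quasi (derivative^[n] p) α := by
  induction n with
  | zero => rfl
  | succ n ih =>
    rw [pow_succ', Module.End.mul_apply, ih, dX_sub_quasi, Function.iterate_succ_apply', sub_self,
      zero_smul, add_zero]

theorem quasi_mem_maxGenEigenspace (p : R[X]) (α : ℂ) :
    quasi p α ∈ (dX R).maxGenEigenspace α := by
  rw [Module.End.mem_maxGenEigenspace]
  refine ⟨p.natDegree + 1, ?_⟩
  have := dX_sub_pow_quasi p α (p.natDegree + 1)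
  rw [iterate_derivative_eq_zero (Nat.lt_succ_self _), quasi_zero] at this
  exact this

/-- Quasipolynomials with different exponents are linearly independent. -/
theorem quasi_independent {s : Finset ℂ} {p : ℂ → R[X]} (h : ∑ α ∈ s, quasi (p α) α = 0)
    {α : ℂ} (hα : α ∈ s) : quasi (p α) α = 0 :=
  (iSupIndep_iff_finsetSum_eq_zero_imp_eq_zero _).1 (dX R).independent_maxGenEigenspace s
    (fun α => quasi (p α) α) (fun _ _ => quasi_mem_maxGenEigenspace _ _) h α hα

theorem quasi_C_of_dX_sub_eq_zero [FiniteDimensional ℂ R] {α : ℂ} {v : MerR R}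
    (h : (dX R - algebraMap ℂ _ α) v = 0) : ∃ r, v = quasi (C r) α := by
  rw [LinearMap.sub_apply, Module.algebraMap_end_apply, sub_eq_zero] at h
  obtain ⟨r, hr⟩ := exists_constR_of_dX_eq_zero (v := v * scalarR (Mer.exp (-α))) (by
    rw [dX_mul, dX_scalarR_exp, h, smul_mul_assoc, mul_smul_comm, neg_smul, add_neg_cancel])
  refine ⟨r, ?_⟩
  rw [quasi, polyR_C, ← hr, mul_assoc, scalarR_exp_mul, neg_add_cancel, Mer.exp_zero, scalarR_one,
    mul_one]

/-- The kernel of a power of `∂ₓ - α` consists of quasipolynomials of bounded degree. -/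
theorem exists_quasi_of_dX_sub_pow_eq_zero [FiniteDimensional ℂ R] {α : ℂ} {n : ℕ} {v : MerR R}
    (h : ((dX R - algebraMap ℂ _ α) ^ n) v = 0) :
    ∃ c : ℕ → R, v = ∑ i ∈ Finset.range n, quasi (monomial i (c i)) α := by
  induction n generalizing v with
  | zero => exact ⟨0, by simpa using h⟩
  | succ n ih =>
    obtain ⟨c, hc⟩ := ih (v := (dX R - algebraMap ℂ _ α) v) (by
      rwa [pow_succ, Module.End.mul_apply] at h)
    obtain ⟨r, hr⟩ := quasi_C_of_dX_sub_eq_zero (α := α)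
      (v := v - ∑ i ∈ Finset.range n, quasi (monomial (i + 1) (((i : ℂ) + 1)⁻¹ • c i)) α) (by
        rw [map_sub, hc, map_sum, sub_eq_zero]
        refine Finset.sum_congr rfl fun i _ => ?_
        rw [dX_sub_quasi, sub_self, zero_smul, add_zero, derivative_monomial]
        congr 2
        have : (((i + 1 : ℕ) : R)) = ((i : ℂ) + 1) • (1 : R) := by
          rw [← Algebra.algebraMap_eq_smul_one]; push_cast; simp
        rw [this, mul_smul_comm, mul_one, smul_smul, mul_inv_cancel₀ (Nat.cast_add_one_ne_zero i),
          one_smul])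
    refine ⟨fun i => if i = 0 then r else ((i : ℂ)⁻¹ • c (i - 1)), ?_⟩
    rw [Finset.sum_range_succ']
    simp only [if_true]
    rw [monomial_zero_left, ← hr]
    simp

/-- The kernel of a product of powers of distinct `∂ₓ - a` is the sum of their kernels. -/
theorem exists_sum_of_aeval_dX_eq_zero {S : Finset ℂ} {n : ℂ → ℕ} {v : MerR R}
    (h : aeval (dX R) (∏ a ∈ S, (X - C a) ^ n a) v = 0) :
    ∃ w : ℂ → MerR R, (∀ a, ((dX R - algebraMap ℂ _ a) ^ n a) (w a) = 0) ∧
      v = ∑ a ∈ S, w a := by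
  induction S using Finset.induction_on generalizing v with
  | empty => exact ⟨0, fun a => by simp, by simpa using h⟩
  | insert a S ha ih =>
    rw [Finset.prod_insert ha] at h
    have hcop : IsCoprime ((X - C a) ^ n a) (∏ b ∈ S, (X - C b) ^ n b : ℂ[X]) := by
      refine IsCoprime.prod_right fun b hb => IsCoprime.pow ?_
      exact isCoprime_X_sub_C_of_isUnit_sub (sub_ne_zero.2 (by rintro rfl; exact ha hb)).isUnit
    have h' : v ∈ LinearMap.ker (aeval (dX R) ((X - C a) ^ n a * ∏ b ∈ S, (X - C b) ^ n b)) := h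
    rw [← sup_ker_aeval_eq_ker_aeval_mul_of_coprime _ hcop, Submodule.mem_sup] at h'
    obtain ⟨y, hy, z, hz, rfl⟩ := h'
    obtain ⟨w, hw, rfl⟩ := ih hz
    refine ⟨Function.update w a y, fun b => ?_, ?_⟩
    · rcases eq_or_ne b a with rfl | hb
      · simpa using hy
      · rw [Function.update_of_ne hb]
        exact hw b
    · rw [Finset.sum_insert ha, Function.update_self]
      congr 1
      refine Finset.sum_congr rfl fun b hb => ?_
      rw [Function.update_of_ne]
      rintro rfl
      exact ha hb

/-- The scalar constant coefficient operator `∏ (∂ₓ - b)`, the product over a multiset. -/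
noncomputable def scalarOp (R : Type*) [Ring R] [Algebra ℂ R] (s : Multiset ℂ) :
    Module.End ℂ (MerR R) :=
  aeval (dX R) (s.map fun b => X - C b).prod

theorem scalarOp_cons (b : ℂ) (s : Multiset ℂ) :
    scalarOp R (b ::ₘ s) = (dX R - algebraMap ℂ _ b) * scalarOp R s := by
  simp [scalarOp]

theorem scalarOp_zero : scalarOp R 0 = 1 := by simp [scalarOp]

/-- Solutions of a scalar equation with constant coefficients. The pairs `(b, i)` in
`s.toEnumFinset` are those with `b ∈ s` and `i` less than the multiplicity of `b`. -/
theorem exists_of_scalarOp_eq_zero [FiniteDimensional ℂ R] {s : Multiset ℂ} {v : MerR R}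
    (h : scalarOp R s v = 0) :
    ∃ c : ℂ × ℕ → R, v = ∑ t ∈ s.toEnumFinset, quasi (monomial t.2 (c t)) t.1 := by
  rw [scalarOp, Finset.prod_multiset_map_count] at h
  obtain ⟨w, hw, rfl⟩ := exists_sum_of_aeval_dX_eq_zero h
  choose c hc using fun a => exists_quasi_of_dX_sub_pow_eq_zero (hw a)
  refine ⟨fun t => c t.1 t.2, ?_⟩
  rw [← Finset.sum_fiberwise_of_maps_to (t := s.toFinset) (g := Prod.fst)
    (fun t ht => Multiset.mem_toFinset.2 (Multiset.mem_of_mem_toEnumFinset ht))]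
  refine Finset.sum_congr rfl fun a _ => ?_
  rw [Multiset.toEnumFinset_filter_eq, Finset.sum_product, Finset.sum_singleton]
  exact hc a

theorem scalarOp_quasi_eq_zero {s : Multiset ℂ} {t : ℂ × ℕ} (ht : t ∈ s.toEnumFinset) (r : R) :
    scalarOp R s (quasi (monomial t.2 r) t.1) = 0 := by
  rw [Multiset.mem_toEnumFinset] at ht
  have hle : Multiset.replicate (s.count t.1) t.1 ≤ s := Multiset.le_count_iff_replicate_le.1 le_rfl
  obtain ⟨q, hq⟩ := Multiset.prod_dvd_prod_of_le
    (Multiset.map_le_map (f := fun b : ℂ => (X - C b : ℂ[X])) hle)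
  rw [scalarOp, hq, mul_comm, map_mul, Module.End.mul_apply, Multiset.map_replicate,
    Multiset.prod_replicate, map_pow, map_sub, aeval_X, aeval_C, dX_sub_pow_quasi,
    iterate_derivative_eq_zero ((natDegree_monomial_le _).trans_lt ht), quasi_zero, map_zero]

/-! ### Rational and regular functions -/

/-- The ring of `R`-valued rational functions. -/
def ratR (R : Type*) [Ring R] [Algebra ℂ R] : Subring (MerR R) where
  carrier := {a | IsRational a}
  mul_mem' := by
    rintro a b ⟨q, hq, p, hp⟩ ⟨q', hq', p', hp'⟩
    refine ⟨q * q', mul_ne_zero hq hq', p * p', ?_⟩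
    rw [map_mul, scalarR_mul, polyR_mul, ← hp, ← hp', mul_assoc, mul_assoc,
      ← mul_assoc _ a b, scalarR_mul_comm _ a, mul_assoc]
  one_mem' := ⟨1, one_ne_zero, 1, by
    rw [map_one, scalarR_one, one_mul, ← C_1, polyR_C, constR_one]⟩
  zero_mem' := ⟨1, one_ne_zero, 0, by rw [mul_zero, polyR_zero]⟩
  add_mem' := by
    rintro a b ⟨q, hq, p, hp⟩ ⟨q', hq', p', hp'⟩
    refine ⟨q * q', mul_ne_zero hq hq', q'.map (algebraMap ℂ R) * p + q.map (algebraMap ℂ R) * p',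
      ?_⟩
    rw [polyR_add, polyR_mul, polyR_mul, polyR_map_algebraMap, polyR_map_algebraMap, ← hp, ← hp',
      mul_add, ← mul_assoc, ← mul_assoc, ← scalarR_mul, ← scalarR_mul, map_mul,
      mul_comm (aeval Mer.x q')]
  neg_mem' := by
    rintro a ⟨q, hq, p, hp⟩
    refine ⟨q, hq, -p, ?_⟩
    rw [mul_neg, hp, polyR_eq, polyR_eq, map_neg]

theorem polyR_mem_ratR (p : R[X]) : polyR p ∈ ratR R :=
  ⟨1, one_ne_zero, p, by rw [map_one, scalarR_one, one_mul]⟩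

theorem constR_mem_ratR (r : R) : constR r ∈ ratR R := polyR_C r ▸ polyR_mem_ratR (C r)

theorem dX_mem_ratR {a : MerR R} (h : a ∈ ratR R) : dX R a ∈ ratR R := by
  obtain ⟨q, hq, p, hp⟩ := h
  refine ⟨q * q, mul_ne_zero hq hq, q.map (algebraMap ℂ R) * derivative p -
    (derivative q).map (algebraMap ℂ R) * p, ?_⟩
  have hd := congrArg (dX R) hp
  have hq' : dX R (scalarR (aeval Mer.x q)) = scalarR (aeval Mer.x (derivative q)) := by
    rw [← polyR_map_algebraMap, dX_polyR, derivative_map, polyR_map_algebraMap]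
  rw [dX_mul, dX_polyR, hq'] at hd
  have h1 : polyR (q.map (algebraMap ℂ R) * derivative p - (derivative q).map (algebraMap ℂ R) * p)
      = scalarR (aeval Mer.x q) * polyR (derivative p) -
        scalarR (aeval Mer.x (derivative q)) * polyR p := by
    rw [← polyR_map_algebraMap, ← polyR_map_algebraMap, ← polyR_mul, ← polyR_mul]
    simp only [polyR_eq, map_sub]
  rw [h1, ← hd, ← hp, map_mul, scalarR_mul]
  have h2 : scalarR (aeval Mer.x (derivative q)) * (scalarR (aeval Mer.x q) * a) =
      scalarR (aeval Mer.x q) * (scalarR (aeval Mer.x (derivative q)) * a) := by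
    rw [← mul_assoc, ← mul_assoc, scalarR_mul_comm]
  rw [h2]
  noncomm_ring

/-- Rational functions times different exponentials are linearly independent. -/
theorem rational_exp_independent {s : Finset ℂ} {a : ℂ → MerR R} (ha : ∀ α ∈ s, a α ∈ ratR R)
    (h : ∑ α ∈ s, a α * scalarR (Mer.exp α) = 0) {α : ℂ} (hα : α ∈ s) : a α = 0 := by
  have ha' : ∀ α, ∃ (q : ℂ[X]) (p : R[X]), q ≠ 0 ∧
      (α ∈ s → scalarR (aeval Mer.x q) * a α = polyR p) := fun α => by
    by_cases hα : α ∈ s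
    · obtain ⟨q, hq, p, hp⟩ := ha α hα
      exact ⟨q, p, hq, fun _ => hp⟩
    · exact ⟨1, 0, one_ne_zero, fun h => absurd h hα⟩
  choose q p hq hp using ha'
  -- a common denominator reduces the claim to quasipolynomials
  have key : ∀ β ∈ s, scalarR (aeval Mer.x (∏ γ ∈ s, q γ)) * a β =
      polyR ((∏ γ ∈ s.erase β, q γ).map (algebraMap ℂ R) * p β) := fun β hβ => by
    rw [polyR_mul, polyR_map_algebraMap, ← hp β hβ, ← mul_assoc, ← scalarR_mul, ← map_mul,
      Finset.prod_erase_mul _ _ hβ]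
  have h0 : ∑ β ∈ s, quasi ((∏ γ ∈ s.erase β, q γ).map (algebraMap ℂ R) * p β) β = 0 := by
    rw [← mul_zero (scalarR (aeval Mer.x (∏ γ ∈ s, q γ))), ← h, Finset.mul_sum]
    refine Finset.sum_congr rfl fun β hβ => ?_
    rw [quasi, ← key β hβ, mul_assoc]
  have h1 := mul_scalarR_exp_eq_zero (quasi_independent h0 hα)
  rw [← key α hα] at h1
  obtain ⟨ψ, hψ, -⟩ := Mer.exists_inv_aeval_x (Finset.prod_ne_zero_iff.2 fun γ (_ : γ ∈ s) => hq γ)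
  rw [← one_mul (a α), ← scalarR_one, ← hψ, scalarR_mul, mul_assoc, h1, mul_zero]

/-- The `R`-valued meromorphic functions that are regular at `a`. -/
def regR (R : Type*) [Ring R] [Algebra ℂ R] (a : ℂ) : Subalgebra ℂ (MerR R) :=
  (Algebra.TensorProduct.map (AlgHom.id ℂ R) (Mer.reg a).val).range

theorem regR_induction {a : ℂ} {motive : MerR R → Prop} (zero : motive 0)
    (tmul : ∀ (r : R) (f : Mer), f ∈ Mer.reg a → motive (r ⊗ₜ f))
    (add : ∀ v w, motive v → motive w → motive (v + w)) {v : MerR R} (hv : v ∈ regR R a) :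
    motive v := by
  obtain ⟨u, rfl⟩ := hv
  induction u using TensorProduct.induction_on with
  | zero => simpa using zero
  | tmul r f => exact tmul r f f.2
  | add v w hv hw => simpa using add _ _ hv hw

theorem tmul_mem_regR {a : ℂ} (r : R) {f : Mer} (hf : f ∈ Mer.reg a) :
    (r ⊗ₜ f : MerR R) ∈ regR R a := ⟨r ⊗ₜ ⟨f, hf⟩, rfl⟩

theorem scalarR_mem_regR {a : ℂ} {f : Mer} (hf : f ∈ Mer.reg a) :
    (scalarR f : MerR R) ∈ regR R a := tmul_mem_regR 1 hf

theorem dX_mem_regR {a : ℂ} {v : MerR R} (hv : v ∈ regR R a) : dX R v ∈ regR R a := by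
  refine regR_induction (motive := fun v => dX R v ∈ regR R a)
    (by rw [map_zero]; exact zero_mem _) (fun r f hf => ?_)
    (fun v w hv hw => by rw [map_add]; exact add_mem hv hw) hv
  exact tmul_mem_regR r (Mer.D_mem_reg hf)

theorem polyR_mem_regR (a : ℂ) (p : R[X]) : polyR p ∈ regR R a := by
  rw [polyR]
  exact sum_mem fun n _ => tmul_mem_regR _ (pow_mem (Mer.x_mem_reg a) n)

theorem quasi_mem_regR (a : ℂ) (p : R[X]) (α : ℂ) : quasi p α ∈ regR R a :=
  mul_mem (polyR_mem_regR a p) (scalarR_mem_regR (Mer.exp_mem_reg α a))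

/-- A rational function is regular at all but finitely many points. -/
theorem eventually_mem_regR {v : MerR R} (hv : v ∈ ratR R) :
    ∀ᶠ a in cofinite, v ∈ regR R a := by
  obtain ⟨q, hq, p, hp⟩ := hv
  obtain ⟨ψ, hψ, hreg⟩ := Mer.exists_inv_aeval_x hq
  have hfin : ∀ᶠ a in cofinite, q.eval a ≠ 0 := by
    simpa using! finite_setOfPred_isRoot hq
  filter_upwards [hfin] with a ha
  rw [← one_mul v, ← scalarR_one, ← hψ, scalarR_mul, mul_assoc, hp]
  exact mul_mem (scalarR_mem_regR (hreg a ha)) (polyR_mem_regR a p)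

/-- Evaluation at `a`, extended arbitrarily from the functions regular at `a`. -/
noncomputable def evalR (R : Type*) [Ring R] [Algebra ℂ R] (a : ℂ) : MerR R →ₗ[ℂ] R :=
  (TensorProduct.rid ℂ R).toLinearMap ∘ₗ LinearMap.lTensor R (Mer.evalAt a)

theorem evalR_tmul (a : ℂ) (r : R) (f : Mer) : evalR R a (r ⊗ₜ f) = Mer.evalAt a f • r := by
  simp [evalR]

theorem evalR_mul {a : ℂ} {v w : MerR R} (hv : v ∈ regR R a) (hw : w ∈ regR R a) :
    evalR R a (v * w) = evalR R a v * evalR R a w := by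
  refine regR_induction (motive := fun v => evalR R a (v * w) = evalR R a v * evalR R a w)
    (by simp) (fun r f hf => ?_)
    (fun v v' h h' => by rw [add_mul, map_add, map_add, h, h', add_mul]) hv
  refine regR_induction
    (motive := fun w => evalR R a (r ⊗ₜ f * w) = evalR R a (r ⊗ₜ f) * evalR R a w)
    (by simp) (fun s g hg => ?_)
    (fun w w' h h' => by rw [mul_add, map_add, map_add, h, h', mul_add]) hw
  rw [Algebra.TensorProduct.tmul_mul_tmul, evalR_tmul, evalR_tmul, evalR_tmul,
    Mer.evalAt_mul hf hg, smul_mul_smul_comm]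

theorem evalR_mul_constR (a : ℂ) (v : MerR R) (r : R) :
    evalR R a (v * constR r) = evalR R a v * r := by
  induction v using TensorProduct.induction_on with
  | zero => simp
  | tmul s f => rw [constR, Algebra.TensorProduct.tmul_mul_tmul, mul_one, evalR_tmul, evalR_tmul,
      smul_mul_assoc]
  | add v w hv hw => rw [add_mul, map_add, hv, hw, map_add, add_mul]

theorem dual_evalR (φ : Module.Dual ℂ R) (a : ℂ) (v : MerR R) :
    φ (evalR R a v) = Mer.evalAt a (coordMap φ v) := by
  induction v using TensorProduct.induction_on with
  | zero => simp
  | tmul s f =>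
    rw [evalR_tmul, coordMap_tmul, map_smul, map_smul, smul_eq_mul, smul_eq_mul, mul_comm]
  | add v w hv hw => rw [map_add, map_add, hv, hw, map_add, map_add]

theorem coordMap_mem_reg (φ : Module.Dual ℂ R) {a : ℂ} {v : MerR R} (hv : v ∈ regR R a) :
    coordMap φ v ∈ Mer.reg a := by
  refine regR_induction (motive := fun v => coordMap φ v ∈ Mer.reg a)
    (by rw [map_zero]; exact zero_mem _) (fun r f hf => ?_)
    (fun v w hv hw => by rw [map_add]; exact add_mem hv hw) hv
  rw [coordMap_tmul]
  exact Subalgebra.smul_mem _ hf _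

/-- A function regular at `a` all of whose derivatives vanish at `a` is zero. -/
theorem eq_zero_of_evalR [FiniteDimensional ℂ R] {a : ℂ} {v : MerR R} (hv : v ∈ regR R a)
    (h : ∀ k, evalR R a ((dX R ^ k) v) = 0) : v = 0 := by
  refine eq_zero_of_coordMap fun φ => Mer.eq_zero_of_evalAt (coordMap_mem_reg φ hv) fun k => ?_
  rw [← coordMap_dX_pow, ← dual_evalR, h, map_zero]

end MerR

/-! ### Differential operators -/

section DiffOp

variable {R : Type*} [Ring R] [Algebra ℂ R]

theorem coeff_coeffMap (A : Module.End ℂ R) (u : R[X]) (n : ℕ) :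
    (coeffMap A u).coeff n = A (u.coeff n) := by
  rw [coeffMap, Polynomial.sum, finsetSum_coeff]
  simp only [coeff_monomial, Finset.sum_ite_eq', mem_support_iff, ne_eq]
  split_ifs with h
  · rfl
  · rw [notMem_support_iff.1 h, map_zero]

theorem diffOp_add (p q : (MerR R)[X]) : diffOp (p + q) = diffOp p + diffOp q := by
  refine sum_add_index p q _ (fun k => ?_) fun k a b => ?_
  · rw [LinearMap.mulLeft_zero_eq_zero, zero_mul]
  · rw [← add_mul]
    congr 1
    exact LinearMap.ext fun v => add_mul a b v

theorem diffOp_monomial (k : ℕ) (a : MerR R) :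
    diffOp (monomial k a) = LinearMap.mulLeft ℂ a * dX R ^ k :=
  sum_monomial_index a _ (by rw [LinearMap.mulLeft_zero_eq_zero, zero_mul])

theorem diffOp_zero : diffOp (0 : (MerR R)[X]) = 0 := sum_zero_index _

/-- `diffOp` as an additive homomorphism. -/
noncomputable def diffOpHom (R : Type*) [Ring R] [Algebra ℂ R] :
    (MerR R)[X] →+ Module.End ℂ (MerR R) where
  toFun := diffOp
  map_zero' := diffOp_zero
  map_add' := diffOp_add

theorem diffOp_sum {ι : Type*} (s : Finset ι) (p : ι → (MerR R)[X]) :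
    diffOp (∑ i ∈ s, p i) = ∑ i ∈ s, diffOp (p i) := map_sum (diffOpHom R) p s

theorem diffOp_apply {p : (MerR R)[X]} {n : ℕ} (hn : p.natDegree < n) (v : MerR R) :
    diffOp p v = ∑ k ∈ Finset.range n, p.coeff k * (dX R ^ k) v := by
  rw [diffOp, sum_over_range' _ (fun k => by rw [LinearMap.mulLeft_zero_eq_zero, zero_mul]) n hn,
    LinearMap.sum_apply]
  rfl

theorem diffOp_mul_constR (p : (MerR R)[X]) (v : MerR R) (r : R) :
    diffOp p (v * constR r) = diffOp p v * constR r := by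
  rw [diffOp_apply (Nat.lt_succ_self _), diffOp_apply (Nat.lt_succ_self _), Finset.sum_mul]
  exact Finset.sum_congr rfl fun k _ => by rw [dX_pow_mul_constR, mul_assoc]

theorem dX_mul_diffOp (p : (MerR R)[X]) :
    dX R * diffOp p = diffOp (X * p + coeffMap (dX R) p) := by
  induction p using Polynomial.induction_on' with
  | add p q hp hq =>
    have : coeffMap (dX R) (p + q) = coeffMap (dX R) p + coeffMap (dX R) q := by
      ext n; simp [coeff_coeffMap]
    rw [diffOp_add, mul_add, hp, hq, this, mul_add, ← diffOp_add]
    congr 1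
    abel
  | monomial k a =>
    have : coeffMap (dX R) (monomial k a) = monomial k (dX R a) := by
      ext n
      rw [coeff_coeffMap, coeff_monomial, coeff_monomial]
      split_ifs <;> simp
    rw [this, diffOp_add, X_mul_monomial, diffOp_monomial, diffOp_monomial, diffOp_monomial]
    refine LinearMap.ext fun v => ?_
    simp only [Module.End.mul_apply, LinearMap.mulLeft_apply, LinearMap.add_apply, dX_mul,
      pow_succ']
    exact add_comm _ _

theorem mulLeft_mul_diffOp (a : MerR R) (p : (MerR R)[X]) :
    LinearMap.mulLeft ℂ a * diffOp p = diffOp (C a * p) := by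
  induction p using Polynomial.induction_on' with
  | add p q hp hq => rw [diffOp_add, mul_add, hp, hq, mul_add, diffOp_add]
  | monomial k b =>
    rw [C_mul_monomial, diffOp_monomial, diffOp_monomial, ← mul_assoc, LinearMap.mulLeft_mul]
    rfl

section Product

variable {A : Subring (MerR R)} (hA : ∀ a ∈ A, dX R a ∈ A)
include hA

theorem exists_diffOp_dX_pow_mul {q : (MerR R)[X]} {d : ℕ} (hq : ∀ k, q.coeff k ∈ A)
    (hd : q.natDegree ≤ d) (n : ℕ) : ∃ s : (MerR R)[X], (∀ k, s.coeff k ∈ A) ∧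
      s.natDegree ≤ n + d ∧ s.coeff (n + d) = q.coeff d ∧ dX R ^ n * diffOp q = diffOp s := by
  induction n with
  | zero => exact ⟨q, hq, by simpa using hd, by simp, by simp⟩
  | succ n ih =>
    obtain ⟨s, hs, hsd, hsc, he⟩ := ih
    have hlt : s.natDegree < n + 1 + d := by omega
    refine ⟨X * s + coeffMap (dX R) s, fun k => ?_, ?_, ?_, ?_⟩
    · rw [coeff_add, coeff_coeffMap]
      refine add_mem ?_ (hA _ (hs k))
      cases k with
      | zero => rw [mul_coeff_zero, coeff_X_zero, zero_mul]; exact zero_mem _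
      | succ k => rw [coeff_X_mul]; exact hs k
    · refine natDegree_le_iff_coeff_eq_zero.2 fun N hN => ?_
      rw [coeff_add, coeff_coeffMap, coeff_eq_zero_of_natDegree_lt (show s.natDegree < N by omega),
        map_zero, add_zero]
      obtain ⟨N, rfl⟩ : ∃ N', N = N' + 1 := ⟨N - 1, by omega⟩
      rw [coeff_X_mul, coeff_eq_zero_of_natDegree_lt (by omega)]
    · rw [coeff_add, coeff_coeffMap, coeff_eq_zero_of_natDegree_lt hlt, map_zero, add_zero,
        show n + 1 + d = n + d + 1 by omega, coeff_X_mul, hsc]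
    · rw [pow_succ', mul_assoc, he, dX_mul_diffOp]

/-- Differential operators with coefficients in a differential ring form a ring, and top
coefficients multiply. -/
theorem exists_diffOp_mul {p q : (MerR R)[X]} {r d : ℕ} (hp : ∀ k, p.coeff k ∈ A)
    (hr : p.natDegree ≤ r) (hq : ∀ k, q.coeff k ∈ A) (hd : q.natDegree ≤ d) :
    ∃ s : (MerR R)[X], (∀ k, s.coeff k ∈ A) ∧ s.natDegree ≤ r + d ∧
      s.coeff (r + d) = p.coeff r * q.coeff d ∧ diffOp p * diffOp q = diffOp s := by
  choose s hs hsd hsc he using exists_diffOp_dX_pow_mul hA hq hd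
  refine ⟨∑ k ∈ Finset.range (r + 1), C (p.coeff k) * s k, fun k => ?_, ?_, ?_, ?_⟩
  · rw [finsetSum_coeff]
    exact sum_mem fun i _ => by rw [coeff_C_mul]; exact mul_mem (hp i) (hs i k)
  · refine natDegree_sum_le_of_forall_le _ _ fun i hi => (natDegree_C_mul_le _ _).trans ?_
    have := hsd i
    have := Finset.mem_range.1 hi
    omega
  · rw [finsetSum_coeff, Finset.sum_eq_single_of_mem r (by simp)]
    · rw [coeff_C_mul, hsc]
    · intro i hi hne
      have := hsd i
      have := Finset.mem_range.1 hi
      rw [coeff_C_mul, coeff_eq_zero_of_natDegree_lt (p := s i) (by omega), mul_zero]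
  · rw [diffOp_sum]
    conv_lhs => rw [p.as_sum_range' (r + 1) (by omega), diffOp_sum, Finset.sum_mul]
    refine Finset.sum_congr rfl fun k _ => ?_
    rw [diffOp_monomial, mul_assoc, he, mulLeft_mul_diffOp]

theorem exists_monic_diffOp_mul [Nontrivial (MerR R)] {p q : (MerR R)[X]}
    (hp : ∀ k, p.coeff k ∈ A) (hpm : p.Monic) (hq : ∀ k, q.coeff k ∈ A) (hqm : q.Monic) :
    ∃ s : (MerR R)[X], (∀ k, s.coeff k ∈ A) ∧ s.Monic ∧ s.natDegree = p.natDegree + q.natDegree ∧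
      diffOp p * diffOp q = diffOp s := by
  obtain ⟨s, hs, hsd, hsc, he⟩ := exists_diffOp_mul hA hp le_rfl hq le_rfl
  have hc : s.coeff (p.natDegree + q.natDegree) = 1 := by
    rw [hsc, hpm.coeff_natDegree, hqm.coeff_natDegree, one_mul]
  have hdeg : s.natDegree = p.natDegree + q.natDegree :=
    le_antisymm hsd (le_natDegree_of_ne_zero (by rw [hc]; exact one_ne_zero))
  exact ⟨s, hs, by rw [Monic, leadingCoeff, hdeg, hc], hdeg, he⟩

end Product

/-! ### An operator is determined by its wave function -/

theorem dX_pow_scalarR_exp (k : ℕ) (z : ℂ) :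
    (dX R ^ k) (scalarR (Mer.exp z)) = z ^ k • scalarR (Mer.exp z) := by
  induction k with
  | zero => simp
  | succ k ih => rw [pow_succ', Module.End.mul_apply, ih, map_smul, dX_scalarR_exp, smul_smul,
      pow_succ]

theorem wave_diffOp (p : (MerR R)[X]) (z : ℂ) :
    wave (diffOp p) z = p.eval (algebraMap ℂ (MerR R) z) * scalarR (Mer.exp z) := by
  rw [wave, diffOp_apply (Nat.lt_succ_self _), eval_eq_sum_range, Finset.sum_mul]
  refine Finset.sum_congr rfl fun k _ => ?_
  rw [dX_pow_scalarR_exp, ← map_pow, mul_assoc, Algebra.smul_def]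

theorem eq_zero_of_infinite_eval {V : Type*} [Ring V] [Algebra ℂ V] {p : V[X]} {S : Set ℂ}
    (hS : S.Infinite) (h : ∀ z ∈ S, p.eval (algebraMap ℂ V z) = 0) : p = 0 := by
  ext k
  rw [coeff_zero, ← Module.forall_dual_apply_eq_zero_iff ℂ]
  intro φ
  let q : ℂ[X] := ∑ i ∈ Finset.range (p.natDegree + 1), monomial i (φ (p.coeff i))
  have hq : q = 0 := by
    refine eq_zero_of_infinite_isRoot q (hS.mono fun z hz => ?_)
    have := congrArg φ (h z hz)
    rw [eval_eq_sum_range, map_sum, map_zero] at this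
    change eval z q = 0
    rw [← this, eval_finsetSum]
    refine Finset.sum_congr rfl fun i _ => ?_
    rw [eval_monomial, ← map_pow, ← Algebra.commutes, ← Algebra.smul_def, map_smul, smul_eq_mul,
      mul_comm]
  have hk : q.coeff k = φ (p.coeff k) := by
    simp only [q, finsetSum_coeff, coeff_monomial, Finset.sum_ite_eq', Finset.mem_range]
    split_ifs with hk
    · rfl
    · rw [coeff_eq_zero_of_natDegree_lt (by omega), map_zero]
  rw [← hk, hq, coeff_zero]

theorem diffOp_symbol_eq_of_wave_eq {p q : (MerR R)[X]} {S : Set ℂ} (hS : S.Infinite)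
    (h : ∀ z ∈ S, wave (diffOp p) z = wave (diffOp q) z) : p = q := by
  refine sub_eq_zero.1 (eq_zero_of_infinite_eval hS fun z hz => ?_)
  have := h z hz
  rw [wave_diffOp, wave_diffOp, ← sub_eq_zero, ← sub_mul] at this
  rw [eval_sub, mul_scalarR_exp_eq_zero this]

theorem diffOp_injective {p q : (MerR R)[X]} (h : diffOp p = diffOp q) : p = q :=
  diffOp_symbol_eq_of_wave_eq (S := Set.univ) Set.infinite_univ fun z _ => by rw [h]

/-! ### Operators with constant coefficients -/

theorem commute_mulLeft_constR_dX (r : R) :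
    Commute (LinearMap.mulLeft ℂ (constR r)) (dX R) := by
  exact LinearMap.ext fun v => (dX_constR_mul v r).symm

/-- `L ↦ L(∂ₓ)` as a ring homomorphism. -/
noncomputable def constOpHom (R : Type*) [Ring R] [Algebra ℂ R] :
    R[X] →+* Module.End ℂ (MerR R) :=
  eval₂RingHom' ((Algebra.lmul ℂ (MerR R)).toRingHom.comp
    (Algebra.TensorProduct.includeLeftRingHom : R →+* MerR R)) (dX R)
    commute_mulLeft_constR_dX

theorem constOp_eq (L : R[X]) : constOp L = constOpHom R L := by
  induction L using Polynomial.induction_on' with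
  | add p q hp hq => rw [map_add, ← hp, ← hq, constOp, Polynomial.map_add, diffOp_add]; rfl
  | monomial k a =>
    rw [constOp, map_monomial, diffOp_monomial]
    change _ = eval₂ _ _ _
    rw [eval₂_monomial]
    rfl

theorem constOp_mul (L M : R[X]) : constOp (L * M) = constOp L * constOp M := by
  rw [constOp_eq, map_mul, ← constOp_eq, ← constOp_eq]

theorem constOp_C (r : R) : constOp (C r) = LinearMap.mulLeft ℂ (constR r) := by
  rw [constOp_eq]; exact eval₂_C _ _

theorem constOp_X : constOp (X : R[X]) = dX R := by
  rw [constOp_eq]; exact eval₂_X _ _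

theorem constOp_map_algebraMap (h : ℂ[X]) :
    constOp (h.map (algebraMap ℂ R)) = aeval (dX R) h := by
  rw [constOp_eq]
  change eval₂ _ _ _ = eval₂ _ _ _
  rw [eval₂_map]
  congr 1
  refine RingHom.ext fun c => LinearMap.ext fun v => ?_
  change constR (algebraMap ℂ R c) * v = c • v
  rw [Algebra.algebraMap_eq_smul_one, constR_smul, constR_one, smul_one_mul]

theorem constOp_mem_ratR (L : R[X]) (k : ℕ) :
    (L.map (Algebra.TensorProduct.includeLeftRingHom : R →+* MerR R)).coeff k ∈ ratR R := by
  rw [coeff_map]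
  exact constR_mem_ratR _

end DiffOp

/-! ### The diagonal subalgebra -/

section Diag

variable {R : Type*} [Ring R] [Algebra ℂ R] {m : ℕ} {e : Fin m → R}

theorem diagElt_mul (he : CompleteOrthogonalIdempotents e) (γ δ : Fin m → ℂ) :
    diagElt e (γ * δ) = diagElt e γ * diagElt e δ := by
  simp only [diagElt, Finset.sum_mul_sum, smul_mul_smul_comm, Pi.mul_apply]
  refine Finset.sum_congr rfl fun i _ => ?_
  rw [Finset.sum_eq_single_of_mem i (Finset.mem_univ i), (he.idem i).eq]
  intro j _ hj
  rw [he.ortho hj.symm, smul_zero]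

theorem diagElt_one (he : CompleteOrthogonalIdempotents e) : diagElt e 1 = 1 := by
  simp [diagElt, he.complete]

/-- The embedding `γ ↦ ∑ γₖ eₖ` of `ℂᵐ` in `R`. -/
noncomputable def diagHom (he : CompleteOrthogonalIdempotents e) : (Fin m → ℂ) →ₐ[ℂ] R where
  toFun := diagElt e
  map_one' := diagElt_one he
  map_mul' := diagElt_mul he
  map_zero' := by simp [diagElt]
  map_add' γ δ := by simp [diagElt, add_smul, Finset.sum_add_distrib]
  commutes' c := by
    simp [diagElt, ← Finset.smul_sum, he.complete, Algebra.algebraMap_eq_smul_one]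

theorem diagHom_apply (he : CompleteOrthogonalIdempotents e) (γ : Fin m → ℂ) :
    diagHom he γ = diagElt e γ := rfl

theorem idem_mul_diagElt (he : CompleteOrthogonalIdempotents e) (γ : Fin m → ℂ) (k : Fin m) :
    e k * diagElt e γ = γ k • e k := by
  rw [diagElt, Finset.mul_sum, Finset.sum_eq_single_of_mem k (Finset.mem_univ k), mul_smul_comm,
    (he.idem k).eq]
  intro j _ hj
  rw [mul_smul_comm, he.ortho hj.symm, smul_zero]

theorem diagElt_mul_idem (he : CompleteOrthogonalIdempotents e) (γ : Fin m → ℂ) (k : Fin m) :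
    diagElt e γ * e k = γ k • e k := by
  rw [diagElt, Finset.sum_mul, Finset.sum_eq_single_of_mem k (Finset.mem_univ k), smul_mul_assoc,
    (he.idem k).eq]
  intro j _ hj
  rw [smul_mul_assoc, he.ortho hj, smul_zero]

theorem diagElt_injective (he : CompleteOrthogonalIdempotents e) (hne : ∀ k, e k ≠ 0)
    {γ δ : Fin m → ℂ} (h : diagElt e γ = diagElt e δ) : γ = δ := by
  ext k
  have := congrArg (e k * ·) h
  simp only [idem_mul_diagElt he] at this
  exact smul_left_injective ℂ (hne k) this

theorem linOp_eq_constOp (γ : Fin m → ℂ) : linOp e γ = constOp (X - C (diagElt e γ)) := by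
  rw [constOp_eq, map_sub, ← constOp_eq, ← constOp_eq, constOp_X, constOp_C]; rfl

theorem linOp_apply (γ : Fin m → ℂ) (v : MerR R) :
    linOp e γ v = dX R v - constR (diagElt e γ) * v := rfl

theorem prod_linOp_eq_constOp (γs : List (Fin m → ℂ)) :
    (γs.map (linOp e)).prod = constOp (γs.map fun γ => X - C (diagElt e γ)).prod := by
  rw [constOp_eq, map_list_prod, List.map_map]
  congr 2
  ext1 γ
  rw [linOp_eq_constOp, constOp_eq]; rfl

theorem commute_linOp (he : CompleteOrthogonalIdempotents e) (γ δ : Fin m → ℂ) :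
    Commute (linOp e γ) (linOp e δ) := by
  have h : Commute (LinearMap.mulLeft ℂ (constR (diagElt e γ)))
      (LinearMap.mulLeft ℂ (constR (diagElt e δ))) := by
    rw [Commute, SemiconjBy, Module.End.mul_eq_comp, Module.End.mul_eq_comp,
      ← LinearMap.mulLeft_mul, ← LinearMap.mulLeft_mul, ← constR_mul, ← constR_mul,
      ← diagElt_mul he, ← diagElt_mul he, mul_comm]
  exact ((Commute.refl _).sub_right (commute_mulLeft_constR_dX _).symm).sub_left
    ((commute_mulLeft_constR_dX _).sub_right h)

theorem prod_linOp_scalarR_exp (he : CompleteOrthogonalIdempotents e) (γs : List (Fin m → ℂ))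
    (z : ℂ) :
    (γs.map (linOp e)).prod (scalarR (Mer.exp z)) =
      scalarR (Mer.exp z) * constR (diagElt e fun k => (γs.map fun γ => z - γ k).prod) := by
  induction γs with
  | nil =>
    change _ = _ * constR (diagElt e 1)
    rw [diagElt_one he, constR_one, mul_one]; rfl
  | cons γ γs ih =>
    have h : diagElt e (fun k => ((γ :: γs).map fun γ => z - γ k).prod) =
        (algebraMap ℂ R z - diagElt e γ) * diagElt e fun k => (γs.map fun γ => z - γ k).prod := by
      rw [← (diagHom he).commutes z, ← diagHom_apply he γ, ← map_sub, diagHom_apply,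
        ← diagElt_mul he]
      rfl
    rw [List.map_cons, List.prod_cons, Module.End.mul_apply, ih, linOp_apply, dX_mul_constR,
      dX_scalarR_exp, ← mul_assoc (constR _), ← scalarR_mul_comm, h, constR_mul, constR_sub,
      Algebra.algebraMap_eq_smul_one, constR_smul, constR_one]
    simp only [sub_mul, mul_sub, mul_assoc, smul_mul_assoc, one_mul, mul_smul_comm]

end Diag

/-! ### The operators `F_A` -/

section OpF

variable {R : Type*} [Ring R] [Algebra ℂ R]

theorem coeffMap_zero_right (A : Module.End ℂ R) : coeffMap A 0 = 0 := by
  ext n; simp [coeff_coeffMap]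

theorem coeffMap_add_right (A : Module.End ℂ R) (u v : R[X]) :
    coeffMap A (u + v) = coeffMap A u + coeffMap A v := by ext n; simp [coeff_coeffMap]

theorem coeffMap_smul_left (c : ℂ) (A : Module.End ℂ R) (u : R[X]) :
    coeffMap (c • A) u = c • coeffMap A u := by ext n; simp [coeff_coeffMap]

theorem coeffMap_smul_right (c : ℂ) (A : Module.End ℂ R) (u : R[X]) :
    coeffMap A (c • u) = c • coeffMap A u := by ext n; simp [coeff_coeffMap]

theorem coeffMap_neg_left (A : Module.End ℂ R) (u : R[X]) :
    coeffMap (-A) u = -coeffMap A u := by ext n; simp [coeff_coeffMap]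

theorem coeffMap_one (u : R[X]) : coeffMap (1 : Module.End ℂ R) u = u := by
  ext n; simp [coeff_coeffMap]

theorem coeffMap_mul (A B : Module.End ℂ R) (u : R[X]) :
    coeffMap (A * B) u = coeffMap A (coeffMap B u) := by ext n; simp [coeff_coeffMap]

/-- `coeffMap A` as a linear map. -/
noncomputable def coeffMapHom (A : Module.End ℂ R) : Module.End ℂ R[X] where
  toFun := coeffMap A
  map_add' := coeffMap_add_right A
  map_smul' c u := coeffMap_smul_right c A u

theorem coeffMap_sum (A : Module.End ℂ R) {ι : Type*} (s : Finset ι) (u : ι → R[X]) :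
    coeffMap A (∑ i ∈ s, u i) = ∑ i ∈ s, coeffMap A (u i) := map_sum (coeffMapHom A) u s

theorem coeffMap_X_pow_mul (A : Module.End ℂ R) (k : ℕ) (u : R[X]) :
    coeffMap A (X ^ k * u) = X ^ k * coeffMap A u := by
  ext n
  rw [coeff_coeffMap, coeff_X_pow_mul', coeff_X_pow_mul', coeff_coeffMap]
  split_ifs <;> simp

theorem derivative_coeffMap (A : Module.End ℂ R) (u : R[X]) :
    derivative (coeffMap A u) = coeffMap A (derivative u) := by
  ext n
  rw [coeff_derivative, coeff_coeffMap, coeff_coeffMap, coeff_derivative]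
  have h : ∀ r : R, r * ((n : R) + 1) = ((n : ℂ) + 1) • r := fun r => by
    rw [Algebra.smul_def, Algebra.commutes]; simp
  rw [h, h, map_smul]

theorem coeffMap_mul_C {A : Module.End ℂ R} (hA : ∀ s r : R, A (s * r) = A s * r) (u : R[X])
    (r : R) : coeffMap A (u * C r) = coeffMap A u * C r := by
  ext n
  rw [coeff_coeffMap, coeff_mul_C, coeff_mul_C, coeff_coeffMap, hA]

theorem coeff_primitive_succ (u : R[X]) (n : ℕ) :
    (primitive u).coeff (n + 1) = ((n : ℂ) + 1)⁻¹ • u.coeff n := by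
  rw [primitive, Polynomial.sum, finsetSum_coeff]
  simp only [coeff_monomial, Nat.add_right_cancel_iff, Finset.sum_ite_eq', mem_support_iff, ne_eq]
  split_ifs with h
  · rfl
  · rw [notMem_support_iff.1 h, smul_zero]

theorem coeff_primitive_zero (u : R[X]) : (primitive u).coeff 0 = 0 := by
  rw [primitive, Polynomial.sum, finsetSum_coeff]
  exact Finset.sum_eq_zero fun n _ => by rw [coeff_monomial, if_neg (Nat.succ_ne_zero n)]

theorem derivative_primitive (u : R[X]) : derivative (primitive u) = u := by
  ext n
  rw [coeff_derivative, coeff_primitive_succ]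
  have h : ∀ r : R, r * ((n : R) + 1) = ((n : ℂ) + 1) • r := fun r => by
    rw [Algebra.smul_def, Algebra.commutes]; simp
  rw [h, smul_smul, mul_inv_cancel₀ (Nat.cast_add_one_ne_zero n), one_smul]

theorem coeffMap_primitive (A : Module.End ℂ R) (u : R[X]) :
    coeffMap A (primitive u) = primitive (coeffMap A u) := by
  ext n
  rw [coeff_coeffMap]
  cases n with
  | zero => rw [coeff_primitive_zero, coeff_primitive_zero, map_zero]
  | succ n => rw [coeff_primitive_succ, coeff_primitive_succ, coeff_coeffMap, map_smul]

theorem primitive_mul_C (u : R[X]) (r : R) : primitive (u * C r) = primitive u * C r := by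
  ext n
  rw [coeff_mul_C]
  cases n with
  | zero => rw [coeff_primitive_zero, coeff_primitive_zero, zero_mul]
  | succ n => rw [coeff_primitive_succ, coeff_primitive_succ, coeff_mul_C, smul_mul_assoc]

theorem coeffMap_expAct {A B : Module.End ℂ R} (h : Commute B A) (u : R[X]) :
    coeffMap B (expAct A u) = expAct A (coeffMap B u) := by
  rw [expAct, expAct, coeffMap_sum]
  refine Finset.sum_congr rfl fun k _ => ?_
  rw [coeffMap_X_pow_mul, ← coeffMap_mul, ← coeffMap_mul, mul_smul_comm, smul_mul_assoc,
    (h.pow_right k).eq]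

theorem expAct_mul_C {A : Module.End ℂ R} (hA : ∀ s r : R, A (s * r) = A s * r) (u : R[X])
    (r : R) : expAct A (u * C r) = expAct A u * C r := by
  have hpow : ∀ (k : ℕ) (s r : R), (A ^ k) (s * r) = (A ^ k) s * r := fun k => by
    induction k with
    | zero => intro s r; rfl
    | succ k ih => intro s r; rw [pow_succ', Module.End.mul_apply, ih, hA]; rfl
  rw [expAct, expAct, Finset.sum_mul]
  refine Finset.sum_congr rfl fun k _ => ?_
  rw [mul_assoc, coeffMap_mul_C fun s r => ?_]
  rw [LinearMap.smul_apply, LinearMap.smul_apply, hpow, smul_mul_assoc]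

/-- On polynomials with coefficients killed by `A ^ dim R`, the truncated exponential satisfies
the differential equation of the exponential. -/
theorem derivative_expAct {A : Module.End ℂ R} {u : R[X]}
    (h : coeffMap (A ^ Module.finrank ℂ R) u = 0) :
    derivative (expAct A u) = coeffMap A (expAct A u) + expAct A (derivative u) := by
  have h1 : ∀ k : ℕ, derivative (X ^ k * coeffMap ((k.factorial : ℂ)⁻¹ • A ^ k) u) =
      derivative (X ^ k : R[X]) * coeffMap ((k.factorial : ℂ)⁻¹ • A ^ k) u +
        X ^ k * coeffMap ((k.factorial : ℂ)⁻¹ • A ^ k) (derivative u) := fun k => by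
    rw [derivative_mul, derivative_coeffMap]
  have h2 : ∀ k : ℕ, derivative (X ^ (k + 1) : R[X]) *
      coeffMap (((k + 1).factorial : ℂ)⁻¹ • A ^ (k + 1)) u =
        coeffMap A (X ^ k * coeffMap ((k.factorial : ℂ)⁻¹ • A ^ k) u) := fun k => by
    rw [derivative_X_pow, coeffMap_X_pow_mul, ← coeffMap_mul, mul_smul_comm, ← pow_succ',
      Nat.add_sub_cancel, coeffMap_smul_left, coeffMap_smul_left, Nat.factorial_succ]
    have : (C (((k + 1 : ℕ) : R)) : R[X]) = (((k + 1 : ℕ) : ℂ)) • (1 : R[X]) := by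
      rw [← Algebra.algebraMap_eq_smul_one]; simp
    rw [this, smul_one_mul, smul_mul_assoc, mul_smul_comm, mul_smul_comm, smul_smul, Nat.cast_mul,
      mul_inv, ← mul_assoc, mul_inv_cancel₀ (Nat.cast_ne_zero.2 (Nat.succ_ne_zero k)), one_mul]
  rw [expAct, expAct, derivative_sum, Finset.sum_congr rfl fun k _ => h1 k, Finset.sum_add_distrib]
  congr 1
  rw [coeffMap_sum]
  rcases hd : Module.finrank ℂ R with _ | d'
  · rw [Finset.sum_range_zero, Finset.sum_range_zero]
  · rw [Finset.sum_range_succ', Finset.sum_congr rfl fun k _ => h2 k, Finset.sum_range_succ,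
      coeffMap_X_pow_mul, ← coeffMap_mul, mul_smul_comm, ← pow_succ',
      coeffMap_smul_left (d'.factorial : ℂ)⁻¹, ← hd, h]
    simp

/-- On polynomials with coefficients killed by `A ^ dim R`, the truncated exponentials of `xA` and
`-xA` are inverse to each other. -/
theorem expAct_neg_expAct {A : Module.End ℂ R} {u : R[X]}
    (h : coeffMap (A ^ Module.finrank ℂ R) u = 0) : expAct (-A) (expAct A u) = u := by
  -- `T = xA` satisfies `T ^ d u = 0`, and `exp(-T) exp(T) = 1` holds for the truncated series
  -- modulo `T ^ d`
  let T : Module.End ℂ R[X] := LinearMap.mulLeft ℂ X * coeffMapHom A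
  set d := Module.finrank ℂ R with hd
  have hT : ∀ (c : ℂ) (k : ℕ) (v : R[X]),
      X ^ k * coeffMap (c • A ^ k) v = c • (T ^ k) v := fun c k v => by
    rw [coeffMap_smul_left, mul_smul_comm]
    congr 1
    induction k with
    | zero => simp [coeffMap_one]
    | succ k ih =>
      rw [pow_succ' T, Module.End.mul_apply, ← ih]
      change _ = X * coeffMap A _
      rw [coeffMap_X_pow_mul, ← coeffMap_mul, ← mul_assoc, ← pow_succ', ← pow_succ']
  let E := PowerSeries.trunc d (PowerSeries.exp ℂ)
  let E' := PowerSeries.trunc d (PowerSeries.evalNegHom (PowerSeries.exp ℂ))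
  have hE : ∀ v, expAct A v = aeval T E v := fun v => by
    rw [expAct, aeval_def, PowerSeries.eval₂_trunc_eq_sum_range, LinearMap.sum_apply]
    refine Finset.sum_congr rfl fun k _ => ?_
    rw [hT, PowerSeries.coeff_exp, ← Algebra.smul_def]
    simp
  have hE' : ∀ v, expAct (-A) v = aeval T E' v := fun v => by
    rw [expAct, aeval_def, PowerSeries.eval₂_trunc_eq_sum_range, LinearMap.sum_apply]
    refine Finset.sum_congr rfl fun k _ => ?_
    have hneg : (-A) ^ k = (-1 : ℂ) ^ k • A ^ k := by rw [← neg_one_smul ℂ A, _root_.smul_pow]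
    rw [hneg, smul_smul, hT, PowerSeries.evalNegHom, PowerSeries.coeff_rescale,
      PowerSeries.coeff_exp, ← Algebra.smul_def]
    simp [mul_comm]
  obtain ⟨G, hG⟩ : (X ^ d : ℂ[X]) ∣ E' * E - 1 := by
    rw [X_pow_dvd_iff]
    intro n hn
    rw [coeff_sub, mul_comm, ← Polynomial.coeff_coe, Polynomial.coe_mul,
      ← PowerSeries.coeff_mul_eq_coeff_trunc_mul_trunc _ _ hn, PowerSeries.exp_mul_exp_neg_eq_one,
      PowerSeries.coeff_one, coeff_one, sub_self]
  have hTd : (T ^ d) u = 0 := by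
    rw [← one_smul ℂ ((T ^ d) u), ← hT, one_smul, h, mul_zero]
  rw [hE, hE', ← Module.End.mul_apply, ← map_mul, eq_add_of_sub_eq hG, map_add, mul_comm, map_mul,
    map_pow, aeval_X, map_one, LinearMap.add_apply, Module.End.mul_apply, hTd, map_zero, zero_add,
    Module.End.one_apply]

theorem apply_mem_invSpace {A B : Module.End ℂ R} (h : Commute B A) {r : R}
    (hr : r ∈ invSpace A) : B r ∈ invSpace A := by
  rw [invSpace, Submodule.mem_iInf] at hr ⊢
  intro n
  obtain ⟨s, rfl⟩ := hr n
  exact ⟨B s, by rw [← Module.End.mul_apply, ← Module.End.mul_apply, (h.pow_right n).eq]⟩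

variable [FiniteDimensional ℂ R]

theorem nilProj_mem (A : Module.End ℂ R) (r : R) : nilProj A r ∈ nilSpace A :=
  Submodule.coe_mem _

theorem invProj_mem (A : Module.End ℂ R) (r : R) : invProj A r ∈ invSpace A :=
  Submodule.coe_mem _

theorem partialInv_mem (A : Module.End ℂ R) (r : R) : partialInv A r ∈ invSpace A :=
  Submodule.coe_mem _

theorem nilProj_add_invProj (A : Module.End ℂ R) (r : R) : nilProj A r + invProj A r = r :=
  Submodule.projection_add_projection_eq_self (isCompl_nilSpace_invSpace A) r

theorem apply_partialInv (A : Module.End ℂ R) (r : R) : A (partialInv A r) = invProj A r :=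
  congrArg Subtype.val ((invEquiv A).apply_symm_apply
    ((invSpace A).projectionOnto (nilSpace A) (isCompl_nilSpace_invSpace A).symm r))

theorem eq_nilProj {A : Module.End ℂ R} {a b r : R} (ha : a ∈ nilSpace A) (hb : b ∈ invSpace A)
    (h : a + b = r) : a = nilProj A r ∧ b = invProj A r := by
  have h0 : a - nilProj A r = invProj A r - b := by
    rw [sub_eq_sub_iff_add_eq_add, h, add_comm, nilProj_add_invProj]
  have h1 : a - nilProj A r = 0 := by
    have := (isCompl_nilSpace_invSpace A).disjoint.le_bot
      ⟨sub_mem ha (nilProj_mem A r), h0 ▸ sub_mem (invProj_mem A r) hb⟩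
    simpa using this
  exact ⟨sub_eq_zero.1 h1, (sub_eq_zero.1 (h0 ▸ h1)).symm⟩

theorem eq_zero_of_mem_invSpace {A : Module.End ℂ R} {r : R} (hr : r ∈ invSpace A)
    (h : A r = 0) : r = 0 := by
  have h1 : (⟨r, hr⟩ : invSpace A) = 0 := by
    apply (invEquiv A).injective
    rw [map_zero]
    exact Subtype.ext h
  exact congrArg Subtype.val h1

theorem mem_nilSpace_iff {A : Module.End ℂ R} {r : R} :
    r ∈ nilSpace A ↔ (A ^ Module.finrank ℂ R) r = 0 := by
  rw [nilSpace, ← LinearMap.mem_ker]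
  have h : ∀ n, LinearMap.ker (A ^ n) ≤ LinearMap.ker (A ^ Module.finrank ℂ R) :=
    fun n => Module.End.ker_pow_le_ker_pow_finrank A n
  exact ⟨fun hr => iSup_le h hr, fun hr => Submodule.mem_iSup_of_mem _ hr⟩

theorem apply_mem_nilSpace {A B : Module.End ℂ R} (h : Commute B A) {r : R}
    (hr : r ∈ nilSpace A) : B r ∈ nilSpace A := by
  rw [mem_nilSpace_iff] at hr ⊢
  rw [← Module.End.mul_apply, ← (h.pow_right _).eq, Module.End.mul_apply, hr, map_zero]

theorem commute_nilProj_invProj {A B : Module.End ℂ R} (h : Commute B A) :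
    Commute B (nilProj A) ∧ Commute B (invProj A) := by
  have key := fun r => eq_nilProj (r := B r) (apply_mem_nilSpace h (nilProj_mem A r))
    (apply_mem_invSpace h (invProj_mem A r)) (by rw [← map_add, nilProj_add_invProj])
  exact ⟨LinearMap.ext fun r => (key r).1, LinearMap.ext fun r => (key r).2⟩

theorem commute_partialInv {A B : Module.End ℂ R} (h : Commute B A) :
    Commute B (partialInv A) := by
  refine LinearMap.ext fun r => sub_eq_zero.1 (eq_zero_of_mem_invSpace (A := A)
    (sub_mem (apply_mem_invSpace h (partialInv_mem A r)) (partialInv_mem A (B r))) ?_)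
  have h1 : A (B (partialInv A r)) = B (A (partialInv A r)) := LinearMap.congr_fun h.eq.symm _
  rw [map_sub, Module.End.mul_apply, Module.End.mul_apply, apply_partialInv, h1, apply_partialInv]
  exact sub_eq_zero.2 (LinearMap.congr_fun (commute_nilProj_invProj h).2.eq r)

theorem coeffMap_pow_finrank_nilProj (A : Module.End ℂ R) (u : R[X]) :
    coeffMap (A ^ Module.finrank ℂ R) (coeffMap (nilProj A) u) = 0 := by
  ext n
  rw [coeff_coeffMap, coeff_coeffMap, mem_nilSpace_iff.1 (nilProj_mem A _), coeff_zero]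

/-- `F_A u` solves the differential equation `y' + A y = u`. -/
theorem derivative_opF_add (A : Module.End ℂ R) (u : R[X]) :
    derivative (opF A u) + coeffMap A (opF A u) = u := by
  set w := coeffMap (nilProj A) u with hw
  set w' := coeffMap (invProj A) u with hw'
  have hsum : w + w' = u := by
    ext n; rw [coeff_add, coeff_coeffMap, coeff_coeffMap, nilProj_add_invProj]
  have hw0 := coeffMap_pow_finrank_nilProj A u
  have h1 : derivative (expAct (-A) (primitive (expAct A w))) +
      coeffMap A (expAct (-A) (primitive (expAct A w))) = w := by
    rw [derivative_expAct, derivative_primitive, expAct_neg_expAct hw0, coeffMap_neg_left]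
    · abel
    · have hneg : (-A) ^ Module.finrank ℂ R =
          (-1 : ℂ) ^ Module.finrank ℂ R • A ^ Module.finrank ℂ R := by
        rw [← neg_one_smul ℂ A, _root_.smul_pow]
      rw [hneg, coeffMap_smul_left, coeffMap_primitive,
        coeffMap_expAct ((Commute.refl A).pow_left _), hw0]
      have h0 : expAct A (0 : R[X]) = 0 := by simp [expAct, coeffMap_zero_right]
      have h0' : primitive (0 : R[X]) = 0 := by simp [primitive]
      rw [h0, h0', smul_zero]
  -- the sum over `k` telescopes, and the remainder vanishes because `u` is a polynomial
  have h2 : ∀ n : ℕ, derivative (∑ k ∈ Finset.range n,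
        coeffMap ((-1 : ℂ) ^ k • partialInv A ^ (k + 1)) (derivative^[k] w')) +
      coeffMap A (∑ k ∈ Finset.range n,
        coeffMap ((-1 : ℂ) ^ k • partialInv A ^ (k + 1)) (derivative^[k] w')) =
      w' - coeffMap ((-1 : ℂ) ^ n • partialInv A ^ n) (derivative^[n] w') := fun n => by
    induction n with
    | zero => simp [coeffMap_zero_right, coeffMap_one]
    | succ n ih =>
      have h3 : coeffMap (A * partialInv A ^ (n + 1)) (derivative^[n] w') =
          coeffMap (partialInv A ^ n) (derivative^[n] w') := by
        have hd : derivative^[n] w' = coeffMap (invProj A) (derivative^[n] u) := by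
          rw [hw']
          clear ih
          induction n with
          | zero => rfl
          | succ n ih => rw [Function.iterate_succ_apply', ih, derivative_coeffMap,
              Function.iterate_succ_apply']
        rw [hd]
        ext i
        rw [coeff_coeffMap, coeff_coeffMap, coeff_coeffMap, pow_succ', Module.End.mul_apply,
          Module.End.mul_apply, apply_partialInv, ← coeff_coeffMap]
        refine ((eq_nilProj (zero_mem _) ?_ (zero_add _)).2).symm
        cases n with
        | zero => rw [coeff_coeffMap]; exact invProj_mem A _
        | succ n => rw [pow_succ', Module.End.mul_apply]; exact partialInv_mem A _
      rw [Finset.sum_range_succ, derivative_add, coeffMap_add_right, add_add_add_comm, ih,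
        ← coeffMap_mul, derivative_coeffMap, mul_smul_comm, coeffMap_smul_left (_ ^ n),
        coeffMap_smul_left, coeffMap_smul_left, h3, ← Function.iterate_succ_apply' derivative,
        coeffMap_smul_left, pow_succ (-1 : ℂ)]
      simp only [mul_neg, mul_one, neg_smul]
      abel
  rw [opF, derivative_add, coeffMap_add_right, add_add_add_comm, h1, h2,
    iterate_derivative_eq_zero, coeffMap_zero_right, sub_zero, hsum]
  refine Nat.lt_succ_of_le (natDegree_le_iff_coeff_eq_zero.2 fun N hN => ?_)
  rw [coeff_coeffMap, coeff_eq_zero_of_natDegree_lt hN, map_zero]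

theorem opF_mul_C {A : Module.End ℂ R} (hA : ∀ s r : R, A (s * r) = A s * r) (u : R[X]) (r : R) :
    opF A (u * C r) = opF A u * C r := by
  have hc : Commute (LinearMap.mulRight ℂ r) A := LinearMap.ext fun s => (hA s r).symm
  have hn : ∀ s t : R, nilProj A (s * t) = nilProj A s * t := fun s t =>
    (LinearMap.congr_fun (commute_nilProj_invProj
      (B := LinearMap.mulRight ℂ t) (LinearMap.ext fun s => (hA s t).symm)).1.eq s).symm
  have hi : ∀ s t : R, invProj A (s * t) = invProj A s * t := fun s t =>
    (LinearMap.congr_fun (commute_nilProj_invProj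
      (B := LinearMap.mulRight ℂ t) (LinearMap.ext fun s => (hA s t).symm)).2.eq s).symm
  have hj : ∀ (k : ℕ) (s t : R), (partialInv A ^ k) (s * t) = (partialInv A ^ k) s * t :=
    fun k s t => (LinearMap.congr_fun ((commute_partialInv
      (B := LinearMap.mulRight ℂ t) (LinearMap.ext fun s => (hA s t).symm)).pow_right k).eq s).symm
  have hd : ∀ (k : ℕ) (v : R[X]), derivative^[k] (v * C r) = derivative^[k] v * C r := fun k => by
    induction k with
    | zero => intro v; rfl
    | succ k ih => intro v; rw [Function.iterate_succ_apply, derivative_mul, derivative_C,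
        mul_zero, add_zero, ih, Function.iterate_succ_apply]
  have hneg : ∀ s r : R, (-A) (s * r) = (-A) s * r := fun s r => by simp [hA]
  rw [opF, opF, add_mul, coeffMap_mul_C hn, expAct_mul_C hA, primitive_mul_C, expAct_mul_C hneg,
    coeffMap_mul_C hi]
  congr 1
  rw [Finset.sum_mul]
  have hle : (u * C r).natDegree ≤ u.natDegree := natDegree_mul_C_le u r
  have hz : ∀ k, k ∉ Finset.range ((u * C r).natDegree + 1) →
      coeffMap ((-1 : ℂ) ^ k • partialInv A ^ (k + 1))
        (derivative^[k] (coeffMap (invProj A) u * C r)) = 0 := fun k hk => by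
    rw [Finset.mem_range, not_lt] at hk
    rw [← coeffMap_mul_C hi, iterate_derivative_eq_zero, coeffMap_zero_right]
    refine lt_of_le_of_lt (natDegree_le_iff_coeff_eq_zero.2 fun N hN => ?_) hk
    rw [coeff_coeffMap, coeff_eq_zero_of_natDegree_lt hN, map_zero]
  rw [Finset.sum_subset (Finset.range_mono (Nat.succ_le_succ hle)) fun k _ hk => hz k hk]
  refine Finset.sum_congr rfl fun k _ => ?_
  rw [hd, coeffMap_mul_C fun s t => ?_]
  rw [LinearMap.smul_apply, LinearMap.smul_apply, hj, smul_mul_assoc]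

end OpF

/-! ### The decorated Grassmannian and its order -/

section Darboux

variable {R : Type*} [Ring R] [Algebra ℂ R] {m : ℕ} {e : Fin m → R}

theorem IsMonicRatDiffOp.mul [Nontrivial R] {P S : Module.End ℂ (MerR R)}
    (hP : IsMonicRatDiffOp P) (hS : IsMonicRatDiffOp S) : IsMonicRatDiffOp (P * S) := by
  obtain ⟨p, hpm, hp, rfl⟩ := hP
  obtain ⟨q, hqm, hq, rfl⟩ := hS
  obtain ⟨s, hs, hsm, -, h⟩ :=
    exists_monic_diffOp_mul (A := ratR R) (fun a => dX_mem_ratR) hp hpm hq hqm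
  exact ⟨s, hsm, hs, h⟩

theorem isMonicRatDiffOp_constOp {L : R[X]} (hL : L.Monic) : IsMonicRatDiffOp (constOp L) :=
  ⟨_, hL.map _, constOp_mem_ratR L, rfl⟩

theorem IsDarboux.mul_constOp [Nontrivial R] {P : Module.End ℂ (MerR R)} (hP : IsDarboux P)
    {L : R[X]} (hL : L.Monic) : IsDarboux (P * constOp L) := by
  obtain ⟨hP, Q, hQ, M, hM, h⟩ := hP
  exact ⟨hP.mul (isMonicRatDiffOp_constOp hL), Q, hQ, M * L, hM.mul hL, by
    rw [← mul_assoc, h, constOp_mul]⟩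

theorem monic_list_prod_X_sub_C {R : Type*} [Ring R] {ι : Type*} (c : ι → R) (γs : List ι) :
    ((γs.map fun γ => X - C (c γ)).prod).Monic := by
  induction γs with
  | nil => exact monic_one
  | cons γ γs ih => rw [List.map_cons, List.prod_cons]; exact (monic_X_sub_C _).mul ih

theorem natDegree_list_prod_X_sub_C {R : Type*} [Ring R] [Nontrivial R] {ι : Type*} (c : ι → R)
    (γs : List ι) :
    ((γs.map fun γ => X - C (c γ)).prod).natDegree = γs.length := by
  induction γs with
  | nil => exact natDegree_one
  | cons γ γs ih =>
    rw [List.map_cons, List.prod_cons,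
      (monic_X_sub_C _).natDegree_mul (monic_list_prod_X_sub_C _ _), natDegree_X_sub_C, ih,
      List.length_cons, add_comm]

theorem IsDarboux.mul_prod_linOp [Nontrivial R] {P : Module.End ℂ (MerR R)} (hP : IsDarboux P)
    (γs : List (Fin m → ℂ)) : IsDarboux (P * (γs.map (linOp e)).prod) := by
  rw [prod_linOp_eq_constOp]
  exact hP.mul_constOp (monic_list_prod_X_sub_C _ _)

theorem IsDarboux.eq_of_wave_eq {P S : Module.End ℂ (MerR R)} (hP : IsDarboux P)
    (hS : IsDarboux S) {Z : Set ℂ} (hZ : Z.Infinite) (h : ∀ z ∈ Z, wave P z = wave S z) :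
    P = S := by
  obtain ⟨⟨p, -, -, rfl⟩, -⟩ := hP
  obtain ⟨⟨q, -, -, rfl⟩, -⟩ := hS
  rw [diffOp_symbol_eq_of_wave_eq hZ h]

theorem DecGr.IsOp.unique {Φ : DecGr R} {P S : Module.End ℂ (MerR R)} (hP : Φ.IsOp P)
    (hS : Φ.IsOp S) : P = S :=
  hP.1.eq_of_wave_eq hS.1 Set.infinite_univ fun z _ => by rw [← hP.2, hS.2]

theorem DecGr.exists_isOp (Φ : DecGr R) : ∃ P, Φ.IsOp P := Φ.2

/-- The point `P exp(xz)`. -/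
noncomputable def DecGr.ofOp {P : Module.End ℂ (MerR R)} (hP : IsDarboux P) : DecGr R :=
  ⟨wave P, P, hP, rfl⟩

theorem DecGr.isOp_ofOp {P : Module.End ℂ (MerR R)} (hP : IsDarboux P) :
    (DecGr.ofOp hP).IsOp P := ⟨hP, rfl⟩

theorem DecGr.IsOp.eq {Φ Ψ : DecGr R} {P : Module.End ℂ (MerR R)} (hΦ : Φ.IsOp P)
    (hΨ : Ψ.IsOp P) : Φ = Ψ := Subtype.ext (hΦ.2.trans hΨ.2.symm)

/-- The order of a monic operator is well defined, and it increases under multiplication by first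
order factors. -/
theorem eq_nil_of_mul_prod_linOp_eq [Nontrivial R] [FiniteDimensional ℂ R]
    {P : Module.End ℂ (MerR R)} (hP : IsDarboux P)
    {γs : List (Fin m → ℂ)} (h : P = P * (γs.map (linOp e)).prod) : γs = [] := by
  have := nontrivial_merR (R := R)
  obtain ⟨⟨p, hpm, hp, rfl⟩, -⟩ := hP
  rw [prod_linOp_eq_constOp, constOp] at h
  obtain ⟨s, -, -, hdeg, hs⟩ := exists_monic_diffOp_mul (A := ratR R) (fun a => dX_mem_ratR) hp hpm
    (constOp_mem_ratR (γs.map fun γ => X - C (diagElt e γ)).prod)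
    ((monic_list_prod_X_sub_C _ _).map _)
  rw [hs] at h
  rw [← diffOp_injective h, (monic_list_prod_X_sub_C _ _).natDegree_map,
    natDegree_list_prod_X_sub_C] at hdeg
  exact List.length_eq_zero_iff.1 (by omega)

theorem isStrictOrder_prec [Nontrivial R] [FiniteDimensional ℂ R] (e : Fin m → R) :
    IsStrictOrder (DecGr R) (Prec e) where
  irrefl := by
    rintro Φ ⟨γs, hne, P, S, hP, hS, h⟩
    rw [← hP.unique hS] at h
    exact hne (eq_nil_of_mul_prod_linOp_eq hP.1 h)
  trans := by
    rintro Φ Ψ Θ ⟨γs, hne, P, S, hP, hS, rfl⟩ ⟨δs, -, P', S', hP', hS', rfl⟩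
    refine ⟨γs ++ δs, by simp [hne], P, _, hP, hS', ?_⟩
    rw [← hS.unique hP', List.map_append, List.prod_append, mul_assoc]

/-! ### Immediate successors -/

theorem coeffMap_mulLeft (c : R) (u : R[X]) : coeffMap (LinearMap.mulLeft ℂ c) u = C c * u := by
  ext n; rw [coeff_coeffMap, coeff_C_mul]; rfl

theorem linOp_quasi (he : CompleteOrthogonalIdempotents e) (γ : Fin m → ℂ) (u : R[X]) (α : ℂ) :
    linOp e γ (quasi u α) = quasi (derivative u + coeffMap (opA e γ α) u) α := by
  have h : diagElt e (fun k => α - γ k) = α • (1 : R) - diagElt e γ := by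
    rw [← Algebra.algebraMap_eq_smul_one, ← (diagHom he).commutes α, ← diagHom_apply he γ,
      ← map_sub]
    rfl
  rw [linOp_apply, dX_quasi, ← quasi_C_mul, ← quasi_sub, opA, coeffMap_mulLeft, h, C_sub, sub_mul,
    add_sub_assoc, ← smul_C, smul_mul_assoc, C_1, one_mul]

theorem linOp_mul_constR (γ : Fin m → ℂ) (v : MerR R) (r : R) :
    linOp e γ (v * constR r) = linOp e γ v * constR r := by
  rw [linOp_apply, linOp_apply, dX_mul_constR, sub_mul, mul_assoc]

theorem linOp_quasi_idem (he : CompleteOrthogonalIdempotents e) (γ : Fin m → ℂ) (j : Fin m) :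
    linOp e γ (quasi (C (e j)) (γ j)) = 0 := by
  rw [linOp_quasi he, opA, coeffMap_mulLeft, ← C_mul, diagElt_mul_idem he, sub_self, zero_smul,
    C_0, derivative_C, add_zero, quasi_zero]

variable [FiniteDimensional ℂ R]

/-- The operator `F_A` is a right inverse of `∂ₓ - ∑ γₖeₖ` on quasipolynomials. -/
theorem linOp_quasi_opF (he : CompleteOrthogonalIdempotents e) (γ : Fin m → ℂ) (u : R[X]) (α : ℂ) :
    linOp e γ (quasi (opF (opA e γ α) u) α) = quasi u α := by
  rw [linOp_quasi he, derivative_opF_add]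

theorem exists_of_linOp_eq_zero (he : CompleteOrthogonalIdempotents e) {γ : Fin m → ℂ} {v : MerR R}
    (h : linOp e γ v = 0) : ∃ r : Fin m → R, v = ∑ j, quasi (C (e j)) (γ j) * constR (r j) := by
  have hj : ∀ j, ∃ r, constR (e j) * v = quasi (C r) (γ j) := fun j =>
    quasi_C_of_dX_sub_eq_zero (by
      rw [linOp_apply, sub_eq_zero] at h
      rw [LinearMap.sub_apply, dX_constR_mul, h, ← mul_assoc, ← constR_mul, idem_mul_diagElt he,
        constR_smul, smul_mul_assoc, Module.algebraMap_end_apply, sub_self])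
  choose r hr using hj
  refine ⟨r, ?_⟩
  rw [← one_mul v, ← constR_one, ← he.complete, constR_sum, Finset.sum_mul]
  refine Finset.sum_congr rfl fun j _ => ?_
  rw [← quasi_mul_C, quasi_C_mul, ← hr, ← mul_assoc, ← constR_mul, (he.idem j).eq]

omit [FiniteDimensional ℂ R] in
theorem mem_iSup_span_iff {ι : Type*} [Fintype ι] {f : ι → MerR R} {w : MerR R} :
    w ∈ ⨆ i, Submodule.span Rᵐᵒᵖ {f i} ↔ ∃ r : ι → R, ∑ i, f i * constR (r i) = w := by
  rw [← Submodule.span_range_eq_iSup, Submodule.mem_span_range_iff_exists_fun]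
  constructor
  · rintro ⟨c, rfl⟩
    exact ⟨fun i => (c i).unop, by simp only [← op_smul_eq, MulOpposite.op_unop]⟩
  · rintro ⟨r, rfl⟩
    exact ⟨fun i => MulOpposite.op (r i), by simp only [op_smul_eq]⟩

omit [FiniteDimensional ℂ R] in
theorem iSupIndep_span_iff {ι : Type*} [Fintype ι] {f : ι → MerR R} :
    iSupIndep (fun i => Submodule.span Rᵐᵒᵖ {f i}) ↔
      ∀ r : ι → R, ∑ i, f i * constR (r i) = 0 → ∀ i, f i * constR (r i) = 0 := by
  have hmem : ∀ (i : ι) (r : R), f i * constR r ∈ Submodule.span Rᵐᵒᵖ {f i} := fun i r => by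
    rw [← op_smul_eq]
    exact Submodule.smul_mem _ _ (Submodule.mem_span_singleton_self _)
  rw [iSupIndep_iff_finsetSum_eq_zero_imp_eq_zero]
  constructor
  · intro h r hr i
    exact h Finset.univ _ (fun i _ => hmem i (r i)) hr i (Finset.mem_univ i)
  · classical
    intro h s v hv h0 i hi
    have hr : ∀ i, ∃ r, f i * constR r = if i ∈ s then v i else 0 := fun i => by
      split_ifs with his
      · obtain ⟨a, ha⟩ := Submodule.mem_span_singleton.1 (hv i his)
        exact ⟨a.unop, by rw [← op_smul_eq, MulOpposite.op_unop, ha]⟩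
      · exact ⟨0, by rw [constR_zero, mul_zero]⟩
    choose r hr using hr
    have := h r (by simpa only [hr, Finset.sum_ite_mem, Finset.univ_inter] using h0) i
    rwa [hr, if_pos hi] at this

/-- The generators of the summands of `V_γ`. -/
noncomputable def succGen (e : Fin m → R) {n : ℕ} (p : Fin n → R[X]) (α : Fin n → ℂ)
    (i : Fin n → Fin m) (γ : Fin m → ℂ) : Fin m ⊕ Fin n → MerR R :=
  Sum.elim (fun j => quasi (C (e j)) (γ j))
    fun k => quasi (opF (opA e γ (α k)) (p k * C (e (i k)))) (α k)

theorem succSummand_eq {n : ℕ} (p : Fin n → R[X]) (α : Fin n → ℂ) (i : Fin n → Fin m)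
    (γ : Fin m → ℂ) :
    succSummand e p α i γ = fun k => Submodule.span Rᵐᵒᵖ {succGen e p α i γ k} := by
  funext k; cases k <;> rfl

theorem linOp_sum_succGen (he : CompleteOrthogonalIdempotents e) {n : ℕ} (p : Fin n → R[X])
    (α : Fin n → ℂ) (i : Fin n → Fin m) (γ : Fin m → ℂ) (r : Fin m ⊕ Fin n → R) :
    linOp e γ (∑ k, succGen e p α i γ k * constR (r k)) =
      ∑ k, quasi (p k * C (e (i k))) (α k) * constR (r (Sum.inr k)) := by
  rw [map_sum, Fintype.sum_sum_type, Finset.sum_eq_zero, zero_add]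
  · refine Finset.sum_congr rfl fun k _ => ?_
    rw [linOp_mul_constR]
    congr 1
    exact linOp_quasi_opF he γ _ _
  · intro j _
    rw [linOp_mul_constR]
    exact (congrArg (· * _) (linOp_quasi_idem he γ j)).trans (zero_mul _)

/-- A relation between the generators of `V_γ` is mapped by `∂ₓ - ∑ γₖeₖ` to one between those of
`V`. -/
theorem iSupIndep_succSummand (he : CompleteOrthogonalIdempotents e) {n : ℕ} {p : Fin n → R[X]}
    {α : Fin n → ℂ} {i : Fin n → Fin m} (γ : Fin m → ℂ) (h : iSupIndep (summand e p α i)) :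
    iSupIndep (succSummand e p α i γ) := by
  rw [succSummand_eq, iSupIndep_span_iff]
  intro r hr
  have h1 := linOp_sum_succGen he p α i γ r
  rw [hr, map_zero] at h1
  have h2 := iSupIndep_span_iff.1 h (fun k => r (Sum.inr k)) h1.symm
  have hA : ∀ (α : ℂ) (s r : R), opA e γ α (s * r) = opA e γ α s * r := fun α s r =>
    (mul_assoc _ _ _).symm
  -- `pₖ e_{iₖ} r = 0` implies `F_A(pₖ e_{iₖ}) r = 0`, as `F_A` is right `R`-linear
  have h3 : ∀ k, succGen e p α i γ (Sum.inr k) * constR (r (Sum.inr k)) = 0 := fun k => by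
    have h4 := h2 k
    rw [← quasi_mul_C] at h4
    have h5 := quasi_injective h4
    change quasi _ _ * _ = 0
    rw [← quasi_mul_C, ← opF_mul_C (hA _), h5]
    have : opF (opA e γ (α k)) 0 = 0 := by
      have := opF_mul_C (hA (α k)) 0 0
      simpa using this
    rw [this, quasi_zero]
  rw [Fintype.sum_sum_type, Finset.sum_eq_zero fun k _ => h3 k, add_zero] at hr
  rintro (j | k)
  · have h6 := congrArg (constR (e j) * ·) hr
    simp only [Finset.mul_sum, mul_zero] at h6
    rw [Finset.sum_eq_single_of_mem j (Finset.mem_univ j)] at h6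
    · change quasi _ _ * _ = 0
      change constR (e j) * (quasi _ _ * _) = 0 at h6
      rwa [← mul_assoc, ← quasi_C_mul, ← C_mul, (he.idem j).eq] at h6
    · intro l _ hl
      change constR (e j) * (quasi _ _ * _) = 0
      rw [← mul_assoc, ← quasi_C_mul, ← C_mul, he.ortho hl.symm, C_0, quasi_zero, zero_mul]
  · exact h3 k

/-- `V_γ` is the preimage of `V` under `∂ₓ - ∑ γₖeₖ`. -/
theorem mem_iSup_succSummand_iff (he : CompleteOrthogonalIdempotents e) {n : ℕ} {p : Fin n → R[X]}
    {α : Fin n → ℂ} {i : Fin n → Fin m} (γ : Fin m → ℂ) (v : MerR R) :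
    v ∈ ⨆ k, succSummand e p α i γ k ↔ linOp e γ v ∈ ⨆ k, summand e p α i k := by
  have hs : (⨆ k, summand e p α i k) =
    ⨆ k, Submodule.span Rᵐᵒᵖ {quasi (p k * C (e (i k))) (α k)} := rfl
  rw [succSummand_eq, hs, mem_iSup_span_iff, mem_iSup_span_iff]
  constructor
  · rintro ⟨r, rfl⟩
    exact ⟨_, (linOp_sum_succGen he p α i γ r).symm⟩
  · rintro ⟨r, hr⟩
    have h0 := linOp_sum_succGen he p α i γ (Sum.elim 0 r)
    obtain ⟨t, ht⟩ := exists_of_linOp_eq_zero he (γ := γ)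
      (v := v - ∑ k, succGen e p α i γ k * constR (Sum.elim 0 r k)) (by
        rw [map_sub, h0, ← hr, sub_eq_zero]; rfl)
    refine ⟨Sum.elim t r, ?_⟩
    rw [sub_eq_iff_eq_add] at ht
    rw [ht, Fintype.sum_sum_type, Fintype.sum_sum_type]
    simp [constR_zero, succGen]

omit [FiniteDimensional ℂ R] in
theorem linOp_sub_linOp (γ δ : Fin m → ℂ) :
    linOp e γ - linOp e δ = diffOp (C (constR (diagElt e δ - diagElt e γ))) := by
  rw [← monomial_zero_left, diffOp_monomial, pow_zero, mul_one]
  refine LinearMap.ext fun v => ?_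
  rw [LinearMap.sub_apply, linOp_apply, linOp_apply, LinearMap.mulLeft_apply, constR_sub, sub_mul]
  abel

/-- The immediate successors of a point, the successor for `γ` being `P (∂ₓ - ∑ γₖeₖ) exp(xz)`, and
their kernels. -/
theorem immediate_successors [Nontrivial R] (he : CompleteOrthogonalIdempotents e)
    (hne : ∀ k, e k ≠ 0) (Φ : DecGr R) : ∃ s : (Fin m → ℂ) → DecGr R,
      Function.Injective s ∧ Set.range s = {Ψ | ImmSucc e Φ Ψ} ∧
      ∀ γ : Fin m → ℂ, SuccVia e [γ] Φ (s γ) ∧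
        ∀ (n : ℕ) (p : Fin n → R[X]) (α : Fin n → ℂ) (i : Fin n → Fin m),
          iSupIndep (summand e p α i) →
          Φ.CorrespondsTo (⨆ k, summand e p α i k) →
          iSupIndep (succSummand e p α i γ) ∧
          (s γ).CorrespondsTo (⨆ k, succSummand e p α i γ k) := by
  obtain ⟨P, hP⟩ := Φ.exists_isOp
  have hD : ∀ γ : Fin m → ℂ, IsDarboux (P * linOp e γ) := fun γ => by
    simpa using hP.1.mul_prod_linOp (e := e) [γ]
  have hs : ∀ γ, SuccVia e [γ] Φ (DecGr.ofOp (hD γ)) := fun γ =>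
    ⟨P, _, hP, DecGr.isOp_ofOp (hD γ), by simp⟩
  refine ⟨fun γ => DecGr.ofOp (hD γ), fun γ δ h => ?_, ?_, fun γ => ⟨hs γ, ?_⟩⟩
  · -- `P` is monic, hence not a left divisor of zero
    have h1 : P * linOp e γ = P * linOp e δ :=
      (hD γ).eq_of_wave_eq (hD δ) Set.infinite_univ fun z _ => congrFun (congrArg Subtype.val h) z
    rw [← sub_eq_zero, ← mul_sub, linOp_sub_linOp] at h1
    obtain ⟨⟨p, hpm, hp, rfl⟩, -⟩ := hP.1
    obtain ⟨t, -, -, ht, h2⟩ := exists_diffOp_mul (A := ratR R) (fun a => dX_mem_ratR) hp le_rfl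
      (q := C (constR (diagElt e δ - diagElt e γ))) (d := 0)
      (fun k => by rw [coeff_C]; split_ifs; exacts [constR_mem_ratR _, zero_mem _]) (by simp)
    rw [h1, ← diffOp_zero] at h2
    rw [← diffOp_injective h2, coeff_zero, hpm.coeff_natDegree, one_mul, coeff_C_zero] at ht
    exact (diagElt_injective he hne (sub_eq_zero.1 (constR_injective ht.symm))).symm
  · ext Ψ
    constructor
    · rintro ⟨γ, rfl⟩; exact ⟨γ, hs γ⟩
    · rintro ⟨γ, P', S, hP', hS, rfl⟩
      refine ⟨γ, ?_⟩
      rw [← hP.unique hP'] at hS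
      exact DecGr.IsOp.eq (DecGr.isOp_ofOp (hD γ)) (by simpa using hS)
  · rintro n p α i hind ⟨P', hP', hV⟩
    rw [← hP.unique hP'] at hV
    refine ⟨iSupIndep_succSummand he γ hind, _, DecGr.isOp_ofOp (hD γ), fun f => ?_⟩
    rw [mem_iSup_succSummand_iff he, hV, Module.End.mul_apply]

end Darboux

/-! ### Primitive idempotents have local corners -/

section Local

variable {R : Type*} [Ring R] [Algebra ℂ R] [FiniteDimensional ℂ R] {e : R}

/-- Fitting's lemma in the corner of a primitive idempotent: every element is nilpotent or
invertible. -/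
theorem IsPrimitiveIdem.pow_eq_zero_or_exists_inv (he : IsPrimitiveIdem e) {a : R}
    (h1 : e * a = a) (h2 : a * e = a) :
    (∃ n, a ^ n = 0) ∨ ∃ x, e * x = x ∧ x * e = x ∧ a * x = e ∧ x * a = e := by
  obtain ⟨q, hq, hqa⟩ := Algebra.IsAlgebraic.isAlgebraic (R := ℂ) a
  obtain ⟨g, hg, hXg⟩ := exists_eq_pow_rootMultiplicity_mul_and_not_dvd q hq 0
  set k := rootMultiplicity 0 q
  rw [C_0, sub_zero] at hg hXg
  have hcop : IsCoprime (X ^ (k + 1)) g :=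
    ((irreducible_X (R := ℂ)).coprime_iff_not_dvd.2 hXg).pow_left
  obtain ⟨u, v, huv⟩ := hcop
  have hkill : aeval a (X ^ (k + 1) * g) = 0 := by
    rw [pow_succ', mul_assoc, ← hg, map_mul, hqa, mul_zero]
  -- `f` is the idempotent of `ℂ[a]` on the part where `a` is invertible
  set f := aeval a (u * X ^ (k + 1)) with hf
  have hf1 : f + aeval a (v * g) = 1 := by rw [hf, ← map_add, huv, map_one]
  have hfi : f * f = f := by
    have h0 : f * aeval a (v * g) = 0 := by
      rw [hf, ← map_mul, show u * X ^ (k + 1) * (v * g) = u * v * (X ^ (k + 1) * g) by ring,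
        map_mul, hkill, mul_zero]
    rw [← eq_sub_iff_add_eq'] at hf1
    rw [hf1, mul_sub, mul_one] at h0
    exact (sub_eq_zero.1 h0).symm
  have hfa : f = aeval a (u * X ^ k) * a := by
    rw [hf, pow_succ, ← mul_assoc, map_mul, aeval_X]
  have hfa' : f = a * aeval a (u * X ^ k) := by
    rw [hf, pow_succ, ← mul_assoc, mul_comm _ (X : ℂ[X]), map_mul, aeval_X]
  have hfe : f * e = f := by rw [hfa, mul_assoc, h2]
  have hef : e * f = f := by rw [hfa', ← mul_assoc, h1]
  have hee : e * e = e := he.1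
  rcases he.2.2 f (e - f) hfi
    (by rw [IsIdempotentElem, sub_mul, mul_sub, mul_sub, hee, hef, hfe, hfi, sub_self, sub_zero])
    (by rw [mul_sub, hfe, hfi, sub_self]) (by rw [sub_mul, hef, hfi, sub_self])
    (by rw [add_sub_cancel]) with h0 | h0
  · left
    refine ⟨k + 1, ?_⟩
    have : a ^ (k + 1) = aeval a (X ^ (k + 1) : ℂ[X]) * (f + aeval a (v * g)) := by
      rw [hf1, mul_one, map_pow, aeval_X]
    rw [this, h0, zero_add, ← map_mul (aeval a),
      show X ^ (k + 1) * (v * g) = v * (X ^ (k + 1) * g) by ring, map_mul, hkill, mul_zero]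
  · right
    have hfe' : f = e := (sub_eq_zero.1 h0).symm
    refine ⟨e * aeval a (u * X ^ k) * e, ?_, ?_, ?_, ?_⟩
    · rw [← mul_assoc, ← mul_assoc, hee]
    · rw [mul_assoc, hee]
    · rw [← mul_assoc, ← mul_assoc, h2, ← hfa', hfe, hfe']
    · rw [mul_assoc, h1, mul_assoc, ← hfa, hef, hfe']

theorem IsPrimitiveIdem.exists_inv_of_right_inv (he : IsPrimitiveIdem e) {a x : R}
    (h1 : e * a = a) (h2 : a * e = a) (hx : e * x = x) (hax : a * x = e) :
    ∃ x, e * x = x ∧ x * e = x ∧ a * x = e ∧ x * a = e := by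
  refine (he.pow_eq_zero_or_exists_inv h1 h2).resolve_left ?_
  rintro ⟨n, hn⟩
  -- a nilpotent `a` has no right inverse
  have h : ∀ n, a ^ n * (x ^ n * e) = e := fun n => by
    induction n with
    | zero => rw [pow_zero, pow_zero, one_mul, one_mul]
    | succ n ih =>
      rw [pow_succ, pow_succ', mul_assoc, mul_assoc, ← mul_assoc a, hax]
      cases n with
      | zero => rw [pow_zero, pow_zero, one_mul, one_mul, he.1.eq]
      | succ n => rw [pow_succ' x, mul_assoc x, ← mul_assoc e, hx, ← mul_assoc x, ← pow_succ', ih]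
  exact he.2.1 (by rw [← h n, hn, zero_mul])

/-- The corner of a primitive idempotent is a local ring. -/
theorem IsPrimitiveIdem.exists_inv_of_add (he : IsPrimitiveIdem e) {a c b : R}
    (ha1 : e * a = a) (ha2 : a * e = a) (hc1 : e * c = c) (hc2 : c * e = c)
    (hb1 : e * b = b) (hb2 : b * e = b) (h : (a + c) * b = e) :
    (∃ x, e * x = x ∧ x * e = x ∧ a * x = e ∧ x * a = e) ∨
      ∃ x, e * x = x ∧ x * e = x ∧ c * x = e ∧ x * c = e := by
  rcases he.pow_eq_zero_or_exists_inv (a := a * b) (by rw [← mul_assoc, ha1])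
    (by rw [mul_assoc, hb2]) with ⟨n, hn⟩ | ⟨x, hx, -, hx', -⟩
  · right
    obtain ⟨v, hv⟩ := (IsNilpotent.isUnit_one_sub ⟨n, hn⟩ : IsUnit (1 - a * b)).exists_right_inv
    refine he.exists_inv_of_right_inv hc1 hc2 (x := b * v * e) ?_ ?_
    · rw [← mul_assoc, ← mul_assoc, hb1]
    · have h3 : c * b = e * (1 - a * b) := by
        rw [mul_sub, mul_one, ← mul_assoc, ha1, ← h, add_mul, add_sub_cancel_left]
      rw [← mul_assoc, ← mul_assoc, h3, mul_assoc e, hv, mul_one, he.1.eq]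
  · left
    exact he.exists_inv_of_right_inv ha1 ha2 (x := b * x) (by rw [← mul_assoc, hb1])
      (by rw [← mul_assoc, hx'])

theorem IsPrimitiveIdem.exists_inv_of_sum (he : IsPrimitiveIdem e) {ι : Type*} {s : Finset ι}
    {a : ι → R} {b : R} (h1 : ∀ i ∈ s, e * a i = a i) (h2 : ∀ i ∈ s, a i * e = a i)
    (hb1 : e * b = b) (hb2 : b * e = b) (h : (∑ i ∈ s, a i) * b = e) :
    ∃ i ∈ s, ∃ x, e * x = x ∧ x * e = x ∧ a i * x = e ∧ x * a i = e := by
  classical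
  induction s using Finset.induction_on generalizing b with
  | empty => exact absurd (by simpa using h.symm) he.2.1
  | insert i s hi ih =>
    rw [Finset.sum_insert hi] at h
    rcases he.exists_inv_of_add (h1 i (Finset.mem_insert_self i s))
      (h2 i (Finset.mem_insert_self i s))
      (by
        rw [Finset.mul_sum]
        exact Finset.sum_congr rfl fun j hj => h1 j (Finset.mem_insert_of_mem hj))
      (by
        rw [Finset.sum_mul]
        exact Finset.sum_congr rfl fun j hj => h2 j (Finset.mem_insert_of_mem hj))
      hb1 hb2 h with hx | ⟨x, hx1, hx2, hx3, -⟩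
    · exact ⟨i, Finset.mem_insert_self i s, hx⟩
    · obtain ⟨j, hj, hx⟩ := ih (fun j hj => h1 j (Finset.mem_insert_of_mem hj))
        (fun j hj => h2 j (Finset.mem_insert_of_mem hj)) hx1 hx2 hx3
      exact ⟨j, Finset.mem_insert_of_mem hj, hx⟩

end Local

/-! ### Frames and the exchange lemma -/

section Frame

variable {R : Type*} [Ring R] [Algebra ℂ R]

/-- A frame of a right `R`-module `V` of functions: a family `g` with `V = ⨁ₜ gₜ R`, the right
module `gₜ R` being isomorphic to `εₜ R` by `gₜ ↦ εₜ`. The coordinates `cₜ` of an element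
`∑ gₜ cₜ` are determined up to the right annihilator of `εₜ`. -/
structure IsFrame {ι : Type*} [Fintype ι] (ε : ι → R) (V : Submodule ℂ (MerR R))
    (g : ι → MerR R) : Prop where
  mem : ∀ t, g t ∈ V
  mul_idem : ∀ t, g t * constR (ε t) = g t
  span : ∀ v ∈ V, ∃ c : ι → R, v = ∑ t, g t * constR (c t)
  indep : ∀ c : ι → R, ∑ t, g t * constR (c t) = 0 → ∀ t, ε t * c t = 0

variable {ι : Type*} [Fintype ι] {ε : ι → R} {V : Submodule ℂ (MerR R)} {g : ι → MerR R}

/-- Steinitz exchange of one member `gₜ` of a frame: if `gₜ` is a sum of elements of `V`, then one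
of them can take its place, because the `t`-th coordinates of the summands add up to `εₜ` in the
local ring `εₜ R εₜ`. -/
theorem IsFrame.exchange [FiniteDimensional ℂ R] [DecidableEq ι] (hg : IsFrame ε V g)
    (hV : ∀ v ∈ V, ∀ r : R, v * constR r ∈ V) {t₀ : ι} (hε : IsPrimitiveIdem (ε t₀))
    {κ : Type*} {s : Finset κ} {w : κ → MerR R} (hw : ∀ a ∈ s, w a ∈ V)
    (hsum : g t₀ = ∑ a ∈ s, w a) :
    ∃ a ∈ s, IsFrame ε V (Function.update g t₀ (w a * constR (ε t₀))) := by
  have hc : ∀ a, ∃ c : ι → R, a ∈ s → w a = ∑ t, g t * constR (c t) := fun a => by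
    by_cases ha : a ∈ s
    · obtain ⟨c, hc⟩ := hg.span _ (hw a ha)
      exact ⟨c, fun _ => hc⟩
    · exact ⟨0, fun h => absurd h ha⟩
  choose c hc using hc
  have hεε := hε.1.eq
  have hd : (∑ a ∈ s, ε t₀ * c a t₀ * ε t₀) * ε t₀ = ε t₀ := by
    have h0 : ∑ t, g t * constR ((∑ a ∈ s, c a t) * ε t₀ - if t = t₀ then ε t₀ else 0) = 0 := by
      simp only [constR_sub, mul_sub, Finset.sum_sub_distrib]
      have h1 : ∑ t, g t * constR (if t = t₀ then ε t₀ else 0) = g t₀ := by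
        rw [Finset.sum_eq_single_of_mem t₀ (Finset.mem_univ _), if_pos rfl, hg.mul_idem]
        intro t _ ht
        rw [if_neg ht, constR_zero, mul_zero]
      rw [h1, sub_eq_zero]
      conv_rhs => rw [← hg.mul_idem, hsum]
      simp only [constR_mul, constR_sum, Finset.mul_sum, ← mul_assoc, ← Finset.sum_mul]
      rw [Finset.sum_comm]
      congr 1
      exact Finset.sum_congr rfl fun a ha => (hc a ha).symm
    have h1 := hg.indep _ h0 t₀
    rw [if_pos rfl, mul_sub, hεε, sub_eq_zero] at h1
    rw [← Finset.sum_mul, ← Finset.mul_sum, mul_assoc, hεε, mul_assoc, h1]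
  -- by locality some coefficient `ε c ε` of `gₜ` in `w a ε` is invertible
  obtain ⟨a, ha, x, hx1, hx2, hx3, hx4⟩ := hε.exists_inv_of_sum
    (fun a _ => by rw [← mul_assoc, ← mul_assoc, hεε]) (fun a _ => by rw [mul_assoc, hεε])
    hεε hεε hd
  set d := ε t₀ * c a t₀ * ε t₀ with hd'
  have hwa : w a * constR (ε t₀) =
      g t₀ * constR d + ∑ t ∈ Finset.univ.erase t₀, g t * constR (c a t * ε t₀) := by
    rw [hc a ha, Finset.sum_mul, ← Finset.add_sum_erase _ _ (Finset.mem_univ t₀)]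
    simp only [mul_assoc, ← constR_mul]
    congr 1
    rw [hd', mul_assoc, constR_mul (ε t₀), ← mul_assoc (g t₀), hg.mul_idem]
  set y := w a * constR (ε t₀) with hy
  have hupd : ∀ c' : ι → R, ∑ t, Function.update g t₀ y t * constR (c' t) =
      y * constR (c' t₀) + ∑ t ∈ Finset.univ.erase t₀, g t * constR (c' t) := fun c' => by
    rw [← Finset.add_sum_erase _ _ (Finset.mem_univ t₀), Function.update_self]
    congr 1
    exact Finset.sum_congr rfl fun t ht => by rw [Function.update_of_ne (Finset.ne_of_mem_erase ht)]
  refine ⟨a, ha, fun t => ?_, fun t => ?_, fun v hv => ?_, fun c' hc' => ?_⟩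
  · rcases eq_or_ne t t₀ with rfl | ht
    · rw [Function.update_self]; exact hV _ (hw a ha) _
    · rw [Function.update_of_ne ht]; exact hg.mem t
  · rcases eq_or_ne t t₀ with rfl | ht
    · rw [Function.update_self, mul_assoc, ← constR_mul, hεε]
    · rw [Function.update_of_ne ht]; exact hg.mul_idem t
  · obtain ⟨b, rfl⟩ := hg.span v hv
    refine ⟨fun t => if t = t₀ then x * b t₀ else b t - c a t * ε t₀ * (x * b t₀), ?_⟩
    rw [hupd, if_pos rfl, hwa, ← Finset.add_sum_erase _ _ (Finset.mem_univ t₀), add_mul, mul_assoc,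
      ← constR_mul, ← mul_assoc d, hx3, constR_mul (ε t₀), ← mul_assoc (g t₀), hg.mul_idem,
      add_assoc, Finset.sum_mul, ← Finset.sum_add_distrib]
    congr 1
    refine Finset.sum_congr rfl fun t ht => ?_
    rw [if_neg (Finset.ne_of_mem_erase ht), constR_sub, mul_sub, mul_assoc, ← constR_mul]
    abel
  · rw [hupd, hwa, add_mul, Finset.sum_mul, add_assoc, ← Finset.sum_add_distrib] at hc'
    have h0 : ∑ t, g t *
        constR (if t = t₀ then d * c' t₀ else c a t * ε t₀ * c' t₀ + c' t) = 0 := by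
      rw [← Finset.add_sum_erase _ _ (Finset.mem_univ t₀), if_pos rfl, ← hc', constR_mul,
        mul_assoc (g t₀)]
      congr 1
      refine Finset.sum_congr rfl fun t ht => ?_
      rw [if_neg (Finset.ne_of_mem_erase ht), constR_add, mul_add, constR_mul _ (c' t₀),
        ← mul_assoc (g t)]
    have h1 := hg.indep _ h0
    have h2 : ε t₀ * c' t₀ = 0 := by
      have := h1 t₀
      rw [if_pos rfl] at this
      have h3 : ε t₀ * d = d := by rw [hd', ← mul_assoc, ← mul_assoc, hεε]
      rw [← mul_assoc, h3] at this
      rw [← hx4, mul_assoc, this, mul_zero]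
    intro t
    rcases eq_or_ne t t₀ with rfl | ht
    · exact h2
    · have := h1 t
      rwa [if_neg ht, mul_assoc, h2, mul_zero, zero_add] at this

/-- If every element of `V` is a sum of elements with the property `H`, then the members of a frame
with index in `S` can be exchanged for members with this property. -/
theorem IsFrame.exists_homogeneous [FiniteDimensional ℂ R] (hg : IsFrame ε V g)
    (hV : ∀ v ∈ V, ∀ r : R, v * constR r ∈ V) (hε : ∀ t, IsPrimitiveIdem (ε t))
    {H : MerR R → Prop} (hH : ∀ v, H v → ∀ r : R, H (v * constR r))
    (hdec : ∀ v ∈ V, ∃ (s : Finset ℂ) (w : ℂ → MerR R), (∀ a ∈ s, w a ∈ V ∧ H (w a)) ∧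
      v = ∑ a ∈ s, w a) (S : Finset ι) :
    ∃ g', IsFrame ε V g' ∧ (∀ t ∉ S, g' t = g t) ∧ ∀ t ∈ S, H (g' t) := by
  classical
  induction S using Finset.induction_on with
  | empty => exact ⟨g, hg, fun _ _ => rfl, by simp⟩
  | insert t₀ S ht₀ ih =>
    obtain ⟨g', hg', h1, h2⟩ := ih
    obtain ⟨s, w, hw, hsum⟩ := hdec _ (hg'.mem t₀)
    obtain ⟨a, ha, hframe⟩ := hg'.exchange hV (hε t₀) (fun a ha => (hw a ha).1) hsum
    refine ⟨_, hframe, fun t ht => ?_, fun t ht => ?_⟩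
    · rw [Finset.mem_insert, not_or] at ht
      rw [Function.update_of_ne ht.1, h1 t ht.2]
    · rcases eq_or_ne t t₀ with rfl | hne
      · rw [Function.update_self]
        exact hH _ (hw a ha).2 _
      · rw [Function.update_of_ne hne]
        exact h2 t (Finset.mem_of_mem_insert_of_ne ht hne)

end Frame

/-! ### Scalar multiples of monic polynomials -/

section ScalarMultiple

variable {R : Type*} [Ring R] [Algebra ℂ R]

theorem map_algebraMap_mul_comm (h : ℂ[X]) (p : R[X]) :
    h.map (algebraMap ℂ R) * p = p * h.map (algebraMap ℂ R) := by
  induction h using Polynomial.induction_on' with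
  | add f g hf hg => rw [Polynomial.map_add, add_mul, mul_add, hf, hg]
  | monomial n c =>
    rw [map_monomial, ← C_mul_X_pow_eq_monomial, mul_assoc, X_pow_mul, ← mul_assoc, ← mul_assoc]
    congr 1
    ext k
    rw [coeff_C_mul, coeff_mul_C, Algebra.commutes]

/-- Every monic polynomial `L` over a finite dimensional algebra has a monic scalar left multiple:
the powers of the variable are linearly dependent modulo `L`. -/
theorem exists_mul_eq_map_algebraMap [FiniteDimensional ℂ R] {L : R[X]} (hL : L.Monic) :
    ∃ (M : R[X]) (s : Multiset ℂ),
      M * L = ((s.map fun b => X - C b).prod : ℂ[X]).map (algebraMap ℂ R) := by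
  nontriviality R
  set K := Module.finrank ℂ (Fin L.natDegree → R) + 1
  let v : Fin K → Fin L.natDegree → R := fun i j => ((X ^ (i : ℕ) : R[X]) %ₘ L).coeff j
  have hv : ¬LinearIndependent ℂ v := fun h => by
    have := h.fintype_card_le_finrank
    rw [Fintype.card_fin] at this
    omega
  obtain ⟨c, hc, i₀, hi₀⟩ := Fintype.not_linearIndependent_iff.1 hv
  let h : ℂ[X] := ∑ i : Fin K, monomial (i : ℕ) (c i)
  have hh0 : h ≠ 0 := fun h0 => hi₀ (by
    have : h.coeff i₀ = c i₀ := by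
      simp only [h, finsetSum_coeff, coeff_monomial, Fin.val_inj]
      simp
    rw [← this, h0, coeff_zero])
  have hmod : ∑ i, c i • ((X ^ (i : ℕ) : R[X]) %ₘ L) = 0 := by
    ext j
    rw [finsetSum_coeff, coeff_zero]
    simp only [coeff_smul]
    by_cases hj : j < L.natDegree
    · simpa [v] using congrFun hc ⟨j, hj⟩
    · refine Finset.sum_eq_zero fun i _ => ?_
      rw [coeff_eq_zero_of_degree_lt, smul_zero]
      refine (degree_modByMonic_lt _ hL).trans_le ?_
      rw [degree_eq_natDegree hL.ne_zero]
      exact_mod_cast not_lt.1 hj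
  obtain ⟨M, hM⟩ : ∃ M, h.map (algebraMap ℂ R) = L * M := by
    refine ⟨∑ i, c i • ((X ^ (i : ℕ) : R[X]) /ₘ L), ?_⟩
    rw [Finset.mul_sum, ← zero_add (∑ i, _), ← hmod, ← Finset.sum_add_distrib, Polynomial.map_sum]
    refine Finset.sum_congr rfl fun i _ => ?_
    rw [mul_smul_comm, ← smul_add, modByMonic_add_div, map_monomial, ← C_mul_X_pow_eq_monomial,
      Algebra.algebraMap_eq_smul_one, ← smul_C, C_1, smul_one_mul]
  -- `L` is left regular and scalar polynomials are central, so `M` is a left cofactor as well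
  have hML : M * L = h.map (algebraMap ℂ R) := by
    have h0 : L * (M * L - h.map (algebraMap ℂ R)) = 0 := by
      rw [mul_sub, ← mul_assoc, ← hM, map_algebraMap_mul_comm, sub_self]
    exact sub_eq_zero.1 ((hL.isRegular.left.mul_left_eq_zero_iff).1 h0)
  refine ⟨(C h.leadingCoeff⁻¹ : ℂ[X]).map (algebraMap ℂ R) * M, h.roots, ?_⟩
  rw [mul_assoc, hML, ← Polynomial.map_mul]
  congr 1
  have := (IsAlgClosed.splits h).eq_prod_roots
  conv_lhs => enter [2]; rw [this]
  rw [← mul_assoc, ← C_mul, inv_mul_cancel₀ (leadingCoeff_ne_zero.2 hh0), C_1, one_mul]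

end ScalarMultiple

/-! ### Solutions of scalar equations with constant coefficients -/

section ScalarEquation

variable {R : Type*} [Ring R] [Algebra ℂ R] [FiniteDimensional ℂ R]

theorem quasi_monomial_independent {J : Finset (ℂ × ℕ)} {c : ℂ × ℕ → R}
    (h : ∑ t ∈ J, quasi (monomial t.2 (c t)) t.1 = 0) : ∀ t ∈ J, c t = 0 := by
  classical
  intro t ht
  rw [← Finset.sum_fiberwise_of_maps_to (t := J.image Prod.fst) (g := Prod.fst)
    (fun t ht => Finset.mem_image_of_mem _ ht)] at h
  have h1 : ∀ a, ∑ t ∈ J with t.1 = a, quasi (monomial t.2 (c t)) t.1 =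
      quasi (∑ t ∈ J with t.1 = a, monomial t.2 (c t)) a := fun a => by
    rw [quasi_sum]
    exact Finset.sum_congr rfl fun t ht => by rw [(Finset.mem_filter.1 ht).2]
  simp only [h1] at h
  have h2 := quasi_injective (quasi_independent h (Finset.mem_image_of_mem Prod.fst ht))
  have h3 := congrArg (fun p => coeff p t.2) h2
  simp only [finsetSum_coeff, coeff_monomial, coeff_zero] at h3
  rw [Finset.sum_eq_single_of_mem t (by simp [ht])] at h3
  · simpa using h3
  · rintro u hu hne
    rw [if_neg]
    intro h4
    exact hne (Prod.ext (Finset.mem_filter.1 hu).2 h4)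

/-- Coordinates on the solutions of a scalar equation with constant coefficients. -/
noncomputable def solutionMap (R : Type*) [Ring R] [Algebra ℂ R] (s : Multiset ℂ) :
    (s.toEnumFinset → R) →ₗ[ℂ] MerR R where
  toFun c := ∑ t : s.toEnumFinset, quasi (monomial t.1.2 (c t)) t.1.1
  map_add' c c' := by simp [quasi_add, Finset.sum_add_distrib]
  map_smul' z c := by simp [quasi_smul, Finset.smul_sum]

theorem ker_solutionMap (s : Multiset ℂ) : LinearMap.ker (solutionMap R s) = ⊥ := by
  rw [LinearMap.ker_eq_bot']
  intro c hc
  let c' : ℂ × ℕ → R := fun t => if h : t ∈ s.toEnumFinset then c ⟨t, h⟩ else 0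
  have h : ∑ t ∈ s.toEnumFinset, quasi (monomial t.2 (c' t)) t.1 = 0 := by
    rw [← Finset.sum_coe_sort, ← hc]
    refine Finset.sum_congr rfl fun t _ => ?_
    simp only [c', dif_pos t.2]
  ext1 t
  have := quasi_monomial_independent h t t.2
  rw [Pi.zero_apply]
  simpa only [c', dif_pos t.2] using this

theorem range_solutionMap (s : Multiset ℂ) :
    LinearMap.range (solutionMap R s) = LinearMap.ker (scalarOp R s) := by
  ext v
  rw [LinearMap.mem_range, LinearMap.mem_ker]
  constructor
  · rintro ⟨c, rfl⟩
    change scalarOp R s (∑ t : s.toEnumFinset, _) = 0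
    rw [map_sum]
    exact Finset.sum_eq_zero fun t _ => scalarOp_quasi_eq_zero t.2 _
  · intro h
    obtain ⟨c, rfl⟩ := exists_of_scalarOp_eq_zero h
    exact ⟨fun t => c t, Finset.sum_coe_sort s.toEnumFinset
      (fun t => quasi (monomial t.2 (c t)) t.1)⟩

theorem finite_ker_scalarOp (s : Multiset ℂ) :
    FiniteDimensional ℂ (LinearMap.ker (scalarOp R s)) := by
  rw [← range_solutionMap]; infer_instance

theorem finrank_ker_scalarOp (s : Multiset ℂ) :
    Module.finrank ℂ (LinearMap.ker (scalarOp R s)) = s.card * Module.finrank ℂ R := by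
  rw [← range_solutionMap,
    LinearMap.finrank_range_of_inj (LinearMap.ker_eq_bot.1 (ker_solutionMap s)),
    Module.finrank_pi_fintype, Finset.sum_const, smul_eq_mul, Finset.card_univ, Fintype.card_coe,
    Multiset.card_toEnumFinset]

omit [FiniteDimensional ℂ R] in
theorem scalarOp_eq_constOp (s : Multiset ℂ) :
    scalarOp R s = constOp (((s.map fun b => X - C b).prod : ℂ[X]).map (algebraMap ℂ R)) :=
  (constOp_map_algebraMap _).symm

end ScalarEquation

/-! ### Jets of solutions at a regular point -/

section Jets

variable {R : Type*} [Ring R] [Algebra ℂ R]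

/-- The values at `a` of a function and its derivatives of order less than `n`. -/
noncomputable def jet (R : Type*) [Ring R] [Algebra ℂ R] (a : ℂ) (n : ℕ) :
    MerR R →ₗ[ℂ] Fin n → R :=
  LinearMap.pi fun k => evalR R a ∘ₗ (dX R ^ (k : ℕ))

theorem jet_apply (a : ℂ) (n : ℕ) (v : MerR R) (k : Fin n) :
    jet R a n v k = evalR R a ((dX R ^ (k : ℕ)) v) := rfl

theorem jet_mul_constR (a : ℂ) (n : ℕ) (v : MerR R) (r : R) (k : Fin n) :
    jet R a n (v * constR r) k = jet R a n v k * r := by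
  rw [jet_apply, dX_pow_mul_constR, evalR_mul_constR, jet_apply]

theorem dX_pow_mem_regR {a : ℂ} {v : MerR R} (hv : v ∈ regR R a) (k : ℕ) :
    (dX R ^ k) v ∈ regR R a := by
  induction k with
  | zero => exact hv
  | succ k ih => rw [pow_succ', Module.End.mul_apply]; exact dX_mem_regR ih

theorem diffOp_mem_regR {a : ℂ} {p : (MerR R)[X]} (hp : ∀ k, p.coeff k ∈ regR R a) {v : MerR R}
    (hv : v ∈ regR R a) : diffOp p v ∈ regR R a := by
  rw [diffOp_apply (Nat.lt_succ_self _)]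
  exact sum_mem fun k _ => mul_mem (hp k) (dX_pow_mem_regR hv k)

theorem evalR_dX_pow_mul_eq_zero {a : ℂ} {f v : MerR R} (hf : f ∈ regR R a) (hv : v ∈ regR R a)
    {n : ℕ} (h : ∀ k < n, evalR R a ((dX R ^ k) v) = 0) :
    ∀ k < n, evalR R a ((dX R ^ k) (f * v)) = 0 := by
  intro k
  induction k generalizing f v n with
  | zero =>
    intro hk
    have := h 0 hk
    rw [pow_zero, Module.End.one_apply] at this ⊢
    rw [evalR_mul hf hv, this, mul_zero]
  | succ k ih =>
    intro hk
    rw [pow_succ, Module.End.mul_apply, dX_mul, map_add, map_add, ih (dX_mem_regR hf) hv h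
      (by omega), ih hf (dX_mem_regR hv) (n := n - 1) (fun j hj => ?_) (by omega), add_zero]
    have := h (j + 1) (by omega)
    rwa [pow_succ, Module.End.mul_apply] at this

/-- A solution of a monic equation, everything being regular at `a`, is determined by its jet. -/
theorem eq_zero_of_jet_eq_zero [FiniteDimensional ℂ R] {a : ℂ} {p : (MerR R)[X]} (hpm : p.Monic)
    (hp : ∀ k, p.coeff k ∈ regR R a) {v : MerR R} (hv : v ∈ regR R a) (h : diffOp p v = 0)
    (hj : jet R a p.natDegree v = 0) : v = 0 := by
  set d := p.natDegree with hd
  -- the equation, differentiated `i` times, expresses the derivative of order `d + i` at `a`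
  have key : ∀ i, ∀ k < d + i, evalR R a ((dX R ^ k) v) = 0 := fun i => by
    induction i with
    | zero => intro k hk; exact congrFun hj ⟨k, hk⟩
    | succ i ih =>
      intro k hk
      rcases Nat.lt_or_ge k (d + i) with hk' | hk'
      · exact ih k hk'
      obtain rfl : k = i + d := by omega
      rw [diffOp_apply (Nat.lt_succ_self _), Finset.sum_range_succ, hpm.coeff_natDegree,
        one_mul] at h
      rw [pow_add, Module.End.mul_apply, eq_neg_of_add_eq_zero_right h, map_neg, map_neg, map_sum,
        map_sum, Finset.sum_eq_zero, neg_zero]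
      intro j hj
      have hj := Finset.mem_range.1 hj
      refine evalR_dX_pow_mul_eq_zero (hp j) (dX_pow_mem_regR hv j) (n := i + 1) (fun l hl => ?_) i
        (by omega)
      rw [← Module.End.mul_apply, ← pow_add]
      exact ih _ (by omega)
  exact eq_zero_of_evalR hv fun k => key (k + 1) k (by omega)

end Jets

/-! ### The kernel of a Darboux operator -/

section Kernel

variable {R : Type*} [Ring R] [Algebra ℂ R]

theorem exists_of_finrank_eq_add {W U Y : Type*} [AddCommGroup W] [Module ℂ W] [AddCommGroup U]
    [Module ℂ U] [AddCommGroup Y] [Module ℂ Y] [FiniteDimensional ℂ W] [FiniteDimensional ℂ U]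
    [FiniteDimensional ℂ Y] {T : W →ₗ[ℂ] U} {J : W →ₗ[ℂ] Y} (h : ∀ v, T v = 0 → J v = 0 → v = 0)
    (hd : Module.finrank ℂ W = Module.finrank ℂ U + Module.finrank ℂ Y) (u : Y) :
    ∃ v, T v = 0 ∧ J v = u := by
  have hinj : Function.Injective (T.prod J) := LinearMap.ker_eq_bot.1 <| LinearMap.ker_eq_bot'.2
    fun v hv => h v (congrArg Prod.fst hv) (congrArg Prod.snd hv)
  obtain ⟨v, hv⟩ := (LinearMap.injective_iff_surjective_of_finrank_eq_finrank
    (by rw [hd, Module.finrank_prod])).1 hinj (0, u)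
  exact ⟨v, congrArg Prod.fst hv, congrArg Prod.snd hv⟩

/-- A Darboux operator right-divides a scalar operator, the quotient being monic. -/
theorem IsDarboux.exists_scalarOp [Nontrivial R] [FiniteDimensional ℂ R]
    {P : Module.End ℂ (MerR R)} (hP : IsDarboux P) :
    ∃ (p q : (MerR R)[X]) (s : Multiset ℂ), p.Monic ∧ (∀ k, p.coeff k ∈ ratR R) ∧ P = diffOp p ∧
      q.Monic ∧ (∀ k, q.coeff k ∈ ratR R) ∧ diffOp q * P = scalarOp R s ∧
      q.natDegree + p.natDegree = s.card := by
  have := nontrivial_merR (R := R)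
  obtain ⟨⟨p, hpm, hp, rfl⟩, Q, ⟨q₀, hq₀, rfl⟩, L, hL, h⟩ := hP
  obtain ⟨M, s, hM⟩ := exists_mul_eq_map_algebraMap hL
  obtain ⟨q, hq, -, -, hqe⟩ := exists_diffOp_mul (A := ratR R) (fun a => dX_mem_ratR)
    (constOp_mem_ratR M) le_rfl hq₀ le_rfl
  have hqp : diffOp q * diffOp p = scalarOp R s := by
    rw [← hqe, mul_assoc, h, scalarOp_eq_constOp, ← hM, constOp_mul]; rfl
  obtain ⟨t, -, htd, htc, hte⟩ := exists_diffOp_mul (A := ratR R) (fun a => dX_mem_ratR)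
    hq le_rfl hp le_rfl
  set ℓ : (MerR R)[X] := (((s.map fun b => X - C b).prod : ℂ[X]).map (algebraMap ℂ R)).map
    (Algebra.TensorProduct.includeLeftRingHom : R →+* MerR R) with hℓ
  -- comparing the symbols of both sides determines the order and the leading coefficient of `q`
  have htl : t = ℓ := diffOp_injective (by rw [← hte, hqp, scalarOp_eq_constOp]; rfl)
  have hs : ((s.map fun b => X - C b).prod : ℂ[X]).Monic := monic_multiset_prod_of_monic _ _
    fun b _ => monic_X_sub_C b
  have hℓm : ℓ.Monic := (hs.map _).map _
  have hℓd : ℓ.natDegree = s.card := by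
    rw [hℓ, (hs.map _).natDegree_map, hs.natDegree_map, natDegree_multiset_prod_X_sub_C_eq_card]
  rw [htl, hpm.coeff_natDegree, mul_one] at htc
  rw [htl, hℓd] at htd
  have hq0 : q.leadingCoeff ≠ 0 := by
    rw [leadingCoeff_ne_zero]
    rintro rfl
    rw [diffOp_zero, zero_mul, ← diffOp_zero] at hte
    exact hℓm.ne_zero (htl ▸ (diffOp_injective hte).symm)
  have hle : q.natDegree + p.natDegree ≤ s.card := by
    rw [← hℓd]
    exact le_natDegree_of_ne_zero (by rw [htc]; exact hq0)
  have heq : q.natDegree + p.natDegree = s.card := le_antisymm hle htd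
  refine ⟨p, q, s, hpm, hp, rfl, ?_, hq, hqp, heq⟩
  rw [Monic, leadingCoeff, ← htc, heq, ← hℓd, hℓm.coeff_natDegree]

/-- The kernel of `P` is a free right `R`-module: at a suitable point, solutions correspond to their
jets of order `deg P`. -/
theorem IsDarboux.exists_jet [Nontrivial R] [FiniteDimensional ℂ R]
    {P : Module.End ℂ (MerR R)} (hP : IsDarboux P) {p : (MerR R)[X]} (hpm : p.Monic)
    (hPp : P = diffOp p) :
    ∃ a : ℂ, (∀ v, P v = 0 → jet R a p.natDegree v = 0 → v = 0) ∧
      ∀ u, ∃ v, P v = 0 ∧ jet R a p.natDegree v = u := by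
  obtain ⟨p', q, s, -, hp, hPp', hqm, hq, hqp, hcard⟩ := hP.exists_scalarOp
  obtain rfl : p' = p := diffOp_injective (hPp' ▸ hPp)
  have hreg : ∀ t : (MerR R)[X], (∀ k, t.coeff k ∈ ratR R) →
      ∀ᶠ a in cofinite, ∀ k, t.coeff k ∈ regR R a := fun t ht => by
    have : ∀ᶠ a in cofinite, ∀ k ∈ Finset.range (t.natDegree + 1), t.coeff k ∈ regR R a :=
      (Filter.eventually_all_finset _).2 fun k _ => eventually_mem_regR (ht k)
    filter_upwards [this] with a ha k
    by_cases hk : k ∈ Finset.range (t.natDegree + 1)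
    · exact ha k hk
    · rw [coeff_eq_zero_of_natDegree_lt (by simpa using hk)]; exact zero_mem _
  obtain ⟨a, hpa, hqa⟩ := ((hreg p' hp).and (hreg q hq)).exists
  set W := LinearMap.ker (scalarOp R s)
  have : FiniteDimensional ℂ W := finite_ker_scalarOp s
  have hWreg : ∀ v ∈ W, v ∈ regR R a := fun v hv => by
    obtain ⟨c, rfl⟩ := exists_of_scalarOp_eq_zero hv
    exact sum_mem fun t _ => quasi_mem_regR a _ _
  have hker : ∀ v, P v = 0 → v ∈ W := fun v hv => by
    rw [LinearMap.mem_ker, ← hqp, Module.End.mul_apply, hv, map_zero]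
  have hinj : ∀ v, P v = 0 → jet R a p'.natDegree v = 0 → v = 0 := fun v hv hj =>
    eq_zero_of_jet_eq_zero hpm hpa (hWreg v (hker v hv)) (hPp ▸ hv) hj
  refine ⟨a, hinj, ?_⟩
  -- `T v` is the jet of `P v`, which solves the equation of `q`, so that `ker T = ker P`
  let T : W →ₗ[ℂ] (Fin q.natDegree → R) := jet R a q.natDegree ∘ₗ P ∘ₗ W.subtype
  have hT : ∀ v : W, T v = 0 → P v = 0 := fun v hv =>
    eq_zero_of_jet_eq_zero hqm hqa (hPp ▸ diffOp_mem_regR hpa (hWreg v v.2))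
      (by rw [← Module.End.mul_apply, hqp]; exact v.2) hv
  let J : W →ₗ[ℂ] (Fin p'.natDegree → R) := jet R a p'.natDegree ∘ₗ W.subtype
  have hJ : ∀ v, T v = 0 → J v = 0 → v = 0 := fun v hv hv' => Subtype.ext (hinj _ (hT v hv) hv')
  intro u
  obtain ⟨v, hv, hv'⟩ := exists_of_finrank_eq_add hJ (by
    rw [finrank_ker_scalarOp, ← hcard, add_mul]
    simp only [Module.finrank_pi_fintype, Finset.sum_const, smul_eq_mul, Finset.card_univ,
      Fintype.card_fin]) u
  exact ⟨v, hT v hv, hv'⟩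

theorem exists_rational_dX_pow_mul_exp {u : MerR R} (hu : u ∈ ratR R) (α : ℂ) (k : ℕ) :
    ∃ w ∈ ratR R, (dX R ^ k) (u * scalarR (Mer.exp α)) = w * scalarR (Mer.exp α) := by
  induction k with
  | zero => exact ⟨u, hu, rfl⟩
  | succ k ih =>
    obtain ⟨w, hw, h⟩ := ih
    refine ⟨dX R w + constR (α • 1) * w,
      add_mem (dX_mem_ratR hw) (mul_mem (constR_mem_ratR _) hw), ?_⟩
    rw [pow_succ', Module.End.mul_apply, h, dX_mul, dX_scalarR_exp, add_mul, constR_smul,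
      constR_one, smul_one_mul, mul_smul_comm, smul_mul_assoc]

/-- The components of a solution that belong to the different exponents are solutions. -/
theorem IsDarboux.exists_decomposition [Nontrivial R] [FiniteDimensional ℂ R]
    {P : Module.End ℂ (MerR R)} (hP : IsDarboux P) {v : MerR R} (hv : P v = 0) :
    ∃ (S : Finset ℂ) (w : ℂ → R[X]), (∀ a ∈ S, P (quasi (w a) a) = 0) ∧
      v = ∑ a ∈ S, quasi (w a) a := by
  obtain ⟨p, q, s, -, hp, rfl, -, -, hs, -⟩ := hP.exists_scalarOp
  obtain ⟨c, hc⟩ := exists_of_scalarOp_eq_zero (s := s) (v := v) (by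
    rw [← hs, Module.End.mul_apply, hv, map_zero])
  rw [← Finset.sum_fiberwise_of_maps_to (t := s.toFinset) (g := Prod.fst)
    (fun t ht => Multiset.mem_toFinset.2 (Multiset.mem_of_mem_toEnumFinset ht))] at hc
  have h1 : ∀ a, ∑ t ∈ s.toEnumFinset with t.1 = a, quasi (monomial t.2 (c t)) t.1 =
      quasi (∑ t ∈ s.toEnumFinset with t.1 = a, monomial t.2 (c t)) a := fun a => by
    rw [quasi_sum]
    exact Finset.sum_congr rfl fun t ht => by rw [(Finset.mem_filter.1 ht).2]
  simp only [h1] at hc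
  set w := fun a => ∑ t ∈ s.toEnumFinset with t.1 = a, monomial t.2 (c t)
  refine ⟨s.toFinset, w, ?_, hc⟩
  have h2 : ∀ a, ∃ u ∈ ratR R, diffOp p (quasi (w a) a) = u * scalarR (Mer.exp a) := fun a => by
    choose y hy hye using exists_rational_dX_pow_mul_exp (polyR_mem_ratR (w a)) a
    refine ⟨∑ k ∈ Finset.range (p.natDegree + 1), p.coeff k * y k,
      sum_mem fun k _ => mul_mem (hp k) (hy k), ?_⟩
    rw [diffOp_apply (Nat.lt_succ_self _), Finset.sum_mul]
    exact Finset.sum_congr rfl fun k _ => by rw [quasi, hye, mul_assoc]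
  choose u hu hue using h2
  intro a ha
  rw [hue, rational_exp_independent (s := s.toFinset) (a := u) (fun a _ => hu a) ?_ ha, zero_mul]
  rw [← hv, hc, map_sum]
  exact Finset.sum_congr rfl fun a _ => (hue a).symm

end Kernel

/-! ### Solutions of `∏ⱼ (∂ₓ - γ₁ⱼe₁ - ⋯ - γₘⱼeₘ) f = 0` -/

section ProductOperator

variable {R : Type*} [Ring R] [Algebra ℂ R] {m : ℕ} {e : Fin m → R}

/-- The exponents `γₖⱼ`, with multiplicities, that belong to the idempotent `eₖ`. -/
def exponents (γs : List (Fin m → ℂ)) (k : Fin m) : Multiset ℂ := (γs.map fun γ => γ k : List ℂ)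

theorem prod_linOp_mul_constR (γs : List (Fin m → ℂ)) (v : MerR R) (r : R) :
    (γs.map (linOp e)).prod (v * constR r) = (γs.map (linOp e)).prod v * constR r := by
  induction γs with
  | nil => rfl
  | cons γ γs ih =>
    rw [List.map_cons, List.prod_cons, Module.End.mul_apply, ih, linOp_mul_constR,
      Module.End.mul_apply]

theorem linOp_idem_mul (he : CompleteOrthogonalIdempotents e) (γ : Fin m → ℂ) (k : Fin m)
    (v : MerR R) :
    linOp e γ (constR (e k) * v) = (dX R - algebraMap ℂ _ (γ k)) (constR (e k) * v) := by
  rw [linOp_apply, LinearMap.sub_apply, ← mul_assoc (constR (diagElt e γ)), ← constR_mul,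
    diagElt_mul_idem he, constR_smul, smul_mul_assoc, Module.algebraMap_end_apply]

theorem idem_mul_linOp (he : CompleteOrthogonalIdempotents e) (γ : Fin m → ℂ) (k : Fin m)
    (v : MerR R) : constR (e k) * linOp e γ v = linOp e γ (constR (e k) * v) := by
  rw [linOp_idem_mul he, linOp_apply, LinearMap.sub_apply, dX_constR_mul, mul_sub, ← mul_assoc,
    ← constR_mul, idem_mul_diagElt he, constR_smul, smul_mul_assoc, Module.algebraMap_end_apply]

/-- On functions with values in `eₖ R`, a product of first order factors acts as a scalar
operator. -/
theorem idem_mul_prod_linOp (he : CompleteOrthogonalIdempotents e) (γs : List (Fin m → ℂ))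
    (k : Fin m) (v : MerR R) :
    constR (e k) * (γs.map (linOp e)).prod v = scalarOp R (exponents γs k) (constR (e k) * v) := by
  induction γs with
  | nil =>
    change _ = scalarOp R 0 _
    rw [scalarOp_zero]; rfl
  | cons γ γs ih =>
    rw [List.map_cons, List.prod_cons, Module.End.mul_apply, idem_mul_linOp he, linOp_idem_mul he,
      ih, ← Module.End.mul_apply, ← scalarOp_cons]
    rfl

theorem prod_linOp_idem_mul (he : CompleteOrthogonalIdempotents e) (γs : List (Fin m → ℂ))
    (k : Fin m) (v : MerR R) :
    (γs.map (linOp e)).prod (constR (e k) * v) = constR (e k) * (γs.map (linOp e)).prod v := by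
  induction γs with
  | nil => rfl
  | cons γ γs ih =>
    rw [List.map_cons, List.prod_cons, Module.End.mul_apply, ih, ← idem_mul_linOp he,
      Module.End.mul_apply]

theorem quasi_monomial_idem (he : CompleteOrthogonalIdempotents e) (k : Fin m) (t : ℂ × ℕ) :
    quasi (monomial t.2 (e k)) t.1 = constR (e k) * quasi (monomial t.2 (e k)) t.1 := by
  rw [← quasi_C_mul, C_mul_monomial, (he.idem k).eq]

theorem prod_linOp_quasi_monomial (he : CompleteOrthogonalIdempotents e) {γs : List (Fin m → ℂ)}
    {k : Fin m} {t : ℂ × ℕ} (ht : t ∈ (exponents γs k).toEnumFinset) :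
    (γs.map (linOp e)).prod (quasi (monomial t.2 (e k)) t.1) = 0 := by
  rw [quasi_monomial_idem he, prod_linOp_idem_mul he, idem_mul_prod_linOp he,
    ← quasi_monomial_idem he, scalarOp_quasi_eq_zero ht]

theorem exists_of_prod_linOp_eq_zero [FiniteDimensional ℂ R] (he : CompleteOrthogonalIdempotents e)
    {γs : List (Fin m → ℂ)} {v : MerR R} (h : (γs.map (linOp e)).prod v = 0) :
    ∃ c : Fin m → ℂ × ℕ → R, v = ∑ k, ∑ t ∈ (exponents γs k).toEnumFinset,
      quasi (monomial t.2 (e k)) t.1 * constR (c k t) := by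
  have hk : ∀ k, ∃ c : ℂ × ℕ → R, constR (e k) * v = ∑ t ∈ (exponents γs k).toEnumFinset,
      quasi (monomial t.2 (c t)) t.1 := fun k =>
    exists_of_scalarOp_eq_zero (by rw [← idem_mul_prod_linOp he, h, mul_zero])
  choose c hc using hk
  refine ⟨c, ?_⟩
  have h1 : v = ∑ k, constR (e k) * (constR (e k) * v) := by
    simp only [← mul_assoc, ← constR_mul, (he.idem _).eq, ← Finset.sum_mul, ← constR_sum,
      he.complete, constR_one, one_mul]
  rw [h1]
  refine Finset.sum_congr rfl fun k _ => ?_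
  rw [hc, Finset.mul_sum]
  refine Finset.sum_congr rfl fun t _ => ?_
  rw [← quasi_C_mul, ← quasi_mul_C, C_mul_monomial, monomial_mul_C]

theorem exists_prod_linOp_quasi (he : CompleteOrthogonalIdempotents e) (γs : List (Fin m → ℂ))
    (u : R[X]) (α : ℂ) : ∃ u', (γs.map (linOp e)).prod (quasi u α) = quasi u' α := by
  induction γs with
  | nil => exact ⟨u, rfl⟩
  | cons γ γs ih =>
    obtain ⟨u', h⟩ := ih
    exact ⟨_, by rw [List.map_cons, List.prod_cons, Module.End.mul_apply, h, linOp_quasi he]⟩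

/-- Products of first order factors are surjective on quasipolynomials. -/
theorem exists_prod_linOp_eq_quasi [FiniteDimensional ℂ R] (he : CompleteOrthogonalIdempotents e)
    (γs : List (Fin m → ℂ)) (u : R[X]) (α : ℂ) :
    ∃ u', (γs.map (linOp e)).prod (quasi u' α) = quasi u α := by
  induction γs generalizing u with
  | nil => exact ⟨u, rfl⟩
  | cons γ γs ih =>
    obtain ⟨u', h⟩ := ih (opF (opA e γ α) u)
    exact ⟨u', by rw [List.map_cons, List.prod_cons, Module.End.mul_apply, h, linOp_quasi_opF he]⟩

end ProductOperator

/-! ### Frames with prescribed members -/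

section PrescribedFrame

theorem exists_sum_basis_smul {n : ℕ} {X : Type*} [Fintype X] (b : Module.Basis X ℂ (Fin n → ℂ))
    {M : Type*} [AddCommGroup M] [Module ℂ M] (u : Fin n → M) :
    ∃ c : X → M, ∀ i, ∑ x, b x i • c x = u i := by
  classical
  refine ⟨fun x => ∑ l, b.repr (Pi.single l 1) x • u l, fun i => ?_⟩
  have h : ∀ l, ∑ x, b.repr (Pi.single l 1) x * b x i = (Pi.single l 1 : Fin n → ℂ) i := fun l => by
    conv_rhs => rw [← b.sum_repr (Pi.single l 1)]
    simp only [Finset.sum_apply, Pi.smul_apply, smul_eq_mul]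
  simp only [Finset.smul_sum, smul_smul]
  rw [Finset.sum_comm]
  simp only [← Finset.sum_smul, mul_comm (b _ i), h]
  rw [Finset.sum_eq_single_of_mem i (Finset.mem_univ i)]
  · rw [Pi.single_eq_same, one_smul]
  · intro l _ hl
    rw [Pi.single_eq_of_ne hl.symm, zero_smul]

theorem eq_zero_of_sum_basis_smul {n : ℕ} {X : Type*} [Fintype X]
    (b : Module.Basis X ℂ (Fin n → ℂ)) {M : Type*} [AddCommGroup M] [Module ℂ M] {c : X → M}
    (h : ∀ i, ∑ x, b x i • c x = 0) (x : X) : c x = 0 := by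
  rw [← Module.forall_dual_apply_eq_zero_iff ℂ]
  intro φ
  refine Fintype.linearIndependent_iff.1 b.linearIndependent (fun x => φ (c x)) ?_ x
  ext i
  simpa [mul_comm] using congrArg φ (h i)

theorem sumExtend_inl {ι V : Type*} [AddCommGroup V] [Module ℂ V] {v : ι → V}
    (hv : LinearIndependent ℂ v) (i : ι) : Module.Basis.sumExtend hv (Sum.inl i) = v i := by
  classical
  simp only [Module.Basis.sumExtend, Module.Basis.reindex_apply, Module.Basis.extend_apply_self]
  rfl

variable {R : Type*} [Ring R] [Algebra ℂ R]

/-- The jet of `xⁱ exp(αx) r` is a scalar vector times `r`. -/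
theorem jet_quasi_monomial (a : ℂ) (n i : ℕ) (α : ℂ) : ∃ w : Fin n → ℂ, ∀ (r : R) (k : Fin n),
    jet R a n (quasi (monomial i r) α) k = w k • r := by
  refine ⟨fun k => Mer.evalAt a ((Mer.D ^ (k : ℕ)) (Mer.x ^ i * Mer.exp α)), fun r k => ?_⟩
  have h : ∀ (k : ℕ) (f : Mer), (dX R ^ k) (r ⊗ₜ f) = r ⊗ₜ ((Mer.D ^ k) f) := fun k f => by
    induction k with
    | zero => rfl
    | succ k ih =>
      rw [pow_succ', Module.End.mul_apply, ih, dX_tmul, pow_succ', Module.End.mul_apply]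
  rw [jet_apply, quasi, polyR, sum_monomial_index _ _ (by rw [TensorProduct.zero_tmul]), scalarR,
    Algebra.TensorProduct.tmul_mul_tmul, mul_one, h, evalR_tmul]

variable {m : ℕ} {e : Fin m → R}

/-- The kernel of an operator of order `n` has a frame with `n` members for each idempotent `eₖ`,
in which the solutions `xⁱ exp(αx) eₖ` may be prescribed. -/
theorem IsDarboux.exists_frame [Nontrivial R] [FiniteDimensional ℂ R]
    (he : CompleteOrthogonalIdempotents e) (hne : ∀ k, e k ≠ 0) {T : Module.End ℂ (MerR R)}
    (hT : IsDarboux T) {J : Fin m → Finset (ℂ × ℕ)}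
    (hJ : ∀ k, ∀ t ∈ J k, T (quasi (monomial t.2 (e k)) t.1) = 0) :
    ∃ n : ℕ, (∀ k, (J k).card ≤ n) ∧ ∃ g : (Σ k, J k ⊕ Fin (n - (J k).card)) → MerR R,
      IsFrame (fun t => e t.1) (LinearMap.ker T) g ∧
        ∀ k t, g ⟨k, Sum.inl t⟩ = quasi (monomial t.1.2 (e k)) t.1.1 := by
  obtain ⟨p, hpm, -, hTp⟩ := hT.1
  obtain ⟨a, hinj, hsurj⟩ := hT.exists_jet hpm hTp
  set n := p.natDegree
  -- `w t` is the jet of the scalar function `xⁱ exp(αx)`, where `t = (α, i)`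
  choose w hw using fun t : ℂ × ℕ => jet_quasi_monomial (R := R) a n t.2 t.1
  have hind : ∀ k, LinearIndependent ℂ fun t : J k => w t := fun k => by
    rw [Fintype.linearIndependent_iff]
    intro c hc t
    let c' : ℂ × ℕ → ℂ := fun t => if h : t ∈ J k then c ⟨t, h⟩ else 0
    have hc' : ∀ t : J k, c' t = c t := fun t => dif_pos t.2
    have h0 : ∑ t ∈ J k, quasi (monomial t.2 (c' t • e k)) t.1 = 0 := by
      refine hinj _ ?_ ?_
      · rw [map_sum]
        refine Finset.sum_eq_zero fun t ht => ?_
        rw [← smul_monomial, quasi_smul, map_smul, hJ k t ht, smul_zero]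
      · ext i
        rw [map_sum, Finset.sum_apply, ← Finset.sum_coe_sort]
        simp only [hw, hc', smul_smul, ← Finset.sum_smul]
        have := congrFun hc i
        simp only [Finset.sum_apply, Pi.smul_apply, smul_eq_mul, Pi.zero_apply] at this
        simp only [mul_comm (w _ i), this, zero_smul, Pi.zero_apply]
    have := quasi_monomial_independent h0 t t.2
    rw [hc'] at this
    exact (smul_eq_zero.1 this).resolve_right (hne k)
  have hcard : ∀ k, (J k).card ≤ n := fun k => by
    simpa using (hind k).fintype_card_le_finrank
  have hb : ∀ k, ∃ b : Module.Basis (J k ⊕ Fin (n - (J k).card)) ℂ (Fin n → ℂ),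
      ∀ t, b (Sum.inl t) = w t := fun k => by
    let b := Module.Basis.sumExtend (hind k)
    have : Fintype (Module.Basis.sumExtendIndex (hind k)) :=
      have := FiniteDimensional.fintypeBasisIndex b
      Fintype.ofInjective (Sum.inr (α := J k)) Sum.inr_injective
    have h := Module.finrank_eq_card_basis b
    have h' : Fintype.card (Module.Basis.sumExtendIndex (hind k)) = n - (J k).card := by
      rw [Module.finrank_fin_fun] at h
      have : n = (J k).card + Fintype.card (Module.Basis.sumExtendIndex (hind k)) := by
        rwa [Fintype.card_sum, Fintype.card_coe] at h
      omega
    refine ⟨b.reindex ((Equiv.refl _).sumCongr (Fintype.equivFinOfCardEq h')), fun t => ?_⟩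
    rw [Module.Basis.reindex_apply]
    exact sumExtend_inl (hind k) t
  choose b hb using hb
  -- the frame consists of the solutions with jets `b eₖ`, for `b` in the completed basis of `ℂⁿ`
  have hg : ∀ t : (Σ k, J k ⊕ Fin (n - (J k).card)), ∃ g, T g = 0 ∧
      jet R a n g = fun i => b t.1 t.2 i • e t.1 := fun t => hsurj _
  choose g hgT hg using hg
  have hTr : ∀ v r, T (v * constR r) = T v * constR r := fun v r => by
    rw [hTp, diffOp_mul_constR]
  have hTs : ∀ c : (Σ k, J k ⊕ Fin (n - (J k).card)) → R, T (∑ t, g t * constR (c t)) = 0 :=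
    fun c => by
      rw [map_sum]
      exact Finset.sum_eq_zero fun t _ => by rw [hTr, hgT, zero_mul]
  have hjet : ∀ (c : (Σ k, J k ⊕ Fin (n - (J k).card)) → R) i,
      jet R a n (∑ t, g t * constR (c t)) i = ∑ k, e k * ∑ x, b k x i • c ⟨k, x⟩ := fun c i => by
    rw [map_sum, Finset.sum_apply, Fintype.sum_sigma]
    refine Finset.sum_congr rfl fun k _ => ?_
    rw [Finset.mul_sum]
    refine Finset.sum_congr rfl fun x _ => ?_
    rw [jet_mul_constR, hg, smul_mul_assoc, mul_smul_comm]
  refine ⟨n, hcard, g, ⟨hgT, fun t => ?_, fun v hv => ?_, fun c hc t => ?_⟩, fun k t => ?_⟩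
  · rw [← sub_eq_zero]
    refine hinj _ (by rw [map_sub, hTr, hgT, zero_mul, sub_zero]) ?_
    ext i
    rw [map_sub, Pi.sub_apply, jet_mul_constR, hg, smul_mul_assoc, (he.idem _).eq, sub_self]; rfl
  · choose c hc using fun k => exists_sum_basis_smul (b k) (jet R a n v)
    refine ⟨fun t => c t.1 t.2, ?_⟩
    rw [← sub_eq_zero]
    refine hinj _ (by rw [map_sub, hTs, sub_zero]; exact hv) ?_
    ext i
    rw [map_sub, Pi.sub_apply, hjet]
    simp only [hc]
    rw [← Finset.sum_mul, he.complete, one_mul, sub_self]; rfl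
  · refine eq_zero_of_sum_basis_smul (b t.1) (c := fun x => e t.1 * c ⟨t.1, x⟩) (fun i => ?_) t.2
    have h := congrArg (e t.1 * ·) (hjet c i)
    simp only [hc, map_zero, Pi.zero_apply, mul_zero] at h
    rw [Finset.mul_sum, Finset.sum_eq_single_of_mem t.1 (Finset.mem_univ _)] at h
    · rw [← mul_assoc, (he.idem _).eq, Finset.mul_sum] at h
      simpa only [mul_smul_comm] using h.symm
    · intro l _ hl
      rw [← mul_assoc, he.ortho hl.symm, zero_mul]
  · rw [← sub_eq_zero]
    refine hinj _ (by rw [map_sub, hgT, hJ k t t.2, sub_zero]) ?_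
    ext i
    rw [map_sub, Pi.sub_apply, hg, hw, hb, sub_self]; rfl

/-- The remaining members of the frame may be taken to be quasipolynomials with one exponent. -/
theorem IsDarboux.exists_quasi_frame [Nontrivial R] [FiniteDimensional ℂ R]
    (he : CompleteOrthogonalIdempotents e) (hprim : ∀ k, IsPrimitiveIdem (e k))
    {T : Module.End ℂ (MerR R)} (hT : IsDarboux T) {J : Fin m → Finset (ℂ × ℕ)}
    (hJ : ∀ k, ∀ t ∈ J k, T (quasi (monomial t.2 (e k)) t.1) = 0) :
    ∃ n : ℕ, (∀ k, (J k).card ≤ n) ∧ ∃ (p : ∀ k, J k ⊕ Fin (n - (J k).card) → R[X])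
      (α : ∀ k, J k ⊕ Fin (n - (J k).card) → ℂ),
      IsFrame (fun t : (Σ k, J k ⊕ Fin (n - (J k).card)) => e t.1) (LinearMap.ker T)
        (fun t => quasi (p t.1 t.2 * C (e t.1)) (α t.1 t.2)) ∧
        ∀ k t, quasi (p k (Sum.inl t) * C (e k)) (α k (Sum.inl t)) =
          quasi (monomial t.1.2 (e k)) t.1.1 ∧ α k (Sum.inl t) = t.1.1 := by
  obtain ⟨n, hn, g, hg, hgJ⟩ := hT.exists_frame he (fun k => (hprim k).2.1) hJ
  obtain ⟨q, -, -, hTq⟩ := hT.1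
  obtain ⟨g', hg', hgS, hH⟩ := hg.exists_homogeneous
    (fun v hv r => by
      rw [LinearMap.mem_ker] at hv ⊢
      rw [hTq, diffOp_mul_constR, ← hTq, hv, zero_mul])
    (fun t => hprim t.1) (H := fun v => ∃ (p : R[X]) (α : ℂ), v = quasi p α)
    (by rintro v ⟨p, α, rfl⟩ r; exact ⟨p * C r, α, (quasi_mul_C p r α).symm⟩)
    (fun v hv => by
      obtain ⟨S, w, hw, h⟩ := hT.exists_decomposition hv
      exact ⟨S, fun a => quasi (w a) a, fun a ha => ⟨hw a ha, w a, a, rfl⟩, h⟩)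
    (Finset.univ.filter fun t => t.2.isRight)
  have hpα : ∀ k x, ∃ (p : R[X]) (α : ℂ), g' ⟨k, x⟩ = quasi p α ∧
      ∀ t, x = Sum.inl t → α = t.1.1 := fun k x => by
    rcases x with t | x
    · refine ⟨_, _, (hgS _ (by simp)).trans (hgJ k t), ?_⟩
      rintro t' h
      rw [Sum.inl_injective h]
    · obtain ⟨p, α, h⟩ := hH ⟨k, Sum.inr x⟩ (by simp)
      exact ⟨p, α, h, fun t h => by simp at h⟩
  choose p α hp hα using hpα
  have hpe : ∀ k x, quasi (p k x * C (e k)) (α k x) = g' ⟨k, x⟩ := fun k x => by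
    rw [quasi_mul_C, ← hp]
    exact hg'.mul_idem ⟨k, x⟩
  refine ⟨n, hn, p, α, ?_, fun k t => ⟨?_, hα k _ t rfl⟩⟩
  · have : (fun t : (Σ k, J k ⊕ Fin (n - (J k).card)) =>
        quasi (p t.1 t.2 * C (e t.1)) (α t.1 t.2)) = g' := funext fun t => hpe t.1 t.2
    rwa [this]
  · rw [hpe, hgS _ (by simp), hgJ]

end PrescribedFrame

/-! ### Normalizations -/

section Normalization

variable {R : Type*} [Ring R] [Algebra ℂ R] {m : ℕ} {e : Fin m → R}

/-- The sums of the members of a frame over the different idempotents form a basis. -/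
theorem IsFrame.linearIndependent (he : CompleteOrthogonalIdempotents e) {d : ℕ}
    {V : Submodule ℂ (MerR R)} {h : Fin m × Fin d → MerR R} (hh : IsFrame (fun t => e t.1) V h) :
    LinearIndependent Rᵐᵒᵖ fun j => ∑ k, h (k, j) := by
  rw [Fintype.linearIndependent_iff]
  intro c hc j
  have h0 : ∑ t : Fin m × Fin d, h t * constR (c t.2).unop = 0 := by
    rw [Fintype.sum_prod_type_right, ← hc]
    refine Finset.sum_congr rfl fun j _ => ?_
    rw [← MulOpposite.op_unop (c j), op_smul_eq, Finset.sum_mul]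
  have h1 : (c j).unop = 0 := by
    rw [← one_mul (c j).unop, ← he.complete, Finset.sum_mul]
    exact Finset.sum_eq_zero fun k _ => hh.indep _ h0 (k, j)
  exact MulOpposite.unop_injective h1

theorem IsFrame.mem_span_iff (he : CompleteOrthogonalIdempotents e) {d : ℕ}
    {V : Submodule ℂ (MerR R)} (hV : ∀ v ∈ V, ∀ r : R, v * constR r ∈ V)
    {h : Fin m × Fin d → MerR R} (hh : IsFrame (fun t => e t.1) V h) (v : MerR R) :
    v ∈ Submodule.span Rᵐᵒᵖ (Set.range fun j => ∑ k, h (k, j)) ↔ v ∈ V := by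
  constructor
  · intro hv
    induction hv using Submodule.span_induction with
    | mem v hv =>
      obtain ⟨j, rfl⟩ := hv
      exact sum_mem fun k _ => hh.mem _
    | zero => exact zero_mem _
    | add v w _ _ hv hw => exact add_mem hv hw
    | smul r v _ hv =>
      rw [← MulOpposite.op_unop r, op_smul_eq]
      exact hV v hv _
  · intro hv
    obtain ⟨c, rfl⟩ := hh.span v hv
    refine sum_mem fun t _ => ?_
    have : h t * constR (c t) = MulOpposite.op (e t.1 * c t) • ∑ k, h (k, t.2) := by
      rw [op_smul_eq, constR_mul, ← mul_assoc, Finset.sum_mul,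
        Finset.sum_eq_single_of_mem t.1 (Finset.mem_univ _), hh.mul_idem t]
      intro k _ hk
      rw [← hh.mul_idem (k, t.2), mul_assoc, ← constR_mul, he.ortho hk, constR_zero, mul_zero]
    rw [this]
    exact Submodule.smul_mem _ _ (Submodule.subset_span ⟨t.2, rfl⟩)

/-- The members of a frame of `ker P B` that do not span `ker B` are mapped by `B` to a frame of
`ker P`. -/
theorem IsFrame.image_prod_linOp [Nontrivial R] [FiniteDimensional ℂ R]
    (he : CompleteOrthogonalIdempotents e) {P : Module.End ℂ (MerR R)} (hP : IsDarboux P)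
    {γs : List (Fin m → ℂ)} {X : Fin m → Type*} [∀ k, Fintype (X k)] [∀ k, DecidableEq (X k)]
    {f : (Σ k, X k) → MerR R}
    (hf : IsFrame (fun t => e t.1) (LinearMap.ker (P * (γs.map (linOp e)).prod)) f)
    (ζ : ∀ k, (exponents γs k).toEnumFinset ↪ X k)
    (hζ : ∀ k t, f ⟨k, ζ k t⟩ = quasi (monomial t.1.2 (e k)) t.1.1) {d : ℕ}
    (σ : ∀ k, Fin d ≃ {x // x ∉ Finset.univ.map (ζ k)}) :
    IsFrame (fun t => e t.1) (LinearMap.ker P)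
      (fun t : Fin m × Fin d => (γs.map (linOp e)).prod (f ⟨t.1, σ t.1 t.2⟩)) := by
  set B := (γs.map (linOp e)).prod with hB
  have hBr : ∀ v r, B (v * constR r) = B v * constR r := prod_linOp_mul_constR γs
  -- sums over the frame split into the members that solve `B` and the others
  have hsplit : ∀ φ : (Σ k, X k) → MerR R, ∑ t, φ t =
      ∑ k, ∑ t, φ ⟨k, ζ k t⟩ + ∑ t : Fin m × Fin d, φ ⟨t.1, σ t.1 t.2⟩ := fun φ => by
    rw [Fintype.sum_sigma, Fintype.sum_prod_type, ← Finset.sum_add_distrib]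
    refine Finset.sum_congr rfl fun k _ => ?_
    rw [(σ k).sum_comp fun x : {x // x ∉ Finset.univ.map (ζ k)} => φ ⟨k, x⟩, ← Finset.sum_map
      Finset.univ (ζ k) fun x => φ ⟨k, x⟩]
    rw [← Finset.sum_add_sum_compl (Finset.univ.map (ζ k))]
    congr 1
    exact (Finset.sum_subtype _ (fun x => by rw [Finset.mem_compl]) _)
  refine ⟨fun t => ?_, fun t => ?_, fun v hv => ?_, fun c hc t => ?_⟩
  · have := hf.mem ⟨t.1, σ t.1 t.2⟩
    rwa [LinearMap.mem_ker, Module.End.mul_apply] at this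
  · rw [← hBr]
    exact congrArg B (hf.mul_idem ⟨t.1, σ t.1 t.2⟩)
  · obtain ⟨S, w, -, rfl⟩ := hP.exists_decomposition hv
    choose w' hw' using fun a => exists_prod_linOp_eq_quasi he γs (w a) a
    have hw : B (∑ a ∈ S, quasi (w' a) a) = ∑ a ∈ S, quasi (w a) a := by
      rw [map_sum]
      exact Finset.sum_congr rfl fun a _ => hw' a
    obtain ⟨c, hc⟩ := hf.span (∑ a ∈ S, quasi (w' a) a) (by
      rw [LinearMap.mem_ker, Module.End.mul_apply, hw]; exact hv)
    refine ⟨fun t => c ⟨t.1, σ t.1 t.2⟩, ?_⟩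
    rw [← hw, hc, hsplit, map_add, map_sum, Finset.sum_eq_zero, zero_add, map_sum]
    · exact Finset.sum_congr rfl fun t _ => hBr _ _
    · intro k _
      rw [map_sum]
      refine Finset.sum_eq_zero fun t _ => ?_
      rw [hBr, hζ, hB, prod_linOp_quasi_monomial he t.2, zero_mul]
  · have h0 : B (∑ t : Fin m × Fin d, f ⟨t.1, σ t.1 t.2⟩ * constR (c t)) = 0 := by
      rw [map_sum, ← hc]
      exact Finset.sum_congr rfl fun t _ => hBr _ _
    obtain ⟨c', hc'⟩ := exists_of_prod_linOp_eq_zero he h0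
    -- a relation between the images lifts to a relation in the frame of `ker P B`
    let D : (Σ k, X k) → R := fun x =>
      if h : x.2 ∈ Finset.univ.map (ζ x.1) then -c' x.1 (Finset.mem_map.1 h).choose.1
      else c (x.1, (σ x.1).symm ⟨x.2, h⟩)
    have hD1 : ∀ k t, D ⟨k, ζ k t⟩ = -c' k t := fun k t => by
      have h : ζ k t ∈ Finset.univ.map (ζ k) := Finset.mem_map_of_mem _ (Finset.mem_univ _)
      have h' := (Finset.mem_map.1 h).choose_spec.2
      simp only [D, dif_pos h]
      rw [(ζ k).injective h']
    have hD2 : ∀ t : Fin m × Fin d, D ⟨t.1, σ t.1 t.2⟩ = c t := fun t => by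
      simp only [D, dif_neg (σ t.1 t.2).2, Subtype.coe_eta, Equiv.symm_apply_apply]
    rw [← hD2]
    refine hf.indep D ?_ ⟨t.1, σ t.1 t.2⟩
    have hneg : ∀ r : R, constR (-r) = -constR r := fun r => by
      rw [← neg_one_smul ℂ, constR_smul, neg_one_smul]
    rw [hsplit]
    simp only [hD1, hD2, hζ, hneg, mul_neg, Finset.sum_neg_distrib]
    rw [hc', neg_add_eq_zero]
    refine Finset.sum_congr rfl fun k _ => ?_
    exact Finset.sum_coe_sort _ fun t : ℂ × ℕ => quasi (monomial t.2 (e k)) t.1 * constR (c' k t)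

theorem inverse_diagElt (he : CompleteOrthogonalIdempotents e) {v : Fin m → ℂ}
    (hv : ∀ k, v k ≠ 0) : Ring.inverse (diagElt e v) = diagElt e v⁻¹ := by
  have h : v * v⁻¹ = 1 := funext fun k => mul_inv_cancel₀ (hv k)
  have h' : v⁻¹ * v = 1 := funext fun k => inv_mul_cancel₀ (hv k)
  exact Ring.inverse_unit ⟨diagElt e v, diagElt e v⁻¹, by rw [← diagElt_mul he, h, diagElt_one he],
    by rw [← diagElt_mul he, h', diagElt_one he]⟩

theorem wave_mul_prod_linOp (he : CompleteOrthogonalIdempotents e) {P : Module.End ℂ (MerR R)}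
    (hP : IsDarboux P) (γs : List (Fin m → ℂ)) (z : ℂ) :
    wave (P * (γs.map (linOp e)).prod) z =
      wave P z * constR (diagElt e fun k => (γs.map fun γ => z - γ k).prod) := by
  obtain ⟨⟨p, -, -, rfl⟩, -⟩ := hP
  rw [wave, Module.End.mul_apply, prod_linOp_scalarR_exp he, diffOp_mul_constR, wave]

/-- If `ker P B` has a frame of quasipolynomials `p exp(αx) eₖ` that contains the solutions
`xⁱ exp(γx) eₖ` of `B`, then `P exp(xz)` has the normalization
`P B exp(xz) · (∑ₖ ∏ (z - α) eₖ)⁻¹`, the products being over the frame. -/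
theorem isNormalization_of_isFrame [Nontrivial R] [FiniteDimensional ℂ R]
    (he : CompleteOrthogonalIdempotents e) {Φ : DecGr R} {P T : Module.End ℂ (MerR R)}
    (hP : Φ.IsOp P) {γs : List (Fin m → ℂ)} (hT : T = P * (γs.map (linOp e)).prod)
    {X : Fin m → Type*} [∀ k, Fintype (X k)] {n : ℕ} (hX : ∀ k, Fintype.card (X k) = n)
    {p : ∀ k, X k → R[X]} {α : ∀ k, X k → ℂ}
    (hf : IsFrame (fun t : (Σ k, X k) => e t.1) (LinearMap.ker T)
      fun t => quasi (p t.1 t.2 * C (e t.1)) (α t.1 t.2))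
    (ζ : ∀ k, (exponents γs k).toEnumFinset ↪ X k)
    (hζ : ∀ k t, quasi (p k (ζ k t) * C (e k)) (α k (ζ k t)) =
      quasi (monomial t.1.2 (e k)) t.1.1 ∧ α k (ζ k t) = t.1.1) :
    IsNormalization e Φ ((fun z => wave T z * constR (diagElt e fun k => (∏ x, (z - α k x))⁻¹) :
      ℂ → MerR R) : Germ (codiscrete ℂ) (MerR R)) := by
  classical
  subst hT
  have hcard : ∀ k, Fintype.card {x // x ∉ Finset.univ.map (ζ k)} = n - γs.length := fun k => by
    rw [Fintype.card_subtype_compl, hX, Fintype.card_coe, Finset.card_map, Finset.card_univ,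
      Fintype.card_coe, Multiset.card_toEnumFinset, exponents, Multiset.coe_card, List.length_map]
  let σ := fun k => (Fintype.equivFinOfCardEq (hcard k)).symm
  have hh := hf.image_prod_linOp he hP.1 ζ (fun k t => (hζ k t).1) σ
  choose q hq using fun k x => exists_prod_linOp_quasi he γs (p k x) (α k x)
  refine ⟨P, hP, n - γs.length, fun k j => q k (σ k j), fun k j => α k (σ k j),
    fun j => ∑ k, (γs.map (linOp e)).prod (quasi (p k (σ k j) * C (e k)) (α k (σ k j))),
    fun j => Finset.sum_congr rfl fun k _ => ?_, hh.linearIndependent he, fun f => ?_, ?_⟩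
  · rw [quasi_mul_C, prod_linOp_mul_constR, hq, quasi_mul_C]
  · refine (hh.mem_span_iff he (fun v hv r => ?_) f).trans LinearMap.mem_ker
    obtain ⟨⟨p, -, -, rfl⟩, -⟩ := hP.1
    rw [LinearMap.mem_ker] at hv ⊢
    rw [diffOp_mul_constR, hv, zero_mul]
  · rw [Germ.coe_eq]
    have hfin : (⋃ k, Set.range (α k)).Finite := Set.finite_iUnion fun k => Set.finite_range _
    filter_upwards [hfin.compl_mem_codiscrete] with z hz
    have hz : ∀ k x, z - α k x ≠ 0 := fun k x h =>
      hz (Set.mem_iUnion.2 ⟨k, x, (sub_eq_zero.1 h).symm⟩)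
    have hprod : ∀ k, ∏ x, (z - α k x) =
        (γs.map fun γ => z - γ k).prod * ∏ j, (z - α k (σ k j)) := fun k => by
      rw [← Finset.prod_mul_prod_compl (Finset.univ.map (ζ k)), Finset.prod_map,
        (σ k).prod_comp fun x : {x // x ∉ Finset.univ.map (ζ k)} => z - α k x]
      congr 1
      · simp only [fun t => (hζ k t).2]
        rw [Finset.prod_coe_sort _ fun t : ℂ × ℕ => z - t.1]
        have : (γs.map fun γ => z - γ k).prod = ((exponents γs k).map fun b => z - b).prod := by
          rw [exponents, Multiset.map_coe, Multiset.prod_coe, List.map_map]; rfl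
        rw [this]
        conv_rhs => rw [← Multiset.map_toEnumFinset_fst (exponents γs k), Multiset.map_map]
        rfl
      · exact Finset.prod_subtype _ (fun x => by rw [Finset.mem_compl]) _
    have hne : ∀ k, ∏ j, (z - α k (σ k j)) ≠ 0 := fun k =>
      Finset.prod_ne_zero_iff.2 fun j _ => hz k _
    change _ = Φ.1 z * constR (Ring.inverse (diagElt e fun k => ∏ j, (z - α k (σ k j))))
    rw [inverse_diagElt he hne, wave_mul_prod_linOp he hP.1, hP.2, mul_assoc, ← constR_mul,
      ← diagElt_mul he]
    congr 3
    ext k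
    have hk : (γs.map fun γ => z - γ k).prod ≠ 0 := by
      have := Finset.prod_ne_zero_iff.2 fun x (_ : x ∈ Finset.univ) => hz k x
      rw [hprod] at this
      exact left_ne_zero_of_mul this
    rw [Pi.mul_apply, Pi.inv_apply, hprod, mul_inv, mul_inv_cancel_left₀ hk]

end Normalization

/-! ### The fibers of the normalization map -/

section Fibers

variable {R : Type*} [Ring R] [Algebra ℂ R] {m : ℕ} {e : Fin m → R}

theorem infinite_of_mem_codiscrete {Z : Set ℂ} (hZ : Z ∈ codiscrete ℂ) : Z.Infinite := by
  intro hfin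
  have h : (∅ : Set ℂ) ∈ codiscrete ℂ := by
    simpa using Filter.inter_mem hZ hfin.compl_mem_codiscrete
  have h0 := mem_codiscreteWithin_iff_forall_mem_nhdsNE.1 h 0 (Set.mem_univ _)
  simp at h0

theorem exists_common_successor_iff [Nontrivial R] {Φ Ψ : DecGr R}
    {P S : Module.End ℂ (MerR R)} (hP : Φ.IsOp P) (hS : Ψ.IsOp S) :
    (∃ Θ : DecGr R, Prec e Φ Θ ∧ Prec e Ψ Θ) ↔ ∃ γs δs : List (Fin m → ℂ),
      P * (γs.map (linOp e)).prod = S * (δs.map (linOp e)).prod := by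
  constructor
  · rintro ⟨Θ, ⟨γs, -, P', T, hP', hT, rfl⟩, δs, -, S', T', hS', hT', h⟩
    refine ⟨γs, δs, ?_⟩
    rw [hP.unique hP', hS.unique hS', ← h, hT.unique hT']
  · rintro ⟨γs, δs, h⟩
    -- one more factor makes both lists nonempty
    have h' : P * ((γs ++ [0]).map (linOp e)).prod = S * ((δs ++ [0]).map (linOp e)).prod := by
      simp only [List.map_append, List.prod_append, ← mul_assoc, h]
    have hT := hP.1.mul_prod_linOp (e := e) (γs ++ [0])
    exact ⟨DecGr.ofOp hT, ⟨γs ++ [0], by simp, P, _, hP, DecGr.isOp_ofOp hT, rfl⟩,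
      δs ++ [0], by simp, S, _, hS, DecGr.isOp_ofOp hT, h'⟩

theorem commute_prod_linOp (he : CompleteOrthogonalIdempotents e) (γs δs : List (Fin m → ℂ)) :
    Commute (γs.map (linOp e)).prod (δs.map (linOp e)).prod :=
  Commute.list_prod_left _ _ fun _ hx => Commute.list_prod_right _ _ fun _ hy => by
    obtain ⟨γ, -, rfl⟩ := List.mem_map.1 hx
    obtain ⟨δ, -, rfl⟩ := List.mem_map.1 hy
    exact commute_linOp he γ δ

theorem common_successor_trans [Nontrivial R] (he : CompleteOrthogonalIdempotents e)
    {Φ Ψ Ω : DecGr R} (h₁ : ∃ Θ : DecGr R, Prec e Φ Θ ∧ Prec e Ψ Θ)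
    (h₂ : ∃ Θ : DecGr R, Prec e Ψ Θ ∧ Prec e Ω Θ) : ∃ Θ : DecGr R, Prec e Φ Θ ∧ Prec e Ω Θ := by
  obtain ⟨P, hP⟩ := Φ.exists_isOp
  obtain ⟨S, hS⟩ := Ψ.exists_isOp
  obtain ⟨Q, hQ⟩ := Ω.exists_isOp
  rw [exists_common_successor_iff hP hS] at h₁
  rw [exists_common_successor_iff hS hQ] at h₂
  rw [exists_common_successor_iff hP hQ]
  obtain ⟨γs, δs, h₁⟩ := h₁
  obtain ⟨δs', εs, h₂⟩ := h₂
  refine ⟨γs ++ δs', εs ++ δs, ?_⟩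
  rw [List.map_append, List.map_append, List.prod_append, List.prod_append, ← mul_assoc,
    ← mul_assoc, h₁, ← h₂, mul_assoc, mul_assoc, (commute_prod_linOp he δs δs').eq]

/-- Points with a common successor `T exp(xz)` have a normalization in common: one frame of `ker T`
serves both. -/
theorem SameNorm.of_common_successor [Nontrivial R] [FiniteDimensional ℂ R]
    (he : CompleteOrthogonalIdempotents e) (hprim : ∀ k, IsPrimitiveIdem (e k)) {Φ Ψ : DecGr R}
    (h : ∃ Θ : DecGr R, Prec e Φ Θ ∧ Prec e Ψ Θ) : SameNorm e Φ Ψ := by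
  obtain ⟨P, hP⟩ := Φ.exists_isOp
  obtain ⟨S, hS⟩ := Ψ.exists_isOp
  obtain ⟨γs, δs, h⟩ := (exists_common_successor_iff hP hS).1 h
  have hT := hP.1.mul_prod_linOp (e := e) γs
  have hγ : ∀ k, (exponents γs k).toEnumFinset ⊆
      (exponents γs k ∪ exponents δs k).toEnumFinset := fun k =>
    Multiset.toEnumFinset_mono Multiset.le_union_left
  have hδ : ∀ k, (exponents δs k).toEnumFinset ⊆
      (exponents γs k ∪ exponents δs k).toEnumFinset := fun k =>
    Multiset.toEnumFinset_mono Multiset.le_union_right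
  obtain ⟨n, hn, p, α, hf, hJ⟩ := hT.exists_quasi_frame he hprim
    (J := fun k => (exponents γs k ∪ exponents δs k).toEnumFinset) (fun k t ht => by
      -- by maximality of the multiplicity, `t` belongs to `γs` or to `δs`
      rw [Multiset.mem_toEnumFinset, Multiset.count_union, lt_max_iff,
        ← Multiset.mem_toEnumFinset, ← Multiset.mem_toEnumFinset] at ht
      rcases ht with ht | ht
      · rw [Module.End.mul_apply, prod_linOp_quasi_monomial he ht, map_zero]
      · rw [h, Module.End.mul_apply, prod_linOp_quasi_monomial he ht, map_zero])
  have hX : ∀ k, Fintype.card ((exponents γs k ∪ exponents δs k).toEnumFinset ⊕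
      Fin (n - (exponents γs k ∪ exponents δs k).toEnumFinset.card)) = n := fun k => by
    rw [Fintype.card_sum, Fintype.card_coe, Fintype.card_fin]
    exact Nat.add_sub_cancel' (hn k)
  exact ⟨_, isNormalization_of_isFrame he hP rfl hX hf
      (fun k => ⟨fun t => Sum.inl ⟨t, hγ k t.2⟩, fun s t hst =>
        Subtype.ext (Subtype.ext_iff.1 (Sum.inl_injective hst) :)⟩) (fun k t => hJ k ⟨t, hγ k t.2⟩),
    isNormalization_of_isFrame he hS h hX hf
      (fun k => ⟨fun t => Sum.inl ⟨t, hδ k t.2⟩, fun s t hst =>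
        Subtype.ext (Subtype.ext_iff.1 (Sum.inl_injective hst) :)⟩) (fun k t => hJ k ⟨t, hδ k t.2⟩)⟩

theorem normFactor_eq_diagElt {l : ℕ} (α : Fin m → Fin l → ℂ) (z : ℂ) :
    normFactor e α z = diagElt e fun k =>
      (((List.ofFn fun j k => α k j).map fun γ : Fin m → ℂ => z - γ k).prod) := by
  simp only [List.map_ofFn, List.prod_ofFn]
  rfl

/-- Two functions that become equal after division by scalar factors become equal after
multiplication by such factors. -/
theorem SameNorm.common_successor [Nontrivial R] (he : CompleteOrthogonalIdempotents e)
    {Φ Ψ : DecGr R} (h : SameNorm e Φ Ψ) : ∃ Θ : DecGr R, Prec e Φ Θ ∧ Prec e Ψ Θ := by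
  obtain ⟨N, ⟨P, hP, l, -, α, -, -, -, -, hN⟩, S, hS, l', -, β, -, -, -, -, hN'⟩ := h
  rw [exists_common_successor_iff hP hS]
  refine ⟨List.ofFn fun j k => β k j, List.ofFn fun j k => α k j, ?_⟩
  rw [hN', Germ.coe_eq] at hN
  have hfin : ((⋃ k, Set.range (α k)) ∪ ⋃ k, Set.range (β k)).Finite :=
    (Set.finite_iUnion fun k => Set.finite_range _).union
      (Set.finite_iUnion fun k => Set.finite_range _)
  have hZ := Filter.inter_mem hN hfin.compl_mem_codiscrete
  refine (hP.1.mul_prod_linOp _).eq_of_wave_eq (hS.1.mul_prod_linOp _)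
    (infinite_of_mem_codiscrete hZ) fun z hz => ?_
  obtain ⟨hz, hz'⟩ := hz
  have hα : ∀ k, ∏ j, (z - α k j) ≠ 0 := fun k => Finset.prod_ne_zero_iff.2 fun j _ h =>
    hz' (Or.inl (Set.mem_iUnion.2 ⟨k, j, (sub_eq_zero.1 h).symm⟩))
  have hβ : ∀ k, ∏ j, (z - β k j) ≠ 0 := fun k => Finset.prod_ne_zero_iff.2 fun j _ h =>
    hz' (Or.inr (Set.mem_iUnion.2 ⟨k, j, (sub_eq_zero.1 h).symm⟩))
  rw [wave_mul_prod_linOp he hP.1, wave_mul_prod_linOp he hS.1, ← normFactor_eq_diagElt,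
    ← normFactor_eq_diagElt]
  change wave P z * constR (diagElt e fun k => ∏ j, (z - β k j)) =
    wave S z * constR (diagElt e fun k => ∏ j, (z - α k j))
  change Ψ.1 z * constR (Ring.inverse (diagElt e fun k => ∏ j, (z - β k j))) =
    Φ.1 z * constR (Ring.inverse (diagElt e fun k => ∏ j, (z - α k j))) at hz
  rw [inverse_diagElt he hα, inverse_diagElt he hβ, hP.2, hS.2] at hz
  have hmul := congrArg (· * constR (diagElt e ((fun k => ∏ j, (z - α k j)) *
    fun k => ∏ j, (z - β k j)))) hz
  simp only [mul_assoc, ← constR_mul, ← diagElt_mul he] at hmul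
  have hu : ∀ {u : Fin m → ℂ} (w : Fin m → ℂ), (∀ k, u k ≠ 0) → u⁻¹ * (u * w) = w :=
    fun w h => funext fun k => inv_mul_cancel_left₀ (h k) _
  rw [hu _ hα, mul_comm (fun k => ∏ j, (z - α k j)), hu _ hβ] at hmul
  exact hmul.symm

theorem sameNorm_iff [Nontrivial R] [FiniteDimensional ℂ R]
    (he : CompleteOrthogonalIdempotents e) (hprim : ∀ k, IsPrimitiveIdem (e k)) {Φ Ψ : DecGr R} :
    SameNorm e Φ Ψ ↔ ∃ Θ : DecGr R, Prec e Φ Θ ∧ Prec e Ψ Θ :=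
  ⟨fun h => h.common_successor he, SameNorm.of_common_successor he hprim⟩

theorem sameNorm_equivalence [Nontrivial R] [FiniteDimensional ℂ R]
    (he : CompleteOrthogonalIdempotents e) (hprim : ∀ k, IsPrimitiveIdem (e k)) :
    Equivalence (SameNorm e) where
  refl Φ := by
    obtain ⟨P, hP⟩ := Φ.exists_isOp
    exact (sameNorm_iff he hprim).2 ((exists_common_successor_iff hP hP).2 ⟨[], [], rfl⟩)
  symm := fun ⟨N, h₁, h₂⟩ => ⟨N, h₂, h₁⟩
  trans h₁ h₂ := by
    rw [sameNorm_iff he hprim] at h₁ h₂ ⊢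
    exact common_successor_trans he h₁ h₂

end Fibers

theorem theoremB {R : Type*} [Ring R] [Algebra ℂ R] [FiniteDimensional ℂ R] [Nontrivial R]
    {m : ℕ} (e : Fin m → R) (he : CompleteOrthogonalIdempotents e)
    (hprim : ∀ i, IsPrimitiveIdem (e i)) :
    -- the relation is a strict partial order
    IsStrictOrder (DecGr R) (Prec e) ∧
    -- the fibers of the normalization map
    (∀ Φ : DecGr R,
      (∃ N, IsNormalization e Φ N) ∧
      (∀ Ψ : DecGr R, piNorm e Ψ = piNorm e Φ ↔
        ∃ N, IsNormalization e Φ N ∧ IsNormalization e Ψ N) ∧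
      piNorm e ⁻¹' {piNorm e Φ} = {Ψ | ∃ Θ : DecGr R, Prec e Φ Θ ∧ Prec e Ψ Θ}) ∧
    -- the immediate successors and their kernels
    (∀ Φ : DecGr R, ∃ s : (Fin m → ℂ) → DecGr R,
      Function.Injective s ∧ Set.range s = {Ψ | ImmSucc e Φ Ψ} ∧
      ∀ γ : Fin m → ℂ, SuccVia e [γ] Φ (s γ) ∧
        ∀ (n : ℕ) (p : Fin n → R[X]) (α : Fin n → ℂ) (i : Fin n → Fin m),
          iSupIndep (summand e p α i) →
          Φ.CorrespondsTo (⨆ k, summand e p α i k) →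
          iSupIndep (succSummand e p α i γ) ∧
          (s γ).CorrespondsTo (⨆ k, succSummand e p α i γ k)) := by
  have hequiv := sameNorm_equivalence he hprim
  have hπ : ∀ Φ Ψ : DecGr R, piNorm e Ψ = piNorm e Φ ↔ SameNorm e Φ Ψ := fun Φ Ψ => by
    refine Quot.eq.trans ?_
    rw [hequiv.eqvGen_iff]
    exact ⟨hequiv.symm, hequiv.symm⟩
  refine ⟨isStrictOrder_prec e, fun Φ => ⟨?_, hπ Φ, ?_⟩,
    immediate_successors he fun k => (hprim k).2.1⟩
  · obtain ⟨N, hN, -⟩ := hequiv.refl Φ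
    exact ⟨N, hN⟩
  · ext Ψ
    exact (hπ Φ Ψ).trans (sameNorm_iff he hprim)
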